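/- Let $1<\alpha\le 2$ and $\omega\ge 2$ be real numbers. Let $L/K$ be a finite Galois extension with a fixed isomorphism $G=\mathrm{Gal}(L/K)\cong(\mathbb Z/2\mathbb Z)^m$, let $\theta_1,\dots,\theta_m\in G$ correspond to the unit vectors, and put $N=2^m=[L:K]$. Let $\gamma_1,\dots,\gamma_m\in L$ satisfy $\theta_j(\gamma_i)=\gamma_i$ for $j\ne i$ and * if $\operatorname{char}K\neq2$: $\gamma_i\neq 0$, $\gamma_i^2\in K$, $\theta_i(\gamma_i)=-\gamma_i$; put $\bar\gamma_i=-\gamma_i$; * if $\operatorname{char}K=2$: $\gamma_i^2+\gamma_i\in K$, $\theta_i(\gamma_i)=\gamma_i+1$; put $\bar\gamma_i=\gamma_i+1$. For $S\subseteq\{1,\dots,m\}$ the field $K_S=K(\gamma_i:i\in S)$ is equipped with the $K$-basis of the monomials $\prod_{i\in A}\gamma_i$, $A\subseteq S$; in particular $L=K_{\{1,\dots,m\}}$ has a basis $\mathcal B$. Algorithms are algebraic computation trees over $K$: a step loads a constant of $K$, performs one of $+,-,\times,/$ in $K$ (never dividing by $0$), tests an element for zero, or, for randomized algorithms, draws a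 uniform element of a finite nonempty subset of $K$; each step counts as one operation in $K$. Let $\mathcal M_K(K_S)$ be the least number of operations in $K$ (worst case, deterministic) with which the product of two elements of $K_S$, given by coordinates in the above basis, can be computed. For $0\le r\le m$ let $\mathrm{RM}(r,m)$ be the set of elements $\sum_{g\in G}f_g\,g$ ($f_g\in L$) of the skew group algebra $L[G]$ with $f_g=0$ whenever the Hamming weight of $g\in(\mathbb Z/2\mathbb Z)^m$ exceeds $r$, each identified with the matrix in $K^{N\times N}$, with respect to $\mathcal B$, of the $K$-linear map $x\mapsto\sum_g f_g\,g(x)$ of $L$. (It has minimum rank distance $2^{m-r}$.) *Foldings.* Write a $2^{k}\times2^{k}$ matrix $E$ over $L$ ($k\ge1$; rows and columns indexed by the subsets of $\{1,\dots,k\}$) in four blocks according to whether the row and column index contains $k$. Its two foldings are the $2^{k-1}\times2^{k-1}$ matrices $$\begin{pmatrix}a^{-1}I& I\end{pmatrix}E\begin{pmatrix}I\\-a^{-1}I\end{pmatrix}\ (\operatorname{char}K\ne2),\qquad \begin{pmatrix}I& aI\end{pmatrix}E\begin{pmatrix}I\\a^{-1}I\end{pmatrix}\ (\operatorname{char}K=2),\qquad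 a\in\{\gamma_k,\bar\gamma_k\}.$$ *Assumption on the error.* $E\in K^{N\times N}$, and all iterated foldings of $E$ of depth at most $r$ (including $E$ itself) have the same rank $t$, where $t<2^{m-r}/2$. Suppose that, with a constant $c_\omega$, for every $n$ the product of two $n\times n$ matrices over $L$ can be computed by an arithmetic circuit ($+,-,\times$ and constants) with at most $c_\omega n^\omega$ operations in $L$, and that for every $\varepsilon>0$, with a constant $c_\varepsilon$, $\mathcal M_K(K_S)\le c_\varepsilon\,[K_S:K]^{\alpha+\varepsilon}$ for all $S\subseteq\{1,\dots,m\}$. Then, with constants in $\mathcal O$ depending only on $\alpha,\omega,c_\omega$ and the function $\varepsilon\mapsto c_\varepsilon$ (and not on $K,L,m,r,\gamma,t$), and with $\tau=\max(t,1)$: 1. There is a deterministic algorithm that, for every $C\in\mathrm{RM}(r,m)$ and every $E$ satisfying the assumption, computes $C$ from $C+E$ (without being given $t$) in $$\begin{cases}\mathcal O\big(N^\omega+\tau^{\omega-1}N\log N\,\mathcal M_K(L)\big)&\text{if }\alpha<\omega-1,\\ \mathcal O\big(N^{\alpha+1}+\tau^{\omega-1}N\log N\,\mathcal M_K(L)\big)&\text{otherwise}\end{cases}$$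 operations in $K$. 2. There is a Las Vegas algorithm (the output is always correct) that does the same with an expected number of $$\mathcal O\big(\tau^{\omega-1}N\log N\,\mathcal M_K(L)\big)$$ operations in $K$. -/

import Mathlib

universe u v

/-! ### Arithmetic programs

Algebraic computation trees over a field `F`, with inputs indexed by `ι` and outputs indexed by `κ`.
The input registers `Sum.inl i` are read-only; the work registers `Sum.inr d` start at `0`.
The only access to the data is by arithmetic operations, loading constants, tests for zero and
sampling of random elements; the shape of the tree does not see the values. -/

/-- The four arithmetic operations of a field. -/
inductive ArithOp
  | add
  | sub
  | mul
  | div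

def ArithOp.eval {F : Type u} [Field F] : ArithOp → F → F → F
  | .add, x, y => x + y
  | .sub, x, y => x - y
  | .mul, x, y => x * y
  | .div, x, y => x / y

inductive Prog (F : Type u) (ι κ : Type) : Type u
  /-- stop; the `k`-th output is the content of register `out k` -/
  | ret (out : κ → ι ⊕ ℕ) : Prog F ι κ
  /-- load the constant `c` into the work register `d` -/
  | const (d : ℕ) (c : F) (p : Prog F ι κ) : Prog F ι κ
  /-- apply `o` to the contents of `a` and `b`, store the result in the work register `d` -/
  | arith (o : ArithOp) (d : ℕ) (a b : ι ⊕ ℕ) (p : Prog F ι κ) : Prog F ι κ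
  /-- continue with `p` if the content of `a` is zero and with `q` otherwise -/
  | test (a : ι ⊕ ℕ) (p q : Prog F ι κ) : Prog F ι κ
  /-- store a uniformly distributed random element of the finite set `S` in the work register `d`,
  independently of everything sampled before -/
  | sample (d : ℕ) (S : Finset F) (hS : S.Nonempty) (p : Prog F ι κ) : Prog F ι κ

namespace Prog

variable {F : Type u} {ι κ : Type}

/-- Write `x` into the work register `d`. -/
def write (σ : ι ⊕ ℕ → F) (d : ℕ) (x : F) : ι ⊕ ℕ → F :=
  Sum.elim (fun i => σ (Sum.inl i)) (Function.update (fun n => σ (Sum.inr n)) d x)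

/-- The initial register contents on input `x`. -/
def init [Zero F] (x : ι → F) : ι ⊕ ℕ → F := Sum.elim x (fun _ => 0)

/-- From the register contents `σ`, every run (whatever the random choices) is free of divisions by
zero and ends with output `y`. -/
def Yields [Field F] : Prog F ι κ → (ι ⊕ ℕ → F) → (κ → F) → Prop
  | ret out, σ, y => ∀ k, σ (out k) = y k
  | const d c p, σ, y => p.Yields (write σ d c) y
  | arith o d a b p, σ, y =>
      (o = ArithOp.div → σ b ≠ 0) ∧ p.Yields (write σ d (o.eval (σ a) (σ b))) y
  | test a p q, σ, y => (σ a = 0 → p.Yields σ y) ∧ (σ a ≠ 0 → q.Yields σ y)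
  | sample d S _ p, σ, y => ∀ s ∈ S, p.Yields (write σ d s) y

open Classical in
/-- Expected number of operations in `F` performed from the register contents `σ`; every constant,
arithmetic operation, test and sampling counts for one. Without `sample` this is the exact
number of operations performed. -/
noncomputable def costFrom [Field F] : Prog F ι κ → (ι ⊕ ℕ → F) → ℝ
  | ret _, _ => 0
  | const d c p, σ => 1 + p.costFrom (write σ d c)
  | arith o d a b p, σ => 1 + p.costFrom (write σ d (o.eval (σ a) (σ b)))
  | test a p q, σ => 1 + if σ a = 0 then p.costFrom σ else q.costFrom σ
  | sample d S _ p, σ => 1 + (∑ s ∈ S, p.costFrom (write σ d s)) / (S.card : ℝ)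

/-- On input `x`, every run outputs `y`. -/
def Outputs [Field F] (P : Prog F ι κ) (x : ι → F) (y : κ → F) : Prop := P.Yields (init x) y

/-- The (expected) number of operations on input `x`. -/
noncomputable def cost [Field F] (P : Prog F ι κ) (x : ι → F) : ℝ := P.costFrom (init x)

/-- The program uses no randomness. -/
def IsDeterministic : Prog F ι κ → Prop
  | ret _ => True
  | const _ _ p => p.IsDeterministic
  | arith _ _ _ _ p => p.IsDeterministic
  | test _ p q => p.IsDeterministic ∧ q.IsDeterministic
  | sample _ _ _ _ => False

/-- The program is an arithmetic circuit: straight-line, with constants, `+`, `-` and `*` only. -/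
def IsCircuit : Prog F ι κ → Prop
  | ret _ => True
  | const _ _ p => p.IsCircuit
  | arith o _ _ _ p => o ≠ ArithOp.div ∧ p.IsCircuit
  | test _ _ _ => False
  | sample _ _ _ _ => False

end Prog

/-- For every `n`, an arithmetic circuit with at most `c * n ^ ω` operations in `F` multiplies
`n × n` matrices over `F`. -/
def HasMatMulCost (F : Type u) [Field F] (ω c : ℝ) : Prop :=
  ∀ n : ℕ, ∃ P : Prog F ((Fin n × Fin n) ⊕ (Fin n × Fin n)) (Fin n × Fin n),
    P.IsCircuit ∧ ∀ A B : Matrix (Fin n) (Fin n) F,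
      P.Outputs (Sum.elim (Function.uncurry A) (Function.uncurry B)) (Function.uncurry (A * B)) ∧
      P.cost (Sum.elim (Function.uncurry A) (Function.uncurry B)) ≤ c * (n : ℝ) ^ ω

/-- For a `K`-basis `b` of a subfield of `L`: the number of operations in `K` that a multiplication
in this subfield costs, i.e. the least `n` such that the `b`-coordinates of a product can be computed
from those of the two factors by a deterministic program with at most `n` operations in `K`. -/
noncomputable def mulCost (K : Type u) {L : Type v} [Field K] [Field L] [Algebra K L]
    {ι : Type} [Fintype ι] (b : ι → L) : ℕ :=
  sInf {n : ℕ | ∃ P : Prog K (ι ⊕ ι) ι, P.IsDeterministic ∧ ∀ x y : ι → K,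
    P.cost (Sum.elim x y) ≤ (n : ℝ) ∧
    ∃ z : ι → K, P.Outputs (Sum.elim x y) z ∧
      ∑ i, z i • b i = (∑ i, x i • b i) * (∑ i, y i • b i)}

/-! ### Binary rank metric Reed–Muller codes -/

section Codes

variable {K : Type u} {L : Type v} [Field K] [Field L] [Algebra K L]

/-- The monomial `∏ γ i ^ (A i)`, `A i ∈ {0, 1}`. -/
def mon {ι : Type} [Fintype ι] (γ : ι → L) (A : ι → Bool) : L :=
  ∏ i, if A i then γ i else 1

/-- The generator `θ i` of the Galois group corresponding to the `i`-th unit vector. -/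
def galGen {m : ℕ} (e : (L ≃ₐ[K] L) ≃* Multiplicative (Fin m → ZMod 2)) (i : Fin m) : L ≃ₐ[K] L :=
  e.symm (Multiplicative.ofAdd (Pi.single i 1))

/-- Hamming weight of an element of the Galois group seen as a vector of `(ℤ/2ℤ)^m`. -/
def galWeight {m : ℕ} (e : (L ≃ₐ[K] L) ≃* Multiplicative (Fin m → ZMod 2)) (g : L ≃ₐ[K] L) : ℕ :=
  hammingNorm (Multiplicative.toAdd (e g))

/-- Quadratic generators `γ` of `L` over `K` adapted to the generators `θ i` of the Galois group:
square roots (Kummer) if `char K ≠ 2`, Artin–Schreier generators if `char K = 2`. -/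
structure IsAdapted {m : ℕ} (e : (L ≃ₐ[K] L) ≃* Multiplicative (Fin m → ZMod 2))
    (γ : Fin m → L) : Prop where
  kummer : ringChar K ≠ 2 → ∀ i, γ i ≠ 0 ∧ γ i ^ 2 ∈ (algebraMap K L).range ∧
    ∀ j, galGen e j (γ i) = if j = i then -γ i else γ i
  artinSchreier : ringChar K = 2 → ∀ i, γ i ^ 2 + γ i ∈ (algebraMap K L).range ∧
    ∀ j, galGen e j (γ i) = if j = i then γ i + 1 else γ i

/-- The Reed–Muller code of order `r`: the `L`-subspace of the skew group algebra `L[G]` of the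
elements supported on group elements of Hamming weight at most `r`. -/
def rmCode {m : ℕ} (e : (L ≃ₐ[K] L) ≃* Multiplicative (Fin m → ZMod 2)) (r : ℕ) :
    Submodule L (SkewMonoidAlgebra L (L ≃ₐ[K] L)) where
  carrier := {f | ∀ g, f.coeff g ≠ 0 → galWeight e g ≤ r}
  zero_mem' := fun g hg => absurd (by simp) hg
  add_mem' := fun {a b} ha hb g hg => by
    by_cases h : a.coeff g = 0
    · exact hb g fun h' => hg (by simp [SkewMonoidAlgebra.coeff_add, h, h'])
    · exact ha g h
  smul_mem' := fun c a ha g hg =>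
    ha g fun h => hg (by simp [SkewMonoidAlgebra.coeff_smul, h])

/-- The map `x ↦ ∑ f_g g(x)` on `L` given by an element `f = ∑ f_g g` of `L[G]`. -/
def skewApply (f : SkewMonoidAlgebra L (L ≃ₐ[K] L)) (x : L) : L :=
  f.coeff.sum fun g c => c * g x

/-- The code in its matrix form: the matrices over `K` of the maps `skewApply f`, `f ∈ rmCode e r`,
with respect to the basis `mon γ` of `L`. Column `B` holds the coordinates of the image of
`mon γ B`. -/
def rmMatrices {m : ℕ} (e : (L ≃ₐ[K] L) ≃* Multiplicative (Fin m → ZMod 2)) (γ : Fin m → L)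
    (r : ℕ) : Set (Matrix (Fin m → Bool) (Fin m → Bool) K) :=
  {Y | ∃ f ∈ rmCode e r, ∀ B, skewApply f (mon γ B) = ∑ A, Y A B • mon γ A}

/-! ### Foldings

A matrix indexed by `Fin (k + 1) → Bool` is a 2 × 2 block matrix; the last bit of the row (column)
index is the index of the block row (block column). -/

/-- The product `(u₀ I  u₁ I) * E * (v₀ I ; v₁ I)` with the blocks of `E`. -/
def blockFold {k : ℕ} (u v : Bool → L)
    (E : Matrix (Fin (k + 1) → Bool) (Fin (k + 1) → Bool) L) :
    Matrix (Fin k → Bool) (Fin k → Bool) L :=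
  Matrix.of fun A B => ∑ x : Bool, ∑ y : Bool,
    u x * E (Fin.snoc (α := fun _ => Bool) A x) (Fin.snoc (α := fun _ => Bool) B y) * v y

open Classical in
/-- The folding attached to `a`: `(a⁻¹ I  I) * E * (I ; -a⁻¹ I)` if the characteristic is not `2` and
`(I  a I) * E * (I ; a⁻¹ I)` if it is `2`. -/
noncomputable def fold {k : ℕ} (a : L)
    (E : Matrix (Fin (k + 1) → Bool) (Fin (k + 1) → Bool) L) :
    Matrix (Fin k → Bool) (Fin k → Bool) L :=
  if ringChar L = 2 then
    blockFold (fun x => if x then a else 1) (fun y => if y then a⁻¹ else 1) E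
  else
    blockFold (fun x => if x then 1 else a⁻¹) (fun y => if y then -a⁻¹ else 1) E

open Classical in
/-- The conjugate of a quadratic generator. -/
noncomputable def conjGen (a : L) : L := if ringChar L = 2 then a + 1 else -a

/-- All iterated foldings of `E` (with respect to the last generator and its conjugate, then to the
last but one, and so on) of depth at most `r` have rank `t`; depth `0` is `E` itself. -/
def FoldingsHaveRank (t : ℕ) : (r k : ℕ) → (Fin k → L) →
    Matrix (Fin k → Bool) (Fin k → Bool) L → Prop
  | 0, _, _, E => E.rank = t
  | _ + 1, 0, _, E => E.rank = t
  | r + 1, k + 1, γ, E => E.rank = t ∧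
      FoldingsHaveRank t r k (Fin.init γ) (fold (γ (Fin.last k)) E) ∧
      FoldingsHaveRank t r k (Fin.init γ) (fold (conjGen (γ (Fin.last k))) E)

/-- On every input `C + E`, where `C` is a codeword and `E` an error of rank `t` less than half the
minimum distance `2 ^ (m - r)` all of whose iterated foldings of depth at most `r` have rank `t`,
the program `P` outputs `C` after at most `bound t` (expected) operations in `K`. The program is not
told `t`. -/
def DecodesWithin {m : ℕ} (e : (L ≃ₐ[K] L) ≃* Multiplicative (Fin m → ZMod 2)) (γ : Fin m → L)
    (r : ℕ) (bound : ℕ → ℝ)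
    (P : Prog K ((Fin m → Bool) × (Fin m → Bool)) ((Fin m → Bool) × (Fin m → Bool))) : Prop :=
  ∀ C ∈ rmMatrices e γ r, ∀ (E : Matrix (Fin m → Bool) (Fin m → Bool) K) (t : ℕ),
    2 * t < 2 ^ (m - r) →
    FoldingsHaveRank t r m γ (E.map (algebraMap K L)) →
      P.Outputs (Function.uncurry (C + E)) (Function.uncurry C) ∧
      P.cost (Function.uncurry (C + E)) ≤ bound t

end Codes

universe w

/-! ### Knowledge states

An algebraic computation tree is described by what it knows at a node: the set `dom` of instances
that reach the node and the set `vals` of functions of the instance held in the registers. -/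

/-! Number the generators from 0 and let F_h be the fixed field of θ_0, …, θ_{h-1}. Then F_0 = L,
F_m = K and F_h = F_{h+1}(γ_h). Every F_{h+1}-linear map g of L is uniquely g₀ + g₁ ∘ θ_h with
F_h-linear g₀ and g₁ (`comp₀`, `comp₁`). As in the Plotkin construction, this splits a Reed–Muller
map of order r at level h+1 into one of order r and one of order r-1 at level h. Up to a nonzero
scalar the matrix of g₁ is the folding at γ_h (`exists_fold_eq_smul`). Hence the assumption gives
that all iterated components E₁ of the error have the same rank t over their respective fields
(`rankChain_of_foldings`).

Decoding (`run_decode`) treats the component of order r-1 first, after which E₁ is known. Because E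
and E₁ have equal rank, over F_{h+1} and F_h respectively, a dimension count identifies the kernel
of E₁ ∘ θ_h with the largest F_h-subspace of the kernel of E, so E₀ vanishes on it
(`comp₀_eq_zero_of_comp₁`). The component of order r is therefore received with an error that
vanishes on the orthogonal complement of at most t known vectors.

Such an erasure problem (`run_erase`) is again split into its two components. The orthogonality
conditions at level h+1 become linear conditions on pairs (x, y) for the value E₀x + E₁y (`comp_eq`,
`dot_succ`). Elimination on these conditions gives vectors whose complement E₁ kills, and, once E₁
is known, a formula for E₀ on the complement of the remaining vectors. For order zero the codeword
is multiplication by f, and f = Y(x)/x for any nonzero x in the complement.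

For order zero with an unknown error (`run_base_decode`) the graph of the received map Y is viewed
as a subspace X of L × L. Passing from F_{h+1} to F_h, X is replaced by the two spaces X + γX and X
∩ γ⁻¹X. The quantity 2 dim (image of X under (z, y) ↦ y - fz) + 2^m - dim X, the `defect`, is
nonnegative, equals twice the rank of the error for the graph, and its sum over the two new spaces
is at most twice the old value (`defect_up_add_defect_down`). At the bottom there are 2^h subspaces
of the plane L × L. Each one that is the graph of a multiplication votes for its slope and the
others abstain. The defect bound, together with 2t < 2^h, makes f the strict majority, and the votes
are merged in pairs as in the Boyer–Moore algorithm (`run_base`).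

All spaces are kept as lists of O(t) vectors. The number of calls doubles per level while 2^h
halves, so the total is O((t+1) 2^m (m+1)) operations in L (`decodeCost_le`). A multiplication
program must depend on at least half as many coordinates as a basis has elements
(`card_le_two_mul_mulCost`), so one operation in L, including additions and zero tests, costs at
most 2 M_K(L). Since ω ≥ 2 one has t + 1 ≤ 2τ^{ω-1}; thus a single deterministic decoder stays
within the bound of the second claim, and a fortiori within that of the first. -/

structure KState (Ω : Type w) (K : Type u) [Zero K] where
  dom : Set Ω
  vals : Set (Ω → K)
  zero_mem : (fun _ => 0) ∈ vals

namespace KState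

variable {Ω : Type w} {K : Type u} [Field K]

instance : Preorder (KState Ω K) where
  le S S' := S'.dom ⊆ S.dom ∧ S.vals ⊆ S'.vals
  le_refl S := ⟨subset_rfl, subset_rfl⟩
  le_trans _ _ _ h h' := ⟨h'.1.trans h.1, h.2.trans h'.2⟩

/-- The function `f` is available on the instances that reach the state. -/
def Knows (S : KState Ω K) (f : Ω → K) : Prop := ∃ g ∈ S.vals, ∀ ω ∈ S.dom, g ω = f ω

lemma Knows.mono {S S' : KState Ω K} (h : S ≤ S') {f : Ω → K} (hf : S.Knows f) : S'.Knows f := by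
  obtain ⟨g, hg, hgf⟩ := hf
  exact ⟨g, h.2 hg, fun ω hω => hgf ω (h.1 hω)⟩

lemma Knows.congr {S : KState Ω K} {f f' : Ω → K} (hf : S.Knows f)
    (h : ∀ ω ∈ S.dom, f ω = f' ω) : S.Knows f' := by
  obtain ⟨g, hg, hgf⟩ := hf
  exact ⟨g, hg, fun ω hω => (hgf ω hω).trans (h ω hω)⟩

lemma knows_zero (S : KState Ω K) : S.Knows (fun _ => 0) := ⟨_, S.zero_mem, fun _ _ => rfl⟩

/-- Add the function `f` to the available values. -/
def learn (S : KState Ω K) (f : Ω → K) : KState Ω K :=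
  ⟨S.dom, insert f S.vals, Set.mem_insert_of_mem _ S.zero_mem⟩

/-- Restrict to the instances in `A`. -/
def restrict (S : KState Ω K) (A : Set Ω) : KState Ω K := ⟨S.dom ∩ A, S.vals, S.zero_mem⟩

lemma le_learn (S : KState Ω K) (f : Ω → K) : S ≤ S.learn f :=
  ⟨subset_rfl, Set.subset_insert _ _⟩

lemma le_restrict (S : KState Ω K) (A : Set Ω) : S ≤ S.restrict A :=
  ⟨Set.inter_subset_left, subset_rfl⟩

lemma learn_knows (S : KState Ω K) (f : Ω → K) : (S.learn f).Knows f :=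
  ⟨f, Set.mem_insert _ _, fun _ _ => rfl⟩

end KState

open KState

/-- `KRun G S c`: from the state `S` the functions `G` can be computed by a deterministic tree with
at most `c ω` operations on the instance `ω`. -/
inductive KRun {Ω : Type w} {K : Type u} [Field K] {κ : Type} (G : κ → Ω → K) :
    KState Ω K → (Ω → ℝ) → Prop
  | done {S c} : (∀ i, S.Knows (G i)) → (∀ ω ∈ S.dom, 0 ≤ c ω) → KRun G S c
  | const {S c c'} (a : K) : KRun G (S.learn fun _ => a) c → (∀ ω ∈ S.dom, c ω + 1 ≤ c' ω) →
      KRun G S c'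
  | arith {S c c'} (o : ArithOp) (f g : Ω → K) : S.Knows f → S.Knows g →
      (o = ArithOp.div → ∀ ω ∈ S.dom, g ω ≠ 0) →
      KRun G (S.learn fun ω => o.eval (f ω) (g ω)) c → (∀ ω ∈ S.dom, c ω + 1 ≤ c' ω) → KRun G S c'
  | test {S c c'} (f : Ω → K) : S.Knows f → KRun G (S.restrict {ω | f ω = 0}) c →
      KRun G (S.restrict {ω | f ω ≠ 0}) c → (∀ ω ∈ S.dom, c ω + 1 ≤ c' ω) → KRun G S c'

/-! ### Compilation of knowledge runs into trees, and subroutines -/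

namespace KRun

variable {Ω : Type w} {K : Type u} [Field K] {κ : Type} {G : κ → Ω → K}

lemma mono {S : KState Ω K} {c c' : Ω → ℝ} (h : KRun G S c) (hc : ∀ ω ∈ S.dom, c ω ≤ c' ω) :
    KRun G S c' := by
  cases h with
  | done h1 h2 => exact .done h1 fun ω hω => (h2 ω hω).trans (hc ω hω)
  | const a h1 h2 => exact .const a h1 fun ω hω => (h2 ω hω).trans (hc ω hω)
  | arith o f g hf hg h0 h1 h2 => exact .arith o f g hf hg h0 h1 fun ω hω => (h2 ω hω).trans (hc ω hω)
  | test f hf h1 h1' h2 => exact .test f hf h1 h1' fun ω hω => (h2 ω hω).trans (hc ω hω)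

lemma write_of_ne {F : Type u} {ι : Type} {σ : ι ⊕ ℕ → F} {d : ℕ} {x : F} {a : ι ⊕ ℕ} (h : a ≠ Sum.inr d) :
    Prog.write σ d x a = σ a := by
  cases a with
  | inl i => rfl
  | inr k => simp only [Prog.write, Sum.elim_inr]; exact Function.update_of_ne (fun hk => h (by rw [hk])) _ _

lemma write_self {F : Type u} {ι : Type} {σ : ι ⊕ ℕ → F} {d : ℕ} {x : F} :
    Prog.write σ d x (Sum.inr d) = x := by simp [Prog.write]

/-- Registers below `n` hold all available values. -/
def Holds {ι : Type} (S : KState Ω K) (n : ℕ) (env : Ω → ι ⊕ ℕ → K) : Prop :=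
  ∀ f ∈ S.vals, ∃ a : ι ⊕ ℕ, (∀ d, a = Sum.inr d → d < n) ∧ ∀ ω ∈ S.dom, env ω a = f ω

lemma Holds.knows {ι : Type} {S : KState Ω K} {n : ℕ} {env : Ω → ι ⊕ ℕ → K} (h : Holds S n env)
    {f : Ω → K} (hf : S.Knows f) :
    ∃ a : ι ⊕ ℕ, (∀ d, a = Sum.inr d → d < n) ∧ ∀ ω ∈ S.dom, env ω a = f ω := by
  obtain ⟨g, hg, hgf⟩ := hf
  obtain ⟨a, ha, hag⟩ := h g hg
  exact ⟨a, ha, fun ω hω => (hag ω hω).trans (hgf ω hω)⟩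

lemma Holds.learn {ι : Type} {S : KState Ω K} {n : ℕ} {env : Ω → ι ⊕ ℕ → K} (h : Holds S n env)
    (f : Ω → K) (x : Ω → K) (hx : ∀ ω ∈ S.dom, x ω = f ω) :
    Holds (S.learn f) (n + 1) (fun ω => Prog.write (env ω) n (x ω)) := by
  intro g hg
  rcases Set.mem_insert_iff.1 hg with rfl | hg
  · exact ⟨Sum.inr n, fun d hd => by cases hd; omega, fun ω hω => write_self.trans (hx ω hω)⟩
  · obtain ⟨a, ha, hag⟩ := h g hg
    refine ⟨a, fun d hd => (ha d hd).trans (by omega), fun ω hω => ?_⟩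
    exact (write_of_ne fun h' => absurd (ha n h') (by omega)).trans (hag ω hω)

/-- Every new value goes into a fresh register, the first one not below `n`, so nothing is
overwritten and whatever is known at a node stays readable in the whole subtree. -/
theorem exists_prog {ι : Type} {S : KState Ω K} {c : Ω → ℝ} (h : KRun G S c) (n : ℕ)
    (env : Ω → ι ⊕ ℕ → K) (henv : Holds S n env) :
    ∃ P : Prog K ι κ, P.IsDeterministic ∧ ∀ ω ∈ S.dom,
      P.Yields (env ω) (fun i => G i ω) ∧ P.costFrom (env ω) ≤ c ω := by
  induction h generalizing n env with
  | done h1 h2 =>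
    choose a ha using fun i => henv.knows (h1 i)
    exact ⟨.ret a, trivial, fun ω hω => ⟨fun k => (ha k).2 ω hω, h2 ω hω⟩⟩
  | const a h1 h2 ih =>
    obtain ⟨P, hP, hP'⟩ := ih (n + 1) (fun ω => Prog.write (env ω) n a)
      (henv.learn _ (fun _ => a) fun _ _ => rfl)
    refine ⟨.const n a P, hP, fun ω hω => ⟨(hP' ω hω).1, ?_⟩⟩
    have := (hP' ω hω).2
    have := h2 ω hω
    simp only [Prog.costFrom]
    linarith
  | arith o f g hf hg h0 h1 h2 ih =>
    obtain ⟨a, ha, haf⟩ := henv.knows hf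
    obtain ⟨b, hb, hbg⟩ := henv.knows hg
    obtain ⟨P, hP, hP'⟩ := ih (n + 1) (fun ω => Prog.write (env ω) n (o.eval (env ω a) (env ω b)))
      (henv.learn _ _ fun ω hω => by rw [haf ω hω, hbg ω hω])
    refine ⟨.arith o n a b P, hP, fun ω hω => ⟨⟨fun ho => ?_, (hP' ω hω).1⟩, ?_⟩⟩
    · rw [hbg ω hω]; exact h0 ho ω hω
    have := (hP' ω hω).2
    have := h2 ω hω
    simp only [Prog.costFrom]
    linarith
  | test f hf h1 h1' h2 ih ih' =>
    obtain ⟨a, ha, haf⟩ := henv.knows hf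
    obtain ⟨P, hP, hP'⟩ := ih n env fun g hg => by
      obtain ⟨b, hb, hbg⟩ := henv g hg
      exact ⟨b, hb, fun ω hω => hbg ω hω.1⟩
    obtain ⟨Q, hQ, hQ'⟩ := ih' n env fun g hg => by
      obtain ⟨b, hb, hbg⟩ := henv g hg
      exact ⟨b, hb, fun ω hω => hbg ω hω.1⟩
    refine ⟨.test a P Q, ⟨hP, hQ⟩, fun ω hω => ⟨⟨fun h => ?_, fun h => ?_⟩, ?_⟩⟩
    · rw [haf ω hω] at h; exact (hP' ω ⟨hω, h⟩).1
    · rw [haf ω hω] at h; exact (hQ' ω ⟨hω, h⟩).1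
    have := h2 ω hω
    simp only [Prog.costFrom]
    split_ifs with h
    · rw [haf ω hω] at h; have := (hP' ω ⟨hω, h⟩).2; linarith
    · rw [haf ω hω] at h; have := (hQ' ω ⟨hω, h⟩).2; linarith

lemma write_knows {ι : Type} {S : KState Ω K} {env : ι ⊕ ℕ → Ω → K} (h : ∀ a, S.Knows (env a))
    (d : ℕ) (f : Ω → K) (a : ι ⊕ ℕ) :
    (S.learn f).Knows (fun ω => Prog.write (fun a => env a ω) d (f ω) a) := by
  by_cases ha : a = Sum.inr d
  · subst ha
    exact (S.learn_knows f).congr fun ω _ => by rw [write_self]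
  · exact ((h a).mono (S.le_learn f)).congr fun ω _ => by rw [write_of_ne ha]

/-- A deterministic program can be used as a subroutine. -/
theorem of_prog {ι κ' : Type} (P : Prog K ι κ') (hP : P.IsDeterministic) (z : κ' → Ω → K)
    (c : Ω → ℝ) (S : KState Ω K) (n : ℝ) (env : ι ⊕ ℕ → Ω → K) (henv : ∀ a, S.Knows (env a))
    (hz : ∀ ω ∈ S.dom, P.Yields (fun a => env a ω) (fun k => z k ω) ∧
      P.costFrom (fun a => env a ω) ≤ n)
    (cont : ∀ S', S ≤ S' → (∀ k, S'.Knows (z k)) → KRun G S' c) :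
    KRun G S (fun ω => c ω + n) := by
  -- The continuation is inserted at every leaf of `P`. A test of `P` splits the set of instances,
  -- which is why the continuation must serve all later states.
  induction P generalizing S n env with
  | ret out =>
    refine (cont S le_rfl fun k => (henv (out k)).congr fun ω hω => (hz ω hω).1 k).mono
      fun ω hω => ?_
    have := (hz ω hω).2
    simp only [Prog.costFrom] at this
    linarith
  | const d a p ih =>
    refine .const (c := fun ω => c ω + (n - 1)) a ?_ fun ω _ => by linarith
    refine ih hP _ (n - 1) (fun b ω => Prog.write (fun a => env a ω) d a b)
      (write_knows henv d fun _ => a) (fun ω hω => ?_)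
      fun S' h' => cont S' ((S.le_learn _).trans h')
    have := hz ω hω
    simp only [Prog.costFrom, Prog.Yields] at this
    exact ⟨this.1, by linarith [this.2]⟩
  | arith o d a b p ih =>
    refine .arith (c := fun ω => c ω + (n - 1)) o (env a) (env b) (henv a) (henv b)
      (fun ho ω hω => (hz ω hω).1.1 ho) ?_ fun ω _ => by linarith
    refine ih hP _ (n - 1)
      (fun e ω => Prog.write (fun a => env a ω) d (o.eval (env a ω) (env b ω)) e)
      (write_knows henv d _) (fun ω hω => ?_)
      fun S' h' => cont S' ((S.le_learn _).trans h')
    have := hz ω hω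
    simp only [Prog.costFrom, Prog.Yields] at this
    exact ⟨this.1.2, by linarith [this.2]⟩
  | test a p q ih ih' =>
    refine .test (c := fun ω => c ω + (n - 1)) (env a) (henv a) ?_ ?_ fun ω _ => by linarith
    · refine ih hP.1 _ (n - 1) env (fun b => (henv b).mono (S.le_restrict _)) (fun ω hω => ?_)
        fun S' h' => cont S' ((S.le_restrict _).trans h')
      have := hz ω hω.1
      have h0 : env a ω = 0 := hω.2
      simp only [Prog.costFrom, Prog.Yields, h0, if_true] at this
      exact ⟨this.1.1 trivial, by linarith [this.2]⟩
    · refine ih' hP.2 _ (n - 1) env (fun b => (henv b).mono (S.le_restrict _)) (fun ω hω => ?_)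
        fun S' h' => cont S' ((S.le_restrict _).trans h')
      have := hz ω hω.1
      have h0 : env a ω ≠ 0 := hω.2
      simp only [Prog.costFrom, Prog.Yields, h0, if_false] at this
      exact ⟨this.1.2 h0, by linarith [this.2]⟩
  | sample => exact hP.elim

/-- Values computable with at most `n` operations, in continuation form. -/
def Computes (G : κ → Ω → K) (S : KState Ω K) {ι : Type*} (f : ι → Ω → K) (n : ℝ) : Prop :=
  ∀ S', S ≤ S' → ∀ c : Ω → ℝ, (∀ S'', S' ≤ S'' → (∀ i, S''.Knows (f i)) → KRun G S'' c) →
    KRun G S' (fun ω => c ω + n)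

lemma computes_of_knows {S : KState Ω K} {ι : Type*} {f : ι → Ω → K} (h : ∀ i, S.Knows (f i)) :
    Computes G S f 0 := fun S' h' c hc =>
  (hc S' le_rfl fun i => (h i).mono h').mono fun _ _ => by simp

lemma computes_const (S : KState Ω K) (a : K) : Computes G S (fun _ : Unit => fun _ => a) 1 :=
  fun S' _ _ hc => .const a (hc _ (S'.le_learn _) fun _ => S'.learn_knows _) fun _ _ => le_rfl

lemma computes_arith {S : KState Ω K} (o : ArithOp) {f g : Ω → K} (hf : S.Knows f)
    (hg : S.Knows g) (h0 : o = ArithOp.div → ∀ ω ∈ S.dom, g ω ≠ 0) :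
    Computes G S (fun _ : Unit => fun ω => o.eval (f ω) (g ω)) 1 :=
  fun S' h' _ hc => .arith o f g (hf.mono h') (hg.mono h') (fun ho ω hω => h0 ho ω (h'.1 hω))
    (hc _ (S'.le_learn _) fun _ => S'.learn_knows _) fun _ _ => le_rfl

lemma Computes.mono {S S' : KState Ω K} {ι : Type*} {f : ι → Ω → K} {n n' : ℝ}
    (h : Computes G S f n) (hS : S ≤ S') (hn : n ≤ n') : Computes G S' f n' :=
  fun S'' h' c hc => (h S'' (hS.trans h') c hc).mono fun _ _ => by simpa using hn

lemma Computes.trans {S : KState Ω K} {ι ι' : Type*} {f : ι → Ω → K} {g : ι' → Ω → K} {n n' : ℝ}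
    (h : Computes G S f n)
    (hg : ∀ S', S ≤ S' → (∀ i, S'.Knows (f i)) → Computes G S' g n') :
    Computes G S g (n + n') := fun S' h' c hc => by
  refine (h S' h' (fun ω => c ω + n') fun S'' h'' hf => ?_).mono fun ω _ => by
    linarith
  exact hg S'' (h'.trans h'') hf S'' le_rfl c fun S₃ h₃ => hc S₃ (h''.trans h₃)

lemma computes_pi {S : KState Ω K} {ι : Type*} [Fintype ι] {f : ι → Ω → K} {n : ℝ}
    (h : ∀ i, Computes G S (fun _ : Unit => f i) n) :
    Computes G S f (Fintype.card ι * n) := by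
  classical
  have key : ∀ s : Finset ι, Computes G S (fun i : s => f i) (s.card * n) := by
    intro s
    induction s using Finset.induction_on with
    | empty => exact (computes_of_knows fun i => absurd i.2 (Finset.notMem_empty _)).mono le_rfl (by simp)
    | insert a s ha ih =>
      have : Computes G S (fun i : (insert a s : Finset ι) => f i) (s.card * n + (n + 0)) :=
        ih.trans fun S' h' hs => ((h a).mono h' le_rfl).trans fun S'' h'' ha' =>
          computes_of_knows fun i => by
            rcases Finset.mem_insert.1 i.2 with hi | hi
            · rw [hi]; exact ha' ()
            · exact (hs ⟨i, hi⟩).mono h''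
      refine this.mono le_rfl ?_
      rw [Finset.card_insert_of_notMem ha]
      push_cast
      linarith
  refine ((key Finset.univ).trans fun S' h' hs =>
    computes_of_knows fun i => hs ⟨i, Finset.mem_univ i⟩).mono le_rfl ?_
  simp [Finset.card_univ]

lemma computes_sum {S : KState Ω K} {ι : Type*} (s : Finset ι) {f : ι → Ω → K} {n : ℝ}
    (h : ∀ i ∈ s, Computes G S (fun _ : Unit => f i) n) :
    Computes G S (fun _ : Unit => fun ω => ∑ i ∈ s, f i ω) (s.card * (n + 1)) := by
  classical
  induction s using Finset.induction_on with
  | empty => exact (computes_of_knows fun _ => by simpa using S.knows_zero).mono le_rfl (by simp)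
  | insert a s ha ih =>
    have : Computes G S (fun _ : Unit => fun ω => ∑ i ∈ insert a s, f i ω)
        (s.card * (n + 1) + (n + 1)) := by
      refine (ih fun i hi => h i (Finset.mem_insert_of_mem hi)).trans fun S' h' hs =>
        ((h a (Finset.mem_insert_self a s)).mono h' le_rfl).trans fun S'' h'' ha' => ?_
      simp only [Finset.sum_insert ha]
      exact computes_arith .add (ha' ()) ((hs ()).mono h'') (by simp)
    refine this.mono le_rfl ?_
    rw [Finset.card_insert_of_notMem ha]
    push_cast
    linarith

end KRun

/-! ### Multiplication in an extension -/

section MulCost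

variable {K : Type u} {L : Type v} [Field K] [Field L] [Algebra K L] {ι : Type} [Fintype ι]

/-- A deterministic run with `c` operations looks at no more than `2 c` inputs; the remaining ones
can only be copied to the output. -/
lemma Prog.exists_unread {ι κ : Type} [DecidableEq ι] (P : Prog K ι κ) (hP : P.IsDeterministic)
    (σ : ι ⊕ ℕ → K) :
    ∃ J : Finset ι, (J.card : ℝ) ≤ 2 * P.costFrom σ ∧ ∃ (out : κ → ι ⊕ ℕ) (w : ℕ → K),
      ∀ σ' : ι ⊕ ℕ → K, (∀ d, σ' (Sum.inr d) = σ (Sum.inr d)) →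
        (∀ i ∈ J, σ' (Sum.inl i) = σ (Sum.inl i)) → ∀ y, P.Yields σ' y →
        ∀ k, y k = Sum.elim (fun i => σ' (Sum.inl i)) w (out k) := by
  -- Reading a register reveals at most one input; the work registers are fixed by assumption.
  have hread : ∀ a : ι ⊕ ℕ, ∃ J : Finset ι, J.card ≤ 1 ∧ ∀ σ' : ι ⊕ ℕ → K,
      (∀ d, σ' (Sum.inr d) = σ (Sum.inr d)) → (∀ i ∈ J, σ' (Sum.inl i) = σ (Sum.inl i)) →
      σ' a = σ a := by
    rintro (i | d)
    · exact ⟨{i}, by simp, fun σ' _ h => h i (by simp)⟩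
    · exact ⟨∅, by simp, fun σ' h _ => h d⟩
  induction P generalizing σ with
  | ret out =>
    refine ⟨∅, by simp [Prog.costFrom], out, fun d => σ (Sum.inr d), fun σ' h _ y hy k => ?_⟩
    rw [← hy k]
    cases out k with
    | inl i => rfl
    | inr d => exact h d
  | const d a p ih =>
    obtain ⟨J, hJ, out, w, H⟩ := ih hP (Prog.write σ d a) (by
      rintro (i | e)
      · exact ⟨{i}, by simp, fun σ' _ h => h i (by simp)⟩
      · exact ⟨∅, by simp, fun σ' h _ => h e⟩)
    refine ⟨J, by simp only [Prog.costFrom]; linarith, out, w, fun σ' h h' y hy k => ?_⟩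
    exact H (Prog.write σ' d a) (fun e => by simp [Prog.write, Function.update_apply, h]) h' y hy k
  | arith o d a b p ih =>
    obtain ⟨Ja, hJa, ha⟩ := hread a
    obtain ⟨Jb, hJb, hb⟩ := hread b
    obtain ⟨J, hJ, out, w, H⟩ := ih hP (Prog.write σ d (o.eval (σ a) (σ b))) (by
      rintro (i | e)
      · exact ⟨{i}, by simp, fun σ' _ h => h i (by simp)⟩
      · exact ⟨∅, by simp, fun σ' h _ => h e⟩)
    -- An arithmetic operation reads two registers; this is the source of the factor 2.
    refine ⟨J ∪ (Ja ∪ Jb), ?_, out, w, fun σ' h h' y hy k => ?_⟩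
    · have h1 : (J ∪ (Ja ∪ Jb)).card ≤ J.card + 2 :=
        (Finset.card_union_le _ _).trans (by have := Finset.card_union_le Ja Jb; omega)
      have h2 : ((J ∪ (Ja ∪ Jb)).card : ℝ) ≤ J.card + 2 := by exact_mod_cast h1
      simp only [Prog.costFrom]
      linarith
    · have ea := ha σ' h fun i hi => h' i (by simp [hi])
      have eb := hb σ' h fun i hi => h' i (by simp [hi])
      have hy' := hy.2
      rw [ea, eb] at hy'
      exact H (Prog.write σ' d _) (fun e => by simp [Prog.write, Function.update_apply, h])
        (fun i hi => h' i (by simp [hi])) y hy' k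
  | test a p q ih ih' =>
    obtain ⟨Ja, hJa, ha⟩ := hread a
    by_cases h0 : σ a = 0
    · obtain ⟨J, hJ, out, w, H⟩ := ih hP.1 σ hread
      refine ⟨J ∪ Ja, ?_, out, w, fun σ' h h' y hy k => ?_⟩
      · have h2 : ((J ∪ Ja).card : ℝ) ≤ J.card + 1 := by
          exact_mod_cast (Finset.card_union_le _ _).trans (by omega)
        simp only [Prog.costFrom, h0, if_true]
        linarith
      · have ea := ha σ' h fun i hi => h' i (by simp [hi])
        exact H σ' h (fun i hi => h' i (by simp [hi])) y (hy.1 (ea.trans h0)) k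
    · obtain ⟨J, hJ, out, w, H⟩ := ih' hP.2 σ hread
      refine ⟨J ∪ Ja, ?_, out, w, fun σ' h h' y hy k => ?_⟩
      · have h2 : ((J ∪ Ja).card : ℝ) ≤ J.card + 1 := by
          exact_mod_cast (Finset.card_union_le _ _).trans (by omega)
        simp only [Prog.costFrom, h0, if_false]
        linarith
      · have ea := ha σ' h fun i hi => h' i (by simp [hi])
        exact H σ' h (fun i hi => h' i (by simp [hi])) y (hy.2 (by rwa [ea])) k
  | sample => exact hP.elim

/-- The infimum of an empty set of naturals would be 0. The schoolbook product, with the structure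
constants `a` of the spanning family, shows that some bound exists, hence that the infimum is
attained. -/
lemma mulCost_nonempty {b : ι → L} (hs : ∀ x : L, ∃ z : ι → K, ∑ i, z i • b i = x) :
    {n : ℕ | ∃ P : Prog K (ι ⊕ ι) ι, P.IsDeterministic ∧ ∀ x y : ι → K,
      P.cost (Sum.elim x y) ≤ (n : ℝ) ∧
      ∃ z : ι → K, P.Outputs (Sum.elim x y) z ∧
        ∑ i, z i • b i = (∑ i, x i • b i) * (∑ i, y i • b i)}.Nonempty := by
  classical
  choose a ha using fun p : ι × ι => hs (b p.1 * b p.2)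
  let Ω := (ι → K) × (ι → K)
  let G : ι → Ω → K := fun k ω => ∑ p : ι × ι, ω.1 p.1 * ω.2 p.2 * a p k
  let S : KState Ω K := ⟨Set.univ, insert (fun _ => 0)
    ((Set.range fun i => fun ω : Ω => ω.1 i) ∪ (Set.range fun i => fun ω : Ω => ω.2 i)),
    Set.mem_insert _ _⟩
  have h1 : ∀ i, S.Knows fun ω => ω.1 i := fun i => ⟨_, Or.inr (Or.inl ⟨i, rfl⟩), fun _ _ => rfl⟩
  have h2 : ∀ i, S.Knows fun ω => ω.2 i := fun i => ⟨_, Or.inr (Or.inr ⟨i, rfl⟩), fun _ _ => rfl⟩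
  have hG : KRun.Computes G S G (Fintype.card ι * ((Finset.univ : Finset (ι × ι)).card * (3 + 1))) := by
    refine KRun.computes_pi fun k => KRun.computes_sum _ fun p _ => ?_
    refine ((KRun.computes_const S (a p k)).trans fun S' h' hc =>
      (KRun.computes_arith .mul ((h1 p.1).mono h') ((h2 p.2).mono h') (by simp)).trans
        fun S'' h'' hm => KRun.computes_arith .mul (hm ()) ((hc ()).mono h'') (by simp)).mono
        le_rfl (by norm_num)
  have hrun := hG S le_rfl (fun _ => 0) fun S'' _ hk => .done hk fun _ _ => le_rfl
  obtain ⟨P, hP, hP'⟩ := hrun.exists_prog 1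
    (fun ω => Prog.init (Sum.elim ω.1 ω.2)) (by
      rintro f (rfl | ⟨i, rfl⟩ | ⟨i, rfl⟩)
      · exact ⟨Sum.inr 0, fun d hd => by cases hd; omega, fun ω _ => rfl⟩
      · exact ⟨Sum.inl (Sum.inl i), by simp, fun ω _ => rfl⟩
      · exact ⟨Sum.inl (Sum.inr i), by simp, fun ω _ => rfl⟩)
  refine ⟨⌈(Fintype.card ι * ((Finset.univ : Finset (ι × ι)).card * (3 + 1)) : ℝ)⌉₊, P, hP,
    fun x y => ⟨((hP' (x, y) trivial).2.trans ?_), _, (hP' (x, y) trivial).1, ?_⟩⟩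
  · simpa using Nat.le_ceil _
  · simp only [G, Finset.sum_smul]
    rw [Finset.sum_comm, Finset.sum_mul_sum, Fintype.sum_prod_type]
    refine Finset.sum_congr rfl fun i _ => Finset.sum_congr rfl fun j _ => ?_
    rw [smul_mul_smul_comm, ← ha (i, j), Finset.smul_sum]
    simp only [mul_smul]

lemma mulCost_spec {b : ι → L} (hs : ∀ x : L, ∃ z : ι → K, ∑ i, z i • b i = x) :
    ∃ P : Prog K (ι ⊕ ι) ι, P.IsDeterministic ∧ ∀ x y : ι → K,
      P.cost (Sum.elim x y) ≤ (mulCost K b : ℝ) ∧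
      ∃ z : ι → K, P.Outputs (Sum.elim x y) z ∧
        ∑ i, z i • b i = (∑ i, x i • b i) * (∑ i, y i • b i) :=
  Nat.sInf_mem (mulCost_nonempty hs)

/-- If the run on the zero input read fewer coordinates than a basis has elements, some coordinate i
of the first factor and some j of the second would stay unread. All inputs supported there would
follow the same path, where outputs are fixed values or copies of inputs. This forces b_i · b_j = 0.
-/
lemma card_le_two_mul_mulCost {b : ι → L} (hs : ∀ x : L, ∃ z : ι → K, ∑ i, z i • b i = x)
    (hb : LinearIndependent K b) : Fintype.card ι ≤ 2 * mulCost K b := by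
  classical
  obtain ⟨P, hP, h⟩ := mulCost_spec hs
  obtain ⟨J, hJ, out, w, H⟩ := Prog.exists_unread P hP (Prog.init (Sum.elim 0 0))
  have hcost := (h 0 0).1
  by_contra hlt
  have hJc : J.card < Fintype.card ι := by
    have : (J.card : ℝ) ≤ 2 * mulCost K b := by
      refine hJ.trans ?_
      simp only [Prog.cost] at hcost
      linarith
    have : J.card ≤ 2 * mulCost K b := by exact_mod_cast this
    omega
  have hex : ∀ f : ι → ι ⊕ ι, Function.Injective f → ∃ i, f i ∉ J := by
    intro f hf
    by_contra hcon
    push Not at hcon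
    have := Finset.card_le_card_of_injOn (s := Finset.univ) (t := J) f (fun i _ => hcon i)
      hf.injOn
    rw [Finset.card_univ] at this
    omega
  obtain ⟨i, hi⟩ := hex _ Sum.inl_injective
  obtain ⟨j, hj⟩ := hex _ Sum.inr_injective
  have hzero : ∀ x y : ι → K, (∑ i, x i • b i) * (∑ i, y i • b i) = 0 →
      P.Outputs (Sum.elim x y) 0 := by
    intro x y hxy
    obtain ⟨-, z, hz, hz'⟩ := h x y
    rw [hxy] at hz'
    have : z = 0 := funext fun k => Fintype.linearIndependent_iff.1 hb z hz' k
    rwa [this] at hz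
  have agree : ∀ c d : K, ∀ k ∈ J, Prog.init (Sum.elim (Pi.single i c) (Pi.single j d)) (Sum.inl k)
      = Prog.init (Sum.elim (0 : ι → K) (0 : ι → K)) (Sum.inl k) := by
    rintro c d (k | k) hk
    · have : k ≠ i := fun h => hi (h ▸ hk)
      simp [Prog.init, this]
    · have : k ≠ j := fun h => hj (h ▸ hk)
      simp [Prog.init, this]
  have H' := fun c d y hy => H (Prog.init (Sum.elim (Pi.single i c) (Pi.single j d)))
    (fun _ => rfl) (agree c d) y hy
  have h00 := H' 0 0 0 (hzero _ _ (by simp))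
  have h10 := H' 1 0 0 (hzero _ _ (by simp))
  have h01 := H' 0 1 0 (hzero _ _ (by simp))
  obtain ⟨-, z, hz, hz'⟩ := h (Pi.single i 1) (Pi.single j 1)
  have h11 := H' 1 1 z hz
  -- Each output register is a coordinate of the first factor, one of the second, or a fixed value.
  -- Setting the other factor to zero makes the product zero without changing that register, so its
  -- content is zero.
  have hz0 : z = 0 := by
    funext k
    have e := h11 k
    rw [e]
    have e00 := h00 k
    have e10 := h10 k
    have e01 := h01 k
    generalize out k = o at e00 e10 e01
    rcases o with (l | l) | d
    · exact e10.symm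
    · exact e01.symm
    · exact e00.symm
  have hsum : ∀ l : ι, ∑ k, (Pi.single l (1 : K) : ι → K) k • b k = b l := by
    intro l
    simp [Pi.single_apply, ite_smul]
  rw [hz0, hsum, hsum] at hz'
  have := mul_ne_zero (hb.ne_zero i) (hb.ne_zero j)
  exact this (by rw [← hz']; simp)

end MulCost

/-! ### Towers of quadratic extensions -/

/-- Generators `γ i` (`i < m`) of `L` over `K` with commuting involutions `θ i` such that `θ i`
moves `γ i` and no other generator, and `K` is the field fixed by all `θ i`. -/
structure QuadTower (K : Type u) (L : Type v) [Field K] [Field L] [Algebra K L] (m : ℕ) where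
  γ : ℕ → L
  θ : ℕ → L ≃ₐ[K] L
  fix : ∀ i j, i ≠ j → θ i (γ j) = γ j
  ne : ∀ i < m, θ i (γ i) ≠ γ i
  invol : ∀ i x, θ i (θ i x) = x
  comm : ∀ i j x, θ i (θ j x) = θ j (θ i x)
  base : ∀ x, (∀ i < m, θ i x = x) → x ∈ (algebraMap K L).range

lemma Fintype.sum_snoc_bool {M : Type*} [AddCommMonoid M] {h : ℕ} (f : (Fin (h + 1) → Bool) → M) :
    ∑ A, f A = ∑ A : Fin h → Bool, ∑ b, f (Fin.snoc (α := fun _ => Bool) A b) := by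
  rw [← (Fin.snocEquiv fun _ : Fin (h + 1) => Bool).sum_comp, Fintype.sum_prod_type, Finset.sum_comm]
  rfl

/-! ### Coordinates along the tower -/

namespace QuadTower

variable {K : Type u} {L : Type v} [Field K] [Field L] [Algebra K L] {m : ℕ} (T : QuadTower K L m)

/-- The field of elements fixed by `θ i` for `i < h`. -/
def F (h : ℕ) : IntermediateField K L where
  carrier := {x | ∀ i < h, T.θ i x = x}
  mul_mem' ha hb i hi := by rw [map_mul, ha i hi, hb i hi]
  one_mem' i _ := map_one _
  add_mem' ha hb i hi := by rw [map_add, ha i hi, hb i hi]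
  zero_mem' i _ := map_zero _
  algebraMap_mem' r i _ := AlgEquiv.commutes _ r
  inv_mem' x hx i hi := by rw [map_inv₀, hx i hi]

lemma F_anti {h h' : ℕ} (hh : h ≤ h') : T.F h' ≤ T.F h := fun _ hx i hi => hx i (hi.trans_le hh)

lemma γ_mem {h : ℕ} : T.γ h ∈ T.F h := fun i hi => T.fix i h hi.ne

lemma θ_mem {h : ℕ} {x : L} (hx : x ∈ T.F h) (j : ℕ) : T.θ j x ∈ T.F h := fun i hi => by
  rw [T.comm, hx i hi]

lemma mem_F_succ {h : ℕ} {x : L} : x ∈ T.F (h + 1) ↔ x ∈ T.F h ∧ T.θ h x = x := by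
  refine ⟨fun hx => ⟨fun i hi => hx i (by omega), hx h (by omega)⟩, fun hx i hi => ?_⟩
  rcases Nat.lt_succ_iff_lt_or_eq.1 hi with h' | rfl
  · exact hx.1 i h'
  · exact hx.2

lemma sub_ne {h : ℕ} (hm : h < m) : T.γ h - T.θ h (T.γ h) ≠ 0 :=
  sub_ne_zero.2 (T.ne h hm).symm

lemma γ_ne {h : ℕ} (hm : h < m) : T.γ h ≠ 0 := fun h0 => T.ne h hm (by rw [h0, map_zero])

/-- The components of `x = x₀ + γ i * x₁` with `x₀`, `x₁` fixed by `θ i`. -/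
def part (i : ℕ) : Bool → L →ₗ[K] L
  | true => LinearMap.mulLeft K (T.γ i - T.θ i (T.γ i))⁻¹ ∘ₗ
      (LinearMap.id - (T.θ i).toLinearMap)
  | false => LinearMap.id - LinearMap.mulLeft K (T.γ i) ∘ₗ
      LinearMap.mulLeft K (T.γ i - T.θ i (T.γ i))⁻¹ ∘ₗ (LinearMap.id - (T.θ i).toLinearMap)

lemma part_true (i : ℕ) (x : L) :
    T.part i true x = (T.γ i - T.θ i (T.γ i))⁻¹ * (x - T.θ i x) := rfl

lemma part_false (i : ℕ) (x : L) : T.part i false x = x - T.γ i * T.part i true x := rfl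

lemma part_add_part (i : ℕ) (x : L) : T.part i false x + T.γ i * T.part i true x = x := by
  rw [part_false]; ring

lemma θ_part {i : ℕ} (hi : i < m) (b : Bool) (x : L) : T.θ i (T.part i b x) = T.part i b x := by
  have h := T.sub_ne hi
  have h' : T.θ i (T.γ i) - T.γ i ≠ 0 := fun h0 => h (by rw [← neg_sub, h0, neg_zero])
  have ht : T.θ i (T.part i true x) = T.part i true x := by
    rw [part_true, map_mul, map_inv₀, map_sub, map_sub, T.invol, T.invol]
    field_simp
    ring
  cases b
  · rw [part_false, map_sub, map_mul, ht, part_true]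
    field_simp
    ring
  · exact ht

lemma part_θ_of_ne {i j : ℕ} (hij : i ≠ j) (b : Bool) (x : L) :
    T.part i b (T.θ j x) = T.θ j (T.part i b x) := by
  have h1 : T.θ j (T.γ i) = T.γ i := T.fix j i hij.symm
  have ht : T.part i true (T.θ j x) = T.θ j (T.part i true x) := by
    simp only [part_true, map_mul, map_inv₀, map_sub, h1, T.comm j i]
  cases b
  · rw [part_false, part_false, ht, map_sub, map_mul, h1]
  · exact ht

lemma part_mul {i : ℕ} {c : L} (hc : T.θ i c = c) (b : Bool) (x : L) :
    T.part i b (c * x) = c * T.part i b x := by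
  cases b <;> simp only [part_false, part_true, map_mul, hc] <;> ring

lemma part_true_of_fixed {i : ℕ} {x : L} (hx : T.θ i x = x) : T.part i true x = 0 := by
  rw [part_true, hx, sub_self, mul_zero]

lemma part_false_of_fixed {i : ℕ} {x : L} (hx : T.θ i x = x) : T.part i false x = x := by
  rw [part_false, T.part_true_of_fixed hx, mul_zero, sub_zero]

lemma part_pow_mul {i : ℕ} (hi : i < m) {c : L} (hc : T.θ i c = c) (a b : Bool) :
    T.part i a ((if b then T.γ i else 1) * c) = if a = b then c else 0 := by
  have hg : T.part i true (T.γ i) = 1 := by rw [part_true, inv_mul_cancel₀ (T.sub_ne hi)]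
  rw [mul_comm, T.part_mul hc]
  cases a <;> cases b <;>
    simp [part_false, hg, T.part_true_of_fixed (map_one _)]

lemma part_comm {i j : ℕ} (hij : i ≠ j) (a b : Bool) (x : L) :
    T.part i a (T.part j b x) = T.part j b (T.part i a x) := by
  have h1 : T.θ j (T.γ i) = T.γ i := T.fix j i hij.symm
  have h2 : T.θ i (T.γ j) = T.γ j := T.fix i j hij
  have ht : ∀ y, T.part i a (T.part j true y) = T.part j true (T.part i a y) := fun y => by
    rw [part_true, T.part_mul (by rw [map_inv₀, map_sub, T.comm, h2]), map_sub,
      T.part_θ_of_ne hij, part_true]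
  cases b
  · rw [part_false, part_false, map_sub, T.part_mul h2, ht]
  · exact ht x

lemma part_mem {h : ℕ} (hm : h < m) {x : L} (hx : x ∈ T.F h) (b : Bool) :
    T.part h b x ∈ T.F (h + 1) := by
  rw [mem_F_succ]
  exact ⟨fun i hi => by rw [← T.part_θ_of_ne hi.ne', hx i hi], T.θ_part hm b x⟩

/-- The monomial in `γ i`, `i < h`. -/
def bm (h : ℕ) (A : Fin h → Bool) : L := ∏ i, if A i then T.γ i else 1

lemma bm_snoc {h : ℕ} (A : Fin h → Bool) (b : Bool) :
    T.bm (h + 1) (Fin.snoc (α := fun _ => Bool) A b) = T.bm h A * if b then T.γ h else 1 := by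
  simp [bm, Fin.prod_univ_castSucc]

lemma bm_succ {h : ℕ} (A : Fin (h + 1) → Bool) :
    T.bm (h + 1) A = T.bm h (Fin.init A) * if A (Fin.last h) then T.γ h else 1 := by
  conv_lhs => rw [← Fin.snoc_init_self A]
  exact T.bm_snoc _ _

lemma θ_bm {h j : ℕ} (hj : h ≤ j) (A : Fin h → Bool) : T.θ j (T.bm h A) = T.bm h A := by
  rw [bm, map_prod]
  refine Finset.prod_congr rfl fun i _ => ?_
  split_ifs
  · exact T.fix _ _ (by omega)
  · exact map_one _

/-- The coordinates of an element of `L` with respect to the basis `bm h` over `F h`. -/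
def coef : (h : ℕ) → (Fin h → Bool) → L →ₗ[K] L
  | 0, _ => LinearMap.id
  | h + 1, A => T.part h (A (Fin.last h)) ∘ₗ coef h (Fin.init A)

lemma coef_zero (A : Fin 0 → Bool) (x : L) : T.coef 0 A x = x := rfl

lemma coef_succ {h : ℕ} (A : Fin (h + 1) → Bool) (x : L) :
    T.coef (h + 1) A x = T.part h (A (Fin.last h)) (T.coef h (Fin.init A) x) := rfl

lemma coef_snoc {h : ℕ} (A : Fin h → Bool) (b : Bool) (x : L) :
    T.coef (h + 1) (Fin.snoc (α := fun _ => Bool) A b) x = T.part h b (T.coef h A x) := by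
  rw [coef_succ, Fin.snoc_last, Fin.init_snoc]

lemma coef_mem {h : ℕ} (hm : h ≤ m) (A : Fin h → Bool) (x : L) : T.coef h A x ∈ T.F h := by
  induction h with
  | zero => intro i hi; omega
  | succ h ih => exact T.part_mem (by omega) (ih (by omega) _) _

lemma coef_mul {h : ℕ} {c : L} (hc : c ∈ T.F h) (A : Fin h → Bool) (x : L) :
    T.coef h A (c * x) = c * T.coef h A x := by
  induction h with
  | zero => rfl
  | succ h ih =>
    rw [mem_F_succ] at hc
    rw [coef_succ, ih hc.1, T.part_mul hc.2, coef_succ]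

lemma sum_coef {h : ℕ} (x : L) : ∑ A, T.coef h A x * T.bm h A = x := by
  induction h with
  | zero => simp [coef_zero, bm]
  | succ h ih =>
    rw [Fintype.sum_snoc_bool]
    conv_rhs => rw [← ih]
    refine Finset.sum_congr rfl fun A _ => ?_
    simp only [coef_snoc, bm_snoc, Fintype.sum_bool, if_true, Bool.false_eq_true, if_false]
    conv_rhs => rw [← T.part_add_part h (T.coef h A x)]
    ring

lemma coef_bm_mul {h : ℕ} (hm : h ≤ m) {c : L} (hc : c ∈ T.F h) (A B : Fin h → Bool) :
    T.coef h A (T.bm h B * c) = if A = B then c else 0 := by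
  induction h generalizing c with
  | zero => simp [coef_zero, bm, Subsingleton.elim A B]
  | succ h ih =>
    rw [mem_F_succ] at hc
    rw [coef_succ, bm_succ, mul_assoc, ih (by omega) (mul_mem (by
      split_ifs
      · exact T.γ_mem
      · exact one_mem _) hc.1)]
    by_cases hAB : Fin.init A = Fin.init B
    · rw [if_pos hAB, T.part_pow_mul (by omega) hc.2]
      refine if_congr ⟨fun hl => ?_, fun hl => by rw [hl]⟩ rfl rfl
      rw [← Fin.snoc_init_self A, ← Fin.snoc_init_self B, hAB, hl]
    · rw [if_neg hAB, map_zero, if_neg fun hl => hAB (by rw [hl])]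

lemma coef_bm {h : ℕ} (hm : h ≤ m) (A B : Fin h → Bool) :
    T.coef h A (T.bm h B) = if A = B then 1 else 0 := by
  simpa using T.coef_bm_mul hm (one_mem (T.F h)) A B

lemma coef_sum {h : ℕ} (hm : h ≤ m) (c : (Fin h → Bool) → L) (hc : ∀ A, c A ∈ T.F h)
    (A : Fin h → Bool) : T.coef h A (∑ B, c B * T.bm h B) = c A := by
  rw [map_sum]
  simp_rw [mul_comm (c _), T.coef_bm_mul hm (hc _)]
  simp

lemma ext_coef {h : ℕ} {x y : L} (hxy : ∀ A : Fin h → Bool, T.coef h A x = T.coef h A y) :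
    x = y := by
  rw [← T.sum_coef (h := h) x, ← T.sum_coef (h := h) y]
  exact Finset.sum_congr rfl fun A _ => by rw [hxy A]

lemma coef_θ {h j : ℕ} (hj : h ≤ j) (A : Fin h → Bool) (x : L) :
    T.coef h A (T.θ j x) = T.θ j (T.coef h A x) := by
  induction h with
  | zero => rfl
  | succ h ih => rw [coef_succ, ih (by omega), T.part_θ_of_ne (by omega), coef_succ]

lemma coef_part {h j : ℕ} (hj : h ≤ j) (A : Fin h → Bool) (b : Bool) (x : L) :
    T.coef h A (T.part j b x) = T.part j b (T.coef h A x) := by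
  induction h with
  | zero => rfl
  | succ h ih => rw [coef_succ, ih (by omega), T.part_comm (by omega), coef_succ]

/-- A part is fixed by θ_i, so its coordinates with bit i set vanish, and the others are coordinates
of x with bit i replaced by b. Taking parts therefore only rearranges coordinates and costs nothing.
-/
lemma coef_part_of_lt {h i : ℕ} (hm : h ≤ m) (hi : i < h) (A : Fin h → Bool) (b : Bool) (x : L) :
    T.coef h A (T.part i b x) =
      if A ⟨i, hi⟩ then 0 else T.coef h (Function.update A ⟨i, hi⟩ b) x := by
  induction h with
  | zero => omega
  | succ h ih =>
    rcases Nat.lt_succ_iff_lt_or_eq.1 hi with hlt | rfl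
    · have hl : (⟨i, hi⟩ : Fin (h + 1)) = Fin.castSucc ⟨i, hlt⟩ := rfl
      rw [coef_succ, ih (by omega) hlt, coef_succ, hl, Fin.init_update_castSucc,
        Function.update_of_ne (Fin.castSucc_lt_last _).ne']
      rw [apply_ite (T.part h (A (Fin.last h))), map_zero]
      rfl
    · have hl : (⟨i, hi⟩ : Fin (i + 1)) = Fin.last i := rfl
      rw [coef_succ, T.coef_part le_rfl, coef_succ, hl, Fin.init_update_last, Function.update_self]
      have hf := fun x => T.θ_part (show i < m by omega) b x
      cases hA : A (Fin.last i)
      · simp [T.part_false_of_fixed (hf _)]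
      · simp [T.part_true_of_fixed (hf _)]

/-- Set the first `h` bits of an index to `false`. -/
def clear (h : ℕ) {n : ℕ} (A : Fin n → Bool) : Fin n → Bool := fun i => if i.1 < h then false else A i

/-- The first h bits select a coefficient in F_h and the remaining bits expand this coefficient
further. Expanding an element of F_h uses no monomials in the first h generators, hence the cleared
bits. -/
lemma coef_eq_coef_clear {h n : ℕ} (hm : n ≤ m) (hn : h ≤ n) (A : Fin n → Bool) (x : L) :
    T.coef n A x = T.coef n (clear h A) (T.coef h (fun i => A (Fin.castLE hn i)) x) := by
  induction n, hn using Nat.le_induction with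
  | base =>
    have hc : ∀ (k : ℕ) (hk : k ≤ h) {y : L}, y ∈ T.F k → T.coef k (fun _ => false) y = y := by
      intro k
      induction k with
      | zero => intros; rfl
      | succ k ih =>
        intro hk y hy
        rw [mem_F_succ] at hy
        rw [coef_succ]
        have : Fin.init (fun _ : Fin (k + 1) => false) = fun _ => false := rfl
        rw [this, ih (by omega) hy.1, T.part_false_of_fixed hy.2]
    have : clear h A = fun _ => false := by
      funext i; simp [clear]
    rw [this, hc h le_rfl (T.coef_mem hm _ _)]
    rfl
  | succ n hn ih =>
    rw [coef_succ, ih (by omega) (Fin.init A), coef_succ]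
    have h1 : clear h A (Fin.last n) = A (Fin.last n) := by
      simp [clear, not_lt.2 hn]
    rw [h1]
    rfl

end QuadTower

namespace QuadTower

open Module

variable {K : Type u} {L : Type v} [Field K] [Field L] [Algebra K L] {m : ℕ} (T : QuadTower K L m)

/-! #### Dimensions and coordinates -/

/-- Coordinates with respect to the basis `bm h` over `F h`. -/
def coefEquiv {h : ℕ} (hm : h ≤ m) : L ≃ₗ[T.F h] ((Fin h → Bool) → T.F h) where
  toFun x A := ⟨T.coef h A x, T.coef_mem hm A x⟩
  invFun c := ∑ A, (c A : L) * T.bm h A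
  map_add' x y := by ext A; simp
  map_smul' c x := by
    ext A
    simpa [Algebra.smul_def] using T.coef_mul c.2 A x
  left_inv x := T.sum_coef x
  right_inv c := by
    ext A
    exact T.coef_sum hm (fun A => (c A : L)) (fun A => (c A).2) A

lemma finrank_F_top {h : ℕ} (hm : h ≤ m) : finrank (T.F h) L = 2 ^ h := by
  rw [(T.coefEquiv hm).finrank_eq, finrank_fintype_fun_eq_card]
  simp

lemma F_m : T.F m = ⊥ := by
  refine le_antisymm (fun x hx => ?_) bot_le
  obtain ⟨a, rfl⟩ := T.base x hx
  exact algebraMap_mem _ a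

lemma finiteDimensional (T : QuadTower K L m) : FiniteDimensional K L := by
  have h1 := T.finrank_F_top le_rfl
  rw [F_m] at h1
  have h2 := IntermediateField.finrank_bot' (F := K) (E := L)
  exact FiniteDimensional.of_finrank_pos (by rw [← h2, h1]; positivity)

lemma finrank_top (T : QuadTower K L m) : finrank K L = 2 ^ m := by
  rw [← T.finrank_F_top le_rfl, F_m, IntermediateField.finrank_bot']

lemma finrank_F {h : ℕ} (hm : h ≤ m) : finrank K (T.F h) = 2 ^ (m - h) := by
  have h1 := finrank_mul_finrank K (T.F h) L
  rw [T.finrank_F_top hm, T.finrank_top] at h1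
  have h2 : 2 ^ (m - h) * 2 ^ h = 2 ^ m := by rw [← pow_add, Nat.sub_add_cancel hm]
  exact Nat.eq_of_mul_eq_mul_right (by positivity) (h1.trans h2.symm)

/-- The coordinates over `K`. -/
noncomputable def crd (A : Fin m → Bool) (x : L) : K :=
  (T.base (T.coef m A x) (T.coef_mem le_rfl A x)).choose

lemma algebraMap_crd (A : Fin m → Bool) (x : L) : algebraMap K L (T.crd A x) = T.coef m A x :=
  (T.base (T.coef m A x) (T.coef_mem le_rfl A x)).choose_spec

lemma sum_crd (x : L) : ∑ A, T.crd A x • T.bm m A = x := by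
  simp_rw [Algebra.smul_def, algebraMap_crd]
  exact T.sum_coef x

lemma crd_eq_of_coef_eq {A B : Fin m → Bool} {x y : L} (h : T.coef m A x = T.coef m B y) :
    T.crd A x = T.crd B y :=
  (algebraMap K L).injective (by rw [algebraMap_crd, algebraMap_crd, h])

lemma crd_eq_zero {A : Fin m → Bool} {x : L} (h : T.coef m A x = 0) : T.crd A x = 0 :=
  (algebraMap K L).injective (by rw [algebraMap_crd, h, map_zero])

lemma crd_add (A : Fin m → Bool) (x y : L) : T.crd A (x + y) = T.crd A x + T.crd A y :=
  (algebraMap K L).injective (by simp [algebraMap_crd])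

lemma crd_sub (A : Fin m → Bool) (x y : L) : T.crd A (x - y) = T.crd A x - T.crd A y :=
  (algebraMap K L).injective (by simp [algebraMap_crd])

lemma crd_sum_smul (c : (Fin m → Bool) → K) (A : Fin m → Bool) :
    T.crd A (∑ B, c B • T.bm m B) = c A := by
  refine (algebraMap K L).injective ?_
  rw [algebraMap_crd]
  simp_rw [Algebra.smul_def]
  exact T.coef_sum le_rfl _ (fun B => algebraMap_mem _ _) A

lemma eq_zero_of_crd {x : L} (h : ∀ A, T.crd A x = 0) : x = 0 := by
  rw [← T.sum_crd x]
  simp [h]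

lemma linearIndependent_bm : LinearIndependent K (T.bm m) := by
  rw [Fintype.linearIndependent_iff]
  intro c hc A
  rw [← T.crd_sum_smul c A, hc]
  exact T.crd_eq_zero (map_zero _)

/-! #### The standard bilinear form -/

/-- The bilinear form over `F h` for which `bm h` is orthonormal. -/
def dot (h : ℕ) (v : L) : L →ₗ[K] L := ∑ A, LinearMap.mulLeft K (T.coef h A v) ∘ₗ T.coef h A

lemma dot_apply (h : ℕ) (v x : L) : T.dot h v x = ∑ A, T.coef h A v * T.coef h A x := by
  simp [dot, LinearMap.sum_apply]

lemma dot_comm (h : ℕ) (v x : L) : T.dot h v x = T.dot h x v := by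
  simp [dot_apply, mul_comm]

lemma dot_mem {h : ℕ} (hm : h ≤ m) (v x : L) : T.dot h v x ∈ T.F h := by
  rw [dot_apply]
  exact sum_mem fun A _ => mul_mem (T.coef_mem hm A v) (T.coef_mem hm A x)

lemma dot_mul {h : ℕ} {c : L} (hc : c ∈ T.F h) (v x : L) :
    T.dot h v (c * x) = c * T.dot h v x := by
  simp only [dot_apply, T.coef_mul hc, Finset.mul_sum]
  exact Finset.sum_congr rfl fun A _ => by ring

lemma dot_mul_left {h : ℕ} {c : L} (hc : c ∈ T.F h) (v x : L) :
    T.dot h (c * v) x = c * T.dot h v x := by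
  rw [dot_comm, T.dot_mul hc, dot_comm]

lemma dot_add_left (h : ℕ) (v v' x : L) : T.dot h (v + v') x = T.dot h v x + T.dot h v' x := by
  rw [dot_comm, map_add, dot_comm, T.dot_comm h x]

lemma dot_zero_left (h : ℕ) (x : L) : T.dot h 0 x = 0 := by
  rw [dot_comm, map_zero]

lemma dot_bm {h : ℕ} (hm : h ≤ m) (v : L) (A : Fin h → Bool) :
    T.dot h v (T.bm h A) = T.coef h A v := by
  simp [dot_apply, T.coef_bm hm]

lemma dot_θ {h j : ℕ} (hj : h ≤ j) (v x : L) :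
    T.dot h (T.θ j v) (T.θ j x) = T.θ j (T.dot h v x) := by
  simp [dot_apply, T.coef_θ hj]

/-! #### Descent of linear maps along the tower -/

/-- Linearity over `F h`. -/
def FLin (h : ℕ) (g : L →ₗ[K] L) : Prop := ∀ c ∈ T.F h, ∀ x, g (c * x) = c * g x

variable {T}

lemma FLin.sub {h : ℕ} {f g : L →ₗ[K] L} (hf : T.FLin h f) (hg : T.FLin h g) : T.FLin h (f - g) :=
  fun c hc x => by simp [hf c hc, hg c hc, mul_sub]

lemma FLin.ext {h : ℕ} {f g : L →ₗ[K] L} (hm : h ≤ m) (hf : T.FLin h f) (hg : T.FLin h g)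
    (hfg : ∀ A, f (T.bm h A) = g (T.bm h A)) : f = g := by
  ext x
  rw [← T.sum_coef (h := h) x, map_sum, map_sum]
  refine Finset.sum_congr rfl fun A _ => ?_
  rw [hf _ (T.coef_mem hm A x), hg _ (T.coef_mem hm A x), hfg]

lemma FLin.apply_eq {h : ℕ} {f : L →ₗ[K] L} (hm : h ≤ m) (hf : T.FLin h f) (x : L) :
    f x = ∑ A, T.coef h A x * f (T.bm h A) := by
  conv_lhs => rw [← T.sum_coef (h := h) x, map_sum]
  exact Finset.sum_congr rfl fun A _ => hf _ (T.coef_mem hm A x) _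

/-- F_h is generated by γ_h over F_{h+1}: a scalar c splits as c₀ + γ_h c₁ with both parts in
F_{h+1}. -/
lemma flin_of_succ {h : ℕ} (hm : h < m) {f : L →ₗ[K] L} (hf : T.FLin (h + 1) f)
    (hγ : ∀ x, f (T.γ h * x) = T.γ h * f x) : T.FLin h f := by
  intro c hc x
  rw [← T.part_add_part h c, add_mul, map_add, hf _ (T.part_mem hm hc _), mul_assoc, hγ,
    hf _ (T.part_mem hm hc _)]
  ring

variable (T)

/-- The component `g₁` of `g = g₀ + g₁ ∘ θ h`, for `g₀`, `g₁` linear over `F h`. -/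
def comp₁ (h : ℕ) (g : L →ₗ[K] L) : L →ₗ[K] L :=
  LinearMap.mulLeft K (T.θ h (T.γ h) - T.γ h)⁻¹ ∘ₗ
    (g ∘ₗ LinearMap.mulLeft K (T.γ h) - LinearMap.mulLeft K (T.γ h) ∘ₗ g) ∘ₗ (T.θ h).toLinearMap

/-- The component `g₀` of `g = g₀ + g₁ ∘ θ h`. -/
def comp₀ (h : ℕ) (g : L →ₗ[K] L) : L →ₗ[K] L := g - T.comp₁ h g ∘ₗ (T.θ h).toLinearMap

/-- Since g₀ and g₁ commute with F_h, the commutator of g with multiplication by γ kills g₀ and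
multiplies g₁ ∘ θ by θγ - γ. Dividing by this factor and undoing θ isolates g₁. -/
lemma comp₁_apply (h : ℕ) (g : L →ₗ[K] L) (x : L) : T.comp₁ h g x =
    (T.θ h (T.γ h) - T.γ h)⁻¹ * (g (T.γ h * T.θ h x) - T.γ h * g (T.θ h x)) := rfl

lemma comp₀_apply (h : ℕ) (g : L →ₗ[K] L) (x : L) :
    T.comp₀ h g x = g x - T.comp₁ h g (T.θ h x) := rfl

lemma comp₁_sub (h : ℕ) (f g : L →ₗ[K] L) : T.comp₁ h (f - g) = T.comp₁ h f - T.comp₁ h g := by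
  ext x; simp [comp₁_apply]; ring

lemma comp₀_sub (h : ℕ) (f g : L →ₗ[K] L) : T.comp₀ h (f - g) = T.comp₀ h f - T.comp₀ h g := by
  ext x; simp [comp₀_apply, comp₁_sub]; ring

lemma θ_mul (i : ℕ) (x y : L) : T.θ i (x * y) = T.θ i x * T.θ i y := map_mul _ x y

lemma sub_ne' {h : ℕ} (hm : h < m) : T.θ h (T.γ h) - T.γ h ≠ 0 := sub_ne_zero.2 (T.ne h hm)

lemma θγ_add_mem {h : ℕ} : T.γ h + T.θ h (T.γ h) ∈ T.F (h + 1) := by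
  rw [mem_F_succ]
  exact ⟨add_mem T.γ_mem (T.θ_mem T.γ_mem _), by rw [map_add, T.invol, add_comm]⟩

lemma θγ_mul_mem {h : ℕ} : T.γ h * T.θ h (T.γ h) ∈ T.F (h + 1) := by
  rw [mem_F_succ]
  exact ⟨mul_mem T.γ_mem (T.θ_mem T.γ_mem _), by rw [map_mul, T.invol, mul_comm]⟩

variable {T}

/-- Trace and norm of γ over F_{h+1} may be pulled out of g. With norm - γ · trace = -γ², the
commutator of g with γ, evaluated at a θγ-multiple, becomes its γ-multiple, which after the twist by
θ is γ-linearity. -/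
lemma FLin.comp₁ {h : ℕ} (hm : h < m) {g : L →ₗ[K] L} (hg : T.FLin (h + 1) g) :
    T.FLin h (T.comp₁ h g) := by
  refine flin_of_succ hm (fun c hc x => ?_) fun x => ?_
  · have hθ := (T.mem_F_succ.1 hc).2
    rw [comp₁_apply, θ_mul, hθ, mul_left_comm, hg c hc, hg c hc, comp₁_apply]
    ring
  · have h1 := hg _ T.θγ_mul_mem (T.θ h x)
    have h2 := hg _ T.θγ_add_mem (T.θ h x)
    rw [add_mul, map_add] at h2
    rw [comp₁_apply, θ_mul, ← mul_assoc, h1, eq_sub_of_add_eq' h2, comp₁_apply]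
    ring

lemma FLin.comp₀ {h : ℕ} (hm : h < m) {g : L →ₗ[K] L} (hg : T.FLin (h + 1) g) :
    T.FLin h (T.comp₀ h g) := by
  have h1 := hg.comp₁ hm
  have hne := T.sub_ne' hm
  refine flin_of_succ hm (fun c hc x => ?_) fun x => ?_
  · have hθ := T.mem_F_succ.1 hc
    rw [comp₀_apply, hg c hc, θ_mul, hθ.2, h1 c hθ.1, comp₀_apply]
    ring
  · rw [comp₀_apply, θ_mul, h1 _ (T.θ_mem T.γ_mem _), comp₀_apply, comp₁_apply, T.invol]
    field_simp
    ring

lemma comp_add (h : ℕ) (g : L →ₗ[K] L) (x : L) :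
    g x = T.comp₀ h g x + T.comp₁ h g (T.θ h x) := by
  rw [comp₀_apply]; ring

lemma comp₁_eq {h : ℕ} (hm : h < m) {g g₀ g₁ : L →ₗ[K] L} (h₀ : T.FLin h g₀) (h₁ : T.FLin h g₁)
    (hg : ∀ x, g x = g₀ x + g₁ (T.θ h x)) : T.comp₁ h g = g₁ := by
  ext x
  have hne := T.sub_ne' hm
  rw [comp₁_apply, hg, hg, θ_mul, T.invol, h₀ _ T.γ_mem, h₁ _ (T.θ_mem T.γ_mem _)]
  field_simp
  ring

lemma comp₀_eq {h : ℕ} (hm : h < m) {g g₀ g₁ : L →ₗ[K] L} (h₀ : T.FLin h g₀) (h₁ : T.FLin h g₁)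
    (hg : ∀ x, g x = g₀ x + g₁ (T.θ h x)) : T.comp₀ h g = g₀ := by
  ext x
  rw [comp₀_apply, comp₁_eq hm h₀ h₁ hg, hg, add_sub_cancel_right]

/-- The value g(x + θy) mixes g₀x + g₁y with g₀θy + g₁θx. Weighting by γ before applying g gives
them the weights γ and θγ, so one combination removes the second. Here x and y are independent: they
parametrize L ⊗ F_h over F_{h+1}, the extension of scalars in which constraints on g become
constraints on pairs. -/
lemma comp_eq {h : ℕ} (hm : h < m) {g : L →ₗ[K] L} (hg : T.FLin (h + 1) g) (x y : L) :
    (T.γ h - T.θ h (T.γ h)) * (T.comp₀ h g x + T.comp₁ h g y) =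
      g (T.γ h * x + T.θ h (T.γ h * y)) - T.θ h (T.γ h) * g (x + T.θ h y) := by
  have h0 := hg.comp₀ hm
  have h1 := hg.comp₁ hm
  have hγ := T.γ_mem (h := h)
  have hθ := T.θ_mem hγ h
  have e1 : T.θ h (T.γ h * x + T.θ h (T.γ h * y)) = T.θ h (T.γ h) * T.θ h x + T.γ h * y := by
    rw [map_add, θ_mul, T.invol]
  have e2 : T.θ h (x + T.θ h y) = T.θ h x + y := by rw [map_add, T.invol]
  rw [comp_add h g (_ + _), comp_add h g (x + _), e1, e2, θ_mul]
  simp only [map_add, h0 _ hγ, h1 _ hγ, h0 _ hθ, h1 _ hθ]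
  ring

variable (T)

/-- The vector of the component `comp₁` of the linear form `dot (h + 1) v`. -/
noncomputable def vec₁ (h : ℕ) : L →ₗ[K] L :=
  LinearMap.mulLeft K (T.θ h (T.γ h) - T.γ h)⁻¹ ∘ₗ
    (T.part h true - LinearMap.mulLeft K (T.γ h) ∘ₗ T.part h false)

lemma vec₁_apply (h : ℕ) (v : L) : T.vec₁ h v =
    (T.θ h (T.γ h) - T.γ h)⁻¹ * (T.part h true v - T.γ h * T.part h false v) := rfl

/-- The linear form `dot (h + 1) v` has components that are again of the form `dot h`, and the two
representing vectors are conjugate under θ_h. One vector at level h+1 thus descends to one pair at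
level h. -/
lemma dot_succ {h : ℕ} (hm : h < m) (v x : L) :
    T.dot (h + 1) v x = T.dot h (T.θ h (T.vec₁ h v)) x + T.dot h (T.vec₁ h v) (T.θ h x) := by
  have hne := T.sub_ne' hm
  have hne' := T.sub_ne hm
  simp only [dot_apply]
  rw [Fintype.sum_snoc_bool, ← Finset.sum_add_distrib]
  refine Finset.sum_congr rfl fun A _ => ?_
  have hF : (T.θ h (T.γ h) - T.γ h)⁻¹ ∈ T.F h :=
    inv_mem (sub_mem (T.θ_mem T.γ_mem _) T.γ_mem)
  have hv : T.coef h A (T.vec₁ h v) = (T.θ h (T.γ h) - T.γ h)⁻¹ *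
      (T.part h true (T.coef h A v) - T.γ h * T.part h false (T.coef h A v)) := by
    rw [vec₁_apply, T.coef_mul hF, map_sub, T.coef_mul T.γ_mem, T.coef_part le_rfl,
      T.coef_part le_rfl]
  simp only [Fintype.sum_bool, coef_snoc, T.coef_θ le_rfl, hv]
  have hx := T.part_add_part h (T.coef h A x)
  have hθx : T.θ h (T.coef h A x) = T.part h false (T.coef h A x) +
      T.θ h (T.γ h) * T.part h true (T.coef h A x) := by
    conv_lhs => rw [← hx, map_add, map_mul, T.θ_part hm, T.θ_part hm]
  rw [hθx]
  conv_rhs => enter [1, 2]; rw [← hx]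
  simp only [map_mul, map_sub, map_inv₀, T.invol, T.θ_part hm]
  field_simp
  ring

/-- Orthogonality over `F h` to the descended vectors yields elements orthogonal over
`F (h + 1)`. -/
lemma dot_succ_eq_zero {h : ℕ} (hm : h < m) {v x y : L}
    (hv : T.dot h (T.θ h (T.vec₁ h v)) x + T.dot h (T.vec₁ h v) y = 0) {c : L} (hc : c ∈ T.F h) :
    T.dot (h + 1) v (c * x + T.θ h (c * y)) = 0 := by
  have h1 : T.dot h (T.θ h (T.vec₁ h v)) (T.θ h y) + T.dot h (T.vec₁ h v) (T.θ h x) = 0 := by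
    have h2 := T.dot_θ (le_refl h) (T.θ h (T.vec₁ h v)) x
    rw [T.invol] at h2
    rw [T.dot_θ le_rfl, h2, ← map_add, add_comm, hv, map_zero]
  rw [T.dot_succ hm]
  simp only [map_add, map_mul, T.invol, T.dot_mul hc, T.dot_mul (T.θ_mem hc h)]
  linear_combination c * hv + T.θ h c * h1

/-! #### Reed–Muller maps -/

/-- The maps `∑ f_g g` over the products `g` of at most `ρ` of the `θ i`, `i < h`. -/
def RM : ℕ → ℕ → (L →ₗ[K] L) → Prop
  | 0, _, M => ∃ f, ∀ x, M x = f * x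
  | _ + 1, 0, M => ∃ f, ∀ x, M x = f * x
  | h + 1, ρ + 1, M => ∃ M₀ M₁, RM h (ρ + 1) M₀ ∧ RM h ρ M₁ ∧ ∀ x, M x = M₀ x + M₁ (T.θ h x)

lemma RM_zero_right {h : ℕ} {M : L →ₗ[K] L} : T.RM h 0 M ↔ ∃ f, ∀ x, M x = f * x := by
  cases h <;> rfl

variable {T}

lemma RM.flin {h ρ : ℕ} {M : L →ₗ[K] L} (hM : T.RM h ρ M) : T.FLin h M := by
  induction h generalizing ρ M with
  | zero =>
    obtain ⟨f, hf⟩ := hM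
    intro c _ x
    rw [hf, hf]; ring
  | succ h ih =>
    cases ρ with
    | zero =>
      obtain ⟨f, hf⟩ := hM
      intro c _ x
      rw [hf, hf]; ring
    | succ ρ =>
      obtain ⟨M₀, M₁, h₀, h₁, hM⟩ := hM
      intro c hc x
      have hc' := T.mem_F_succ.1 hc
      rw [hM, hM, θ_mul, hc'.2, ih h₀ c hc'.1, ih h₁ c hc'.1]
      ring

lemma RM.comp₁ {h ρ : ℕ} (hm : h < m) {M : L →ₗ[K] L} (hM : T.RM (h + 1) (ρ + 1) M) :
    T.RM h ρ (T.comp₁ h M) := by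
  obtain ⟨M₀, M₁, h₀, h₁, hM⟩ := hM
  rwa [comp₁_eq hm h₀.flin h₁.flin hM]

lemma RM.comp₀ {h ρ : ℕ} (hm : h < m) {M : L →ₗ[K] L} (hM : T.RM (h + 1) (ρ + 1) M) :
    T.RM h (ρ + 1) (T.comp₀ h M) := by
  obtain ⟨M₀, M₁, h₀, h₁, hM⟩ := hM
  rwa [comp₀_eq hm h₀.flin h₁.flin hM]

end QuadTower

/-! ### Machines over the top field of a tower -/

/-- A machine with registers for elements of `L`: `Kn s f` says that the function `f` of the
instance is available in the state `s`, `Run s c` that the goal of the machine can be reached from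
`s` with at most `c ω` operations on the instance `ω`. Coordinates can be rearranged freely. -/
structure LMachine {K : Type u} {L : Type v} [Field K] [Field L] [Algebra K L] {m : ℕ}
    (T : QuadTower K L m) (Ω : Type w) where
  St : Type (max u w)
  [pre : Preorder St]
  dom : St → Set Ω
  Kn : St → (Ω → L) → Prop
  Run : St → (Ω → ℕ) → Prop
  dom_anti : ∀ {s s'}, s ≤ s' → dom s' ⊆ dom s
  kn_mono : ∀ {s s'} {f : Ω → L}, s ≤ s' → Kn s f → Kn s' f
  kn_congr : ∀ {s} {f g : Ω → L}, Kn s f → (∀ ω ∈ dom s, f ω = g ω) → Kn s g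
  kn_zero : ∀ s, Kn s fun _ => 0
  kn_part : ∀ {s} {f : Ω → L} {i : ℕ}, Kn s f → i < m → ∀ b, Kn s fun ω => T.part i b (f ω)
  kn_transpose : ∀ {s} {h : ℕ}, h ≤ m → ∀ {f : (Fin h → Bool) → Ω → L}, (∀ A, Kn s (f A)) →
    ∀ p, Kn s fun ω => ∑ A, T.coef h p (f A ω) * T.bm h A
  run_mono : ∀ {s} {c c' : Ω → ℕ}, Run s c → (∀ ω ∈ dom s, c ω ≤ c' ω) → Run s c'
  run_empty : ∀ {s} {c : Ω → ℕ}, (∀ ω ∈ dom s, False) → Run s c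
  run_const : ∀ {s} {c : Ω → ℕ} (a : L), (∀ s', s ≤ s' → Kn s' (fun _ => a) → Run s' c) →
    Run s fun ω => c ω + 1
  run_add : ∀ {s} {c : Ω → ℕ} {f g : Ω → L}, Kn s f → Kn s g →
    (∀ s', s ≤ s' → Kn s' (fun ω => f ω + g ω) → Run s' c) → Run s fun ω => c ω + 1
  run_sub : ∀ {s} {c : Ω → ℕ} {f g : Ω → L}, Kn s f → Kn s g →
    (∀ s', s ≤ s' → Kn s' (fun ω => f ω - g ω) → Run s' c) → Run s fun ω => c ω + 1
  run_mul : ∀ {s} {c : Ω → ℕ} {f g : Ω → L}, Kn s f → Kn s g →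
    (∀ s', s ≤ s' → Kn s' (fun ω => f ω * g ω) → Run s' c) → Run s fun ω => c ω + 1
  run_base_inv : ∀ {s} {c : Ω → ℕ} {f : Ω → L}, Kn s f →
    (∀ ω ∈ dom s, f ω ∈ T.F m ∧ f ω ≠ 0) →
    (∀ s', s ≤ s' → Kn s' (fun ω => (f ω)⁻¹) → Run s' c) → Run s fun ω => c ω + 1
  run_test : ∀ {s} {c : Ω → ℕ} {f : Ω → L}, Kn s f →
    (∀ s', s ≤ s' → (∀ ω ∈ dom s', f ω = 0) → Run s' c) →
    (∀ s', s ≤ s' → (∀ ω ∈ dom s', f ω ≠ 0) → Run s' c) → Run s fun ω => c ω + 1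

/-! ### Elementary routines on the machine -/

namespace LMachine

attribute [instance] LMachine.pre

variable {K : Type u} {L : Type v} [Field K] [Field L] [Algebra K L] {m : ℕ}
  {T : QuadTower K L m} {Ω : Type w} (M : LMachine T Ω)

/-- The function `f` can be computed from the state `s` with `n` operations. -/
def Comp (s : M.St) (f : Ω → L) (n : ℕ) : Prop :=
  ∀ s', s ≤ s' → ∀ c : Ω → ℕ, (∀ s'', s' ≤ s'' → M.Kn s'' f → M.Run s'' c) →
    M.Run s' fun ω => c ω + n

variable {M}

lemma Kn.comp {s : M.St} {f : Ω → L} (h : M.Kn s f) : M.Comp s f 0 :=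
  fun s' h' _ hc => hc s' le_rfl (M.kn_mono h' h)

lemma Comp.mono {s s' : M.St} {f : Ω → L} {n : ℕ} (h : M.Comp s f n) (hs : s ≤ s') :
    M.Comp s' f n := fun s'' h' => h s'' (hs.trans h')

lemma Comp.le {s : M.St} {f : Ω → L} {n n' : ℕ} (h : M.Comp s f n) (hn : n ≤ n') :
    M.Comp s f n' := fun s'' h' c hc => M.run_mono (h s'' h' c hc) fun _ _ => by omega

lemma Comp.congr {s : M.St} {f g : Ω → L} {n : ℕ} (h : M.Comp s f n)
    (hfg : ∀ ω ∈ M.dom s, f ω = g ω) : M.Comp s g n := fun s' h' c hc =>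
  h s' h' c fun s'' h'' hf => hc s'' h'' (M.kn_congr hf fun ω hω =>
    hfg ω (M.dom_anti (h'.trans h'') hω))

lemma Comp.run {s : M.St} {f : Ω → L} {n : ℕ} {c : Ω → ℕ} (h : M.Comp s f n)
    (hc : ∀ s', s ≤ s' → M.Kn s' f → M.Run s' c) : M.Run s fun ω => c ω + n :=
  h s le_rfl c hc

lemma Comp.bind {s : M.St} {f g : Ω → L} {n k : ℕ} (h : M.Comp s f n)
    (hg : ∀ s', s ≤ s' → M.Kn s' f → M.Comp s' g k) : M.Comp s g (n + k) := fun s' h' c hc =>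
  M.run_mono (h s' h' (fun ω => c ω + k) fun s'' h'' hf =>
    hg s'' (h'.trans h'') hf s'' le_rfl c fun s₃ h₃ => hc s₃ (h''.trans h₃)) fun _ _ => by omega

lemma comp_const (s : M.St) (a : L) : M.Comp s (fun _ => a) 1 :=
  fun _ _ _ hc => M.run_const a hc

lemma Comp.mul {s : M.St} {f g : Ω → L} {n k : ℕ} (hf : M.Comp s f n) (hg : M.Comp s g k) :
    M.Comp s (fun ω => f ω * g ω) (n + k + 1) :=
  (hf.bind fun s' h' hf' => (hg.mono h').bind fun s'' h'' hg' =>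
    (fun s₃ h₃ _ hc => M.run_mul (M.kn_mono (h''.trans h₃) hf') (M.kn_mono h₃ hg') hc :
      M.Comp s'' (fun ω => f ω * g ω) 1)).le (by omega)

lemma Comp.add {s : M.St} {f g : Ω → L} {n k : ℕ} (hf : M.Comp s f n) (hg : M.Comp s g k) :
    M.Comp s (fun ω => f ω + g ω) (n + k + 1) :=
  (hf.bind fun s' h' hf' => (hg.mono h').bind fun s'' h'' hg' =>
    (fun s₃ h₃ _ hc => M.run_add (M.kn_mono (h''.trans h₃) hf') (M.kn_mono h₃ hg') hc :
      M.Comp s'' (fun ω => f ω + g ω) 1)).le (by omega)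

lemma Comp.sub {s : M.St} {f g : Ω → L} {n k : ℕ} (hf : M.Comp s f n) (hg : M.Comp s g k) :
    M.Comp s (fun ω => f ω - g ω) (n + k + 1) :=
  (hf.bind fun s' h' hf' => (hg.mono h').bind fun s'' h'' hg' =>
    (fun s₃ h₃ _ hc => M.run_sub (M.kn_mono (h''.trans h₃) hf') (M.kn_mono h₃ hg') hc :
      M.Comp s'' (fun ω => f ω - g ω) 1)).le (by omega)

lemma comp_list_sum {α : Type*} {s : M.St} (l : List α) {f : α → Ω → L} {n : ℕ}
    (h : ∀ a ∈ l, M.Comp s (f a) n) :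
    M.Comp s (fun ω => (l.map fun a => f a ω).sum) (l.length * (n + 1)) := by
  induction l with
  | nil => exact (Kn.comp (M.kn_zero s)).le (by simp)
  | cons a l ih =>
    have h1 := (h a (by simp)).add (ih fun b hb => h b (by simp [hb]))
    simp only [List.map_cons, List.sum_cons]
    refine h1.le ?_
    rw [List.length_cons]
    nlinarith

lemma run_list {α : Type*} {s : M.St} (l : List α) {f : α → Ω → L} {n : ℕ} {c : Ω → ℕ}
    (h : ∀ a ∈ l, M.Comp s (f a) n)
    (hc : ∀ s', s ≤ s' → (∀ a ∈ l, M.Kn s' (f a)) → M.Run s' c) :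
    M.Run s fun ω => c ω + l.length * n := by
  induction l generalizing s with
  | nil => exact M.run_mono (hc s le_rfl (by simp)) (by simp)
  | cons a l ih =>
    have h1 : M.Run s fun ω => (c ω + l.length * n) + n := by
      refine (h a (by simp)).run fun s' h' ha => ?_
      refine ih (fun b hb => (h b (by simp [hb])).mono h') fun s'' h'' hl => ?_
      refine hc s'' (h'.trans h'') fun b hb => ?_
      rcases List.mem_cons.1 hb with rfl | hb
      · exact M.kn_mono h'' ha
      · exact hl b hb
    refine M.run_mono h1 fun ω _ => ?_
    rw [List.length_cons]
    nlinarith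

lemma run_family {ι : Type*} [Fintype ι] {s : M.St} {f : ι → Ω → L} {n : ℕ} {c : Ω → ℕ}
    (h : ∀ i, M.Comp s (f i) n)
    (hc : ∀ s', s ≤ s' → (∀ i, M.Kn s' (f i)) → M.Run s' c) :
    M.Run s fun ω => c ω + Fintype.card ι * n := by
  have := run_list (M := M) (s := s) (Finset.univ : Finset ι).toList (f := f) (n := n) (c := c)
    (fun a _ => h a) fun s' h' hk => hc s' h' fun i => hk i (by simp)
  simpa using this

lemma Kn.coef {s : M.St} {f : Ω → L} (hf : M.Kn s f) {h : ℕ} (hm : h ≤ m) (A : Fin h → Bool) :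
    M.Kn s fun ω => T.coef h A (f ω) := by
  induction h with
  | zero => exact hf
  | succ h ih => exact M.kn_part (ih (by omega) _) (by omega) _

/-- θ_i fixes both parts of x₀ + γ x₁ and only replaces γ by its conjugate. The parts are free, so a
constant, a product and a sum suffice. -/
lemma Kn.comp_θ {s : M.St} {f : Ω → L} (hf : M.Kn s f) {i : ℕ} (hi : i < m) :
    M.Comp s (fun ω => T.θ i (f ω)) 3 := by
  refine ((Kn.comp (M.kn_part hf hi false)).add
    ((comp_const s (T.θ i (T.γ i))).mul (Kn.comp (M.kn_part hf hi true)))).congr fun ω _ => ?_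
  conv_rhs => rw [← T.part_add_part i (f ω), map_add, map_mul, T.θ_part hi, T.θ_part hi]

/-- Multiplying with one conjugate per level turns f into its norm in K, where inversion is a single
operation; the product of the conjugates used completes the inverse. A level costs 3 + 1 + 1
operations. -/
lemma Kn.comp_inv {s : M.St} {f : Ω → L} (hf : M.Kn s f) (h0 : ∀ ω ∈ M.dom s, f ω ≠ 0) :
    M.Comp s (fun ω => (f ω)⁻¹) (5 * m + 3) := by
  -- With k levels to go, p = f q has reached F_{m-k}. The start is p = f, q = 1 in F_0 = L, and the
  -- end lies in F_m = K.
  have key : ∀ k ≤ m, ∀ s' : M.St, s ≤ s' → ∀ p q : Ω → L, M.Kn s' p → M.Kn s' q →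
      (∀ ω ∈ M.dom s', p ω = f ω * q ω ∧ p ω ≠ 0 ∧ p ω ∈ T.F (m - k)) →
      M.Comp s' (fun ω => (f ω)⁻¹) (5 * k + 2) := by
    intro k
    induction k with
    | zero =>
      intro _ s' h' p q hp hq hpq
      have h1 : M.Comp s' (fun ω => (p ω)⁻¹) 1 := fun s'' h'' c hc =>
        M.run_base_inv (M.kn_mono h'' hp)
          (fun ω hω => ⟨(hpq ω (M.dom_anti h'' hω)).2.2, (hpq ω (M.dom_anti h'' hω)).2.1⟩) hc
      refine ((Kn.comp hq).mul h1).congr fun ω hω => ?_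
      obtain ⟨e1, e2, -⟩ := hpq ω hω
      have : q ω ≠ 0 := fun hq0 => e2 (by rw [e1, hq0, mul_zero])
      rw [e1, mul_inv, mul_comm (f ω)⁻¹, ← mul_assoc, mul_inv_cancel₀ this, one_mul]
    | succ k ih =>
      intro hk s' h' p q hp hq hpq
      have hi : m - (k + 1) < m := by omega
      refine ((hp.comp_θ hi).bind fun s₁ h₁ hθ =>
        ((Kn.comp (M.kn_mono h₁ hp)).mul (Kn.comp hθ)).bind fun s₂ h₂ hp' =>
        ((Kn.comp (M.kn_mono (h₁.trans h₂) hq)).mul (Kn.comp (M.kn_mono h₂ hθ))).bind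
          fun s₃ h₃ hq' => ih (by omega) s₃ (h'.trans (h₁.trans (h₂.trans h₃))) _ _
            (M.kn_mono h₃ hp') hq' fun ω hω => ?_).le (by omega)
      obtain ⟨e1, e2, e3⟩ := hpq ω (M.dom_anti (h₁.trans (h₂.trans h₃)) hω)
      refine ⟨by rw [← mul_assoc, ← e1], mul_ne_zero e2 ((map_ne_zero _).2 e2), ?_⟩
      have hmk : m - k = m - (k + 1) + 1 := by omega
      rw [hmk, T.mem_F_succ]
      exact ⟨mul_mem e3 (T.θ_mem e3 _), by rw [map_mul, T.invol, mul_comm]⟩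
  refine ((comp_const s (1 : L)).bind fun s' h' h1 => key m le_rfl s' h' f (fun _ => 1)
    (M.kn_mono h' hf) h1 fun ω hω => ⟨by simp, h0 ω (M.dom_anti h' hω), ?_⟩).le (by omega)
  rw [Nat.sub_self]
  exact fun i hi => by omega

/-- Find a nonzero coordinate. -/
lemma run_find {s : M.St} {h : ℕ} (hm : h ≤ m) {f : Ω → L} (hf : M.Kn s f)
    (h0 : ∀ ω ∈ M.dom s, f ω ≠ 0) {c : Ω → ℕ}
    (hc : ∀ s', s ≤ s' → ∀ p : Fin h → Bool, (∀ ω ∈ M.dom s', T.coef h p (f ω) ≠ 0) →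
      M.Run s' c) :
    M.Run s fun ω => c ω + 2 ^ h := by
  have key : ∀ l : List (Fin h → Bool), ∀ s', s ≤ s' →
      (∀ ω ∈ M.dom s', ∀ A, A ∉ l → T.coef h A (f ω) = 0) →
      M.Run s' fun ω => c ω + l.length := by
    intro l
    induction l with
    | nil =>
      intro s' h' hz
      -- No instance gets here: all coordinates of a nonzero element would be zero.
      refine M.run_empty fun ω hω => h0 ω (M.dom_anti h' hω) (T.ext_coef (h := h) fun A => ?_)
      rw [hz ω hω A (by simp), map_zero]
    | cons a l ih =>
      intro s' h' hz
      have h1 := M.run_test (s := s') (c := fun ω => c ω + l.length)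
        (M.kn_mono h' (Kn.coef hf hm a)) (fun s'' h'' ha => ih s'' (h'.trans h'') fun ω hω A hA => by
          by_cases hAa : A = a
          · rw [hAa, ha ω hω]
          · exact hz ω (M.dom_anti h'' hω) A (by simp [hAa, hA]))
        (fun s'' h'' ha => M.run_mono (hc s'' (h'.trans h'') a ha) fun _ _ => by omega)
      exact M.run_mono h1 fun _ _ => by rw [List.length_cons]; omega
  have := key Finset.univ.toList s le_rfl fun ω _ A hA => absurd (by simp) hA
  simpa using this

end LMachine

/-! ### Gaussian elimination over the fields of the tower -/

namespace QuadTower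

open Module

variable {K : Type u} {L : Type v} [Field K] [Field L] [Algebra K L] {m : ℕ} (T : QuadTower K L m)

/-- A list of pivot positions, vectors and companion vectors is reduced if every vector has
coordinate `1` at its own pivot and `0` at the others. -/
def Reduced (h : ℕ) (W : List ((Fin h → Bool) × L × L)) : Prop :=
  (∀ a ∈ W, T.coef h a.1 a.2.1 = 1) ∧
    W.Pairwise fun a b => T.coef h a.1 b.2.1 = 0 ∧ T.coef h b.1 a.2.1 = 0

/-- A submodule contains the given pairs, the pairs in `W` and the pairs `(0, u)`, `u ∈ R`. -/
def Contains {h : ℕ} (S : Submodule (T.F h) (L × L)) (l : List (L × L))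
    (W : List ((Fin h → Bool) × L × L)) (R : List L) : Prop :=
  (∀ x ∈ l, x ∈ S) ∧ (∀ a ∈ W, a.2 ∈ S) ∧ ∀ r ∈ R, ((0, r) : L × L) ∈ S

/-- The `F h`-span of the given pairs. -/
def rowSpan (h : ℕ) (l : List (L × L)) (W : List ((Fin h → Bool) × L × L)) (R : List L) :
    Submodule (T.F h) (L × L) :=
  Submodule.span (T.F h) ({x | x ∈ l} ∪ {x | ∃ a ∈ W, a.2 = x} ∪ {x | ∃ r ∈ R, (0, r) = x})

variable {T}

lemma rowSpan_le {h : ℕ} {l : List (L × L)} {W : List ((Fin h → Bool) × L × L)} {R : List L}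
    {S : Submodule (T.F h) (L × L)} : T.rowSpan h l W R ≤ S ↔ T.Contains S l W R := by
  rw [rowSpan, Submodule.span_le]
  constructor
  · exact fun H => ⟨fun x hx => H (.inl (.inl hx)), fun a ha => H (.inl (.inr ⟨a, ha, rfl⟩)),
      fun r hr => H (.inr ⟨r, hr, rfl⟩)⟩
  · rintro ⟨h1, h2, h3⟩ x ((hx | ⟨a, ha, rfl⟩) | ⟨r, hr, rfl⟩)
    exacts [h1 x hx, h2 a ha, h3 r hr]

lemma contains_rowSpan {h : ℕ} (l : List (L × L)) (W : List ((Fin h → Bool) × L × L)) (R : List L) :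
    T.Contains (T.rowSpan h l W R) l W R := rowSpan_le.1 le_rfl

/-- A span is determined by the submodules that contain it, so a row operation only needs to be
checked inside an arbitrary submodule. -/
lemma rowSpan_eq {h : ℕ} {l l' : List (L × L)} {W W' : List ((Fin h → Bool) × L × L)}
    {R R' : List L} (H : ∀ S, T.Contains S l W R ↔ T.Contains S l' W' R') :
    T.rowSpan h l W R = T.rowSpan h l' W' R' :=
  eq_of_forall_ge_iff fun S => by rw [rowSpan_le, rowSpan_le, H]

lemma mul_mem_pair {h : ℕ} (S : Submodule (T.F h) (L × L)) {c : L} (hc : c ∈ T.F h) {x : L × L}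
    (hx : x ∈ S) : (c * x.1, c * x.2) ∈ S := S.smul_mem ⟨c, hc⟩ hx

lemma list_sum_pair {α : Type*} (W : List α) (f g : α → L) :
    ((W.map f).sum, (W.map g).sum) = (W.map fun a => (f a, g a)).sum := by
  induction W with
  | nil => rfl
  | cons a W ih => simp [← ih]

lemma list_sum_mem_pair {h : ℕ} (hm : h ≤ m) (S : Submodule (T.F h) (L × L))
    {W : List ((Fin h → Bool) × L × L)} (hW : ∀ a ∈ W, a.2 ∈ S) (v : L) :
    ((W.map fun a => T.coef h a.1 v * a.2.1).sum, (W.map fun a => T.coef h a.1 v * a.2.2).sum) ∈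
      S := by
  rw [list_sum_pair]
  refine S.list_sum_mem fun x hx => ?_
  obtain ⟨a, ha, rfl⟩ := List.mem_map.1 hx
  exact mul_mem_pair S (T.coef_mem hm _ _) (hW a ha)

lemma list_sum_coef {h : ℕ} {W : List ((Fin h → Bool) × L × L)} (hW : T.Reduced h W)
    (c : ((Fin h → Bool) × L × L) → L) {a : (Fin h → Bool) × L × L} (ha : a ∈ W) :
    (W.map fun b => c b * T.coef h a.1 b.2.1).sum = c a := by
  have aux : ∀ W' : List ((Fin h → Bool) × L × L), (∀ b ∈ W', T.coef h a.1 b.2.1 = 0) →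
      (W'.map fun b => c b * T.coef h a.1 b.2.1).sum = 0 := fun W' h' => by
    refine List.sum_eq_zero fun x hx => ?_
    obtain ⟨b, hb, rfl⟩ := List.mem_map.1 hx
    rw [h' b hb, mul_zero]
  induction W with
  | nil => simp at ha
  | cons b W ih =>
    obtain ⟨h1, h2⟩ := hW
    rw [List.pairwise_cons] at h2
    rw [List.map_cons, List.sum_cons]
    rcases List.mem_cons.1 ha with rfl | ha'
    · rw [h1 _ (by simp), mul_one, aux W fun b hb => (h2.1 b hb).1, add_zero]
    · rw [(h2.1 a ha').2, mul_zero, zero_add]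
      exact ih ⟨fun b hb => h1 b (by simp [hb]), h2.2⟩ ha'

lemma map_list_sum_coef {h : ℕ} (W : List ((Fin h → Bool) × L × L))
    (c : ((Fin h → Bool) × L × L) → L) (hc : ∀ b ∈ W, c b ∈ T.F h) (A : Fin h → Bool) :
    T.coef h A (W.map fun b => c b * b.2.1).sum = (W.map fun b => c b * T.coef h A b.2.1).sum := by
  rw [map_list_sum, List.map_map]
  congr 1
  exact List.map_congr_left fun b hb => T.coef_mul (hc b hb) _ _

/-- Reading a linear relation at the pivot of one row isolates its coefficient, so the rows are
independent. -/
lemma Reduced.length_le {h : ℕ} {W : List ((Fin h → Bool) × L × L)} (hW : T.Reduced h W)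
    (X : Submodule (T.F h) L) (hX : ∀ a ∈ W, a.2.1 ∈ X) : W.length ≤ finrank (T.F h) X := by
  have := T.finiteDimensional
  have hli : LinearIndependent (T.F h) fun i : Fin W.length => (⟨W[i].2.1, hX _ (by simp)⟩ : X) := by
    rw [Fintype.linearIndependent_iff]
    intro c hc i
    have h1 : ∑ j : Fin W.length, (c j : L) * W[j].2.1 = 0 := by
      have := congrArg Subtype.val hc
      simpa [Algebra.smul_def] using this
    have h2 : T.coef h W[i].1 (∑ j : Fin W.length, (c j : L) * W[j].2.1) = c i := by
      rw [map_sum, Finset.sum_eq_single i]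
      · rw [T.coef_mul (c i).2, hW.1 _ (by simp), mul_one]
      · intro j _ hj
        have hp := List.pairwise_iff_getElem.1 hW.2
        rw [T.coef_mul (c j).2]
        rcases lt_or_gt_of_ne hj with hlt | hlt
        · exact mul_eq_zero_of_right _ (hp j i j.2 i.2 hlt).2
        · exact mul_eq_zero_of_right _ (hp i j i.2 j.2 hlt).1
      · simp
    rw [h1, map_zero] at h2
    exact Subtype.ext h2.symm
  simpa using hli.fintype_card_le_finrank

lemma Reduced.length_le_two_pow {h : ℕ} {W : List ((Fin h → Bool) × L × L)} (hW : T.Reduced h W)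
    (hm : h ≤ m) : W.length ≤ 2 ^ h := by
  have := hW.length_le ⊤ (by simp)
  rwa [_root_.finrank_top, T.finrank_F_top hm] at this

variable (T) in
/-- The remainder of a pair after subtracting multiples of the reduced rows. -/
def remainder (h : ℕ) (W : List ((Fin h → Bool) × L × L)) (x : L × L) : L × L :=
  (x.1 - (W.map fun a => T.coef h a.1 x.1 * a.2.1).sum,
    x.2 - (W.map fun a => T.coef h a.1 x.1 * a.2.2).sum)

lemma remainder_mem {h : ℕ} (hm : h ≤ m) (S : Submodule (T.F h) (L × L))
    {W : List ((Fin h → Bool) × L × L)} (hW : ∀ a ∈ W, a.2 ∈ S) (x : L × L) :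
    T.remainder h W x ∈ S ↔ x ∈ S := by
  have h1 := list_sum_mem_pair hm S hW x.1
  have h2 : T.remainder h W x = x - ((W.map fun a => T.coef h a.1 x.1 * a.2.1).sum,
    (W.map fun a => T.coef h a.1 x.1 * a.2.2).sum) := rfl
  rw [h2]
  exact ⟨fun h3 => by simpa using S.add_mem h3 h1, fun h3 => S.sub_mem h3 h1⟩

lemma coef_remainder {h : ℕ} (hm : h ≤ m) {W : List ((Fin h → Bool) × L × L)}
    (hW : T.Reduced h W) (x : L × L) {a : (Fin h → Bool) × L × L} (ha : a ∈ W) :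
    T.coef h a.1 (T.remainder h W x).1 = 0 := by
  rw [remainder, map_sub, map_list_sum_coef W (fun b => T.coef h b.1 x.1)
    (fun b _ => T.coef_mem hm _ _), list_sum_coef hW _ ha, sub_self]

variable (T) in
/-- Insert a new reduced row. -/
def addRow (h : ℕ) (p : Fin h → Bool) (x : L × L) (W : List ((Fin h → Bool) × L × L)) :
    List ((Fin h → Bool) × L × L) :=
  (p, x) :: W.map fun a => (a.1, a.2.1 - T.coef h p a.2.1 * x.1, a.2.2 - T.coef h p a.2.1 * x.2)

lemma Reduced.addRow {h : ℕ} (hm : h ≤ m) {W : List ((Fin h → Bool) × L × L)}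
    (hW : T.Reduced h W) {p : Fin h → Bool} {x : L × L} (hp : T.coef h p x.1 = 1)
    (hx : ∀ a ∈ W, T.coef h a.1 x.1 = 0) : T.Reduced h (T.addRow h p x W) := by
  have key : ∀ (A : Fin h → Bool) (y : L), T.coef h A (y - T.coef h p y * x.1) =
      T.coef h A y - T.coef h p y * T.coef h A x.1 := fun A y => by
    rw [map_sub, T.coef_mul (T.coef_mem hm _ _)]
  refine ⟨fun a ha => ?_, List.pairwise_cons.2 ⟨fun a ha => ?_, ?_⟩⟩
  · rcases List.mem_cons.1 ha with rfl | ha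
    · exact hp
    · obtain ⟨b, hb, rfl⟩ := List.mem_map.1 ha
      simp only [key, hx b hb, hW.1 b hb]
      ring
  · obtain ⟨b, hb, rfl⟩ := List.mem_map.1 ha
    simp only [key, hp, hx b hb]
    simp
  · rw [List.pairwise_map]
    refine hW.2.imp_of_mem fun {a b} ha hb hab => ?_
    simp only [key, hx a ha, hx b hb, hab.1, hab.2]
    simp

lemma contains_addRow {h : ℕ} (hm : h ≤ m) (S : Submodule (T.F h) (L × L)) (l : List (L × L))
    (W : List ((Fin h → Bool) × L × L)) (R : List L) (p : Fin h → Bool) (x y : L × L) {c : L}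
    (hc : c ∈ T.F h) (hc0 : c ≠ 0)
    (hy : y = (c * (T.remainder h W x).1, c * (T.remainder h W x).2)) :
    T.Contains S (x :: l) W R ↔ T.Contains S l (T.addRow h p y W) R := by
  have hyS : y ∈ S ↔ T.remainder h W x ∈ S := by
    subst hy
    refine ⟨fun h' => ?_, fun h' => mul_mem_pair S hc h'⟩
    have := mul_mem_pair S (inv_mem hc) h'
    simpa [← mul_assoc, hc0] using this
  have hrow : y ∈ S → ∀ a : (Fin h → Bool) × L × L,
      ((a.2.1 - T.coef h p a.2.1 * y.1, a.2.2 - T.coef h p a.2.1 * y.2) : L × L) ∈ S ↔ a.2 ∈ S := by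
    intro hy' a
    have h1 := mul_mem_pair S (T.coef_mem hm p a.2.1) hy'
    have h2 : ((a.2.1 - T.coef h p a.2.1 * y.1, a.2.2 - T.coef h p a.2.1 * y.2) : L × L) =
      a.2 - (T.coef h p a.2.1 * y.1, T.coef h p a.2.1 * y.2) := rfl
    rw [h2]
    exact ⟨fun h3 => by simpa using S.add_mem h3 h1, fun h3 => S.sub_mem h3 h1⟩
  constructor
  · rintro ⟨h1, h2, h3⟩
    have hy' : y ∈ S := hyS.2 ((remainder_mem hm S h2 x).2 (h1 x (by simp)))
    refine ⟨fun z hz => h1 z (by simp [hz]), fun a ha => ?_, h3⟩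
    rcases List.mem_cons.1 ha with rfl | ha
    · exact hy'
    · obtain ⟨b, hb, rfl⟩ := List.mem_map.1 ha
      exact (hrow hy' b).2 (h2 b hb)
  · rintro ⟨h1, h2, h3⟩
    have hy' : y ∈ S := h2 (p, y) (by simp [addRow])
    have hW : ∀ a ∈ W, a.2 ∈ S := fun a ha =>
      (hrow hy' a).1 (h2 (a.1, _, _) (List.mem_cons_of_mem _ (List.mem_map.2 ⟨a, ha, rfl⟩)))
    refine ⟨fun z hz => ?_, hW, h3⟩
    rcases List.mem_cons.1 hz with rfl | hz
    · exact (remainder_mem hm S hW _).1 (hyS.1 hy')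
    · exact h1 z hz

/-- A row whose vector reduces to zero carries no pivot; all that is left of it is its companion,
which joins the list R. -/
lemma contains_cons_remainder {h : ℕ} (hm : h ≤ m) (S : Submodule (T.F h) (L × L))
    (l : List (L × L)) (W : List ((Fin h → Bool) × L × L)) (R : List L) (x : L × L)
    (hx : (T.remainder h W x).1 = 0) :
    T.Contains S (x :: l) W R ↔ T.Contains S l W ((T.remainder h W x).2 :: R) := by
  have hx' : ((0, (T.remainder h W x).2) : L × L) = T.remainder h W x := by rw [← hx]
  constructor
  · rintro ⟨h1, h2, h3⟩
    refine ⟨fun z hz => h1 z (by simp [hz]), h2, fun r hr => ?_⟩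
    rcases List.mem_cons.1 hr with rfl | hr
    · rw [hx']; exact (remainder_mem hm S h2 x).2 (h1 x (by simp))
    · exact h3 r hr
  · rintro ⟨h1, h2, h3⟩
    refine ⟨fun z hz => ?_, h2, fun r hr => h3 r (by simp [hr])⟩
    rcases List.mem_cons.1 hz with rfl | hz
    · have := h3 _ (List.mem_cons_self)
      rw [hx'] at this
      exact (remainder_mem hm S h2 _).1 this
    · exact h1 z hz

lemma addRow_spec {h : ℕ} (hm : h ≤ m) {W : List ((Fin h → Bool) × L × L)} (hW : T.Reduced h W)
    (x : L × L) {p : Fin h → Bool} {c : L} (hp : T.coef h p (T.remainder h W x).1 ≠ 0)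
    (hc : c = (T.coef h p (T.remainder h W x).1)⁻¹) (l : List (L × L)) (R : List L) :
    T.Reduced h (T.addRow h p (c * (T.remainder h W x).1, c * (T.remainder h W x).2) W) ∧
    T.rowSpan h l (T.addRow h p (c * (T.remainder h W x).1, c * (T.remainder h W x).2) W) R =
      T.rowSpan h (x :: l) W R := by
  have hcF : c ∈ T.F h := hc ▸ inv_mem (T.coef_mem hm _ _)
  refine ⟨hW.addRow hm ?_ fun a ha => ?_, (rowSpan_eq fun S => contains_addRow hm S _ _ _ p x _ hcF
    (hc ▸ inv_ne_zero hp) rfl).symm⟩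
  · simp only [T.coef_mul hcF]
    rw [hc, inv_mul_cancel₀ hp]
  · simp only [T.coef_mul hcF]
    rw [coef_remainder hm hW _ ha, mul_zero]

lemma Reduced.length_le_finrank {h : ℕ} {W : List ((Fin h → Bool) × L × L)}
    (hW : T.Reduced h W) (l : List (L × L)) (R : List L) :
    W.length ≤ finrank (T.F h) ((T.rowSpan h l W R).map (LinearMap.fst (T.F h) L L)) :=
  hW.length_le _ fun a ha => Submodule.mem_map_of_mem (f := LinearMap.fst (T.F h) L L)
    ((contains_rowSpan (T := T) l W R).2.1 a ha)

/-- A nonzero remainder yields one more independent row. Hence the dimension of the first projection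
bounds the number of expensive pivot steps, however many rows are processed. -/
lemma Reduced.length_lt_finrank {h : ℕ} (hm : h ≤ m) {W : List ((Fin h → Bool) × L × L)}
    (hW : T.Reduced h W) {x : L × L} (hx : (T.remainder h W x).1 ≠ 0) (l : List (L × L))
    (R : List L) :
    W.length < finrank (T.F h) ((T.rowSpan h (x :: l) W R).map (LinearMap.fst (T.F h) L L)) := by
  obtain ⟨p, hp⟩ : ∃ p, T.coef h p (T.remainder h W x).1 ≠ 0 := by
    by_contra hcon
    push Not at hcon
    exact hx (T.ext_coef (h := h) fun A => by rw [hcon A, map_zero])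
  obtain ⟨h1, h2⟩ := addRow_spec hm hW x hp rfl l R
  have := h1.length_le_finrank l R
  rw [h2] at this
  simpa [QuadTower.addRow] using this

end QuadTower

/-! ### Elimination on the machine -/

namespace LMachine

open QuadTower Module

variable {K : Type u} {L : Type v} [Field K] [Field L] [Algebra K L] {m : ℕ}
  {T : QuadTower K L m} {Ω : Type w} {M : LMachine T Ω}

/-- The values of a list of functions. -/
def ev (l : List (Ω → L)) (ω : Ω) : List L := l.map fun f => f ω

/-- The values of a list of pairs of functions. -/
def evPairs (l : List ((Ω → L) × (Ω → L))) (ω : Ω) : List (L × L) := l.map fun a => (a.1 ω, a.2 ω)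

/-- The values of a list of rows. -/
def evRows {h : ℕ} (W : List ((Fin h → Bool) × (Ω → L) × (Ω → L))) (ω : Ω) :
    List ((Fin h → Bool) × L × L) := W.map fun a => (a.1, a.2.1 ω, a.2.2 ω)

/-- Gauss–Jordan elimination over `F h` with companion vectors. -/
theorem run_elim_aux {h : ℕ} (hm : h ≤ m) (D : Ω → ℕ) {c : Ω → ℕ}
    (l : List ((Ω → L) × (Ω → L))) (W : List ((Fin h → Bool) × (Ω → L) × (Ω → L)))
    (R : List (Ω → L)) (s : M.St) (hl : ∀ a ∈ l, M.Kn s a.1 ∧ M.Kn s a.2)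
    (hW : ∀ a ∈ W, M.Kn s a.2.1 ∧ M.Kn s a.2.2) (hR : ∀ r ∈ R, M.Kn s r)
    (hred : ∀ ω ∈ M.dom s, T.Reduced h (evRows W ω))
    (hD : ∀ ω ∈ M.dom s, finrank (T.F h) ((T.rowSpan h (evPairs l ω) (evRows W ω) (ev R ω)).map
      (LinearMap.fst (T.F h) L L)) ≤ D ω)
    (hc : ∀ s', s ≤ s' → ∀ (W' : List ((Fin h → Bool) × (Ω → L) × (Ω → L))) (R' : List (Ω → L)),
      (∀ a ∈ W', M.Kn s' a.2.1 ∧ M.Kn s' a.2.2) → (∀ r ∈ R', M.Kn s' r) →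
      (∀ ω ∈ M.dom s', T.Reduced h (evRows W' ω) ∧ T.rowSpan h [] (evRows W' ω) (ev R' ω) =
        T.rowSpan h (evPairs l ω) (evRows W ω) (ev R ω)) →
      W'.length + R'.length = l.length + W.length + R.length → M.Run s' c) :
    M.Run s fun ω => c ω + (l.length * (4 * min (D ω) (2 ^ h) + 3) +
      (D ω - W.length) * (5 * 2 ^ h + 5 * m + 5)) := by
  have := T.finiteDimensional
  induction l generalizing W R s with
  | nil =>
    exact M.run_mono (hc s le_rfl W R hW hR (fun ω hω => ⟨hred ω hω, rfl⟩) (by simp))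
      fun ω _ => by omega
  | cons x l ih =>
    have hlenW : ∀ ω ∈ M.dom s, W.length ≤ min (D ω) (2 ^ h) := fun ω hω => by
      have e : W.length = (evRows W ω).length := by simp [evRows]
      rw [e]
      exact le_min (((hred ω hω).length_le_finrank _ _).trans (hD ω hω))
        ((hred ω hω).length_le_two_pow hm)
    set v' : Ω → L := fun ω => (T.remainder h (evRows W ω) (x.1 ω, x.2 ω)).1 with hv'
    set u' : Ω → L := fun ω => (T.remainder h (evRows W ω) (x.1 ω, x.2 ω)).2 with hu'
    have hx := hl x (by simp)
    have cv : M.Comp s v' (2 * W.length + 1) := by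
      refine (((Kn.comp hx.1).sub (comp_list_sum W (n := 1)
        (f := fun a ω => T.coef h a.1 (x.1 ω) * a.2.1 ω) fun a ha =>
          (Kn.comp (hx.1.coef hm a.1)).mul (Kn.comp (hW a ha).1))).congr fun ω _ => ?_).le (by omega)
      simp [hv', remainder, evRows, List.map_map, Function.comp_def]
    have cu : M.Comp s u' (2 * W.length + 1) := by
      refine (((Kn.comp hx.2).sub (comp_list_sum W (n := 1)
        (f := fun a ω => T.coef h a.1 (x.1 ω) * a.2.2 ω) fun a ha =>
          (Kn.comp (hx.1.coef hm a.1)).mul (Kn.comp (hW a ha).2))).congr fun ω _ => ?_).le (by omega)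
      simp [hu', remainder, evRows, List.map_map, Function.comp_def]
    let B : Ω → ℕ := fun ω => c ω + (l.length * (4 * min (D ω) (2 ^ h) + 3) +
      (D ω - W.length) * (5 * 2 ^ h + 5 * m + 5))
    -- Every row pays for two remainders of 2|W| + 1 operations each and a zero test. The bound D
    -- occurs only in the cost; the run itself never consults it.
    have main : M.Run s fun ω => ((B ω + 1) + (2 * W.length + 1)) + (2 * W.length + 1) := by
      refine cv.run fun s₁ h₁ kv => (cu.mono h₁).run fun s₂ h₂ ku => ?_
      have h₁₂ := h₁.trans h₂
      refine M.run_test (M.kn_mono h₂ kv) (fun s₃ h₃ hz => ?_) fun s₃ h₃ hnz => ?_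
      · have h₀₃ := h₁₂.trans h₃
        have hspan : ∀ ω ∈ M.dom s₃, T.rowSpan h (evPairs l ω) (evRows W ω) (ev (u' :: R) ω) =
            T.rowSpan h (evPairs (x :: l) ω) (evRows W ω) (ev R ω) := fun ω hω =>
          (rowSpan_eq fun S => contains_cons_remainder hm S _ _ _ _ (hz ω hω)).symm
        refine ih W (u' :: R) s₃
          (fun a ha => ⟨M.kn_mono h₀₃ (hl a (by simp [ha])).1, M.kn_mono h₀₃ (hl a (by simp [ha])).2⟩)
          (fun a ha => ⟨M.kn_mono h₀₃ (hW a ha).1, M.kn_mono h₀₃ (hW a ha).2⟩)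
          (fun r hr => ?_) (fun ω hω => hred ω (M.dom_anti h₀₃ hω))
          (fun ω hω => by rw [hspan ω hω]; exact hD ω (M.dom_anti h₀₃ hω))
          fun s' h' W' R' kW kR hW' hlen' => hc s' (h₀₃.trans h') W' R' kW kR
            (fun ω hω => ⟨(hW' ω hω).1, (hW' ω hω).2.trans (hspan ω (M.dom_anti h' hω))⟩) ?_
        · rcases List.mem_cons.1 hr with rfl | hr
          · exact M.kn_mono h₃ ku
          · exact M.kn_mono h₀₃ (hR r hr)
        · simp only [List.length_cons] at hlen' ⊢; omega
      · let B' : Ω → ℕ := fun ω => c ω + (l.length * (4 * min (D ω) (2 ^ h) + 3) +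
          (D ω - (W.length + 1)) * (5 * 2 ^ h + 5 * m + 5))
        have h₀₃ := h₁₂.trans h₃
        have kv₃ := M.kn_mono (h₂.trans h₃) kv
        have ku₃ := M.kn_mono h₃ ku
        have hlt : ∀ ω ∈ M.dom s₃, W.length + 1 ≤ D ω := fun ω hω => by
          have e : W.length = (evRows W ω).length := by simp [evRows]
          rw [e]
          exact ((hred ω (M.dom_anti h₀₃ hω)).length_lt_finrank hm (hnz ω hω) _ _).trans_le
            (hD ω (M.dom_anti h₀₃ hω))
        -- After the search a pivot step costs 5m + 3 for the inverse, 2 for normalizing the row and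
        -- its companion, and 4|W| for clearing the new pivot from the old rows.
        have pivot : ∀ s₄, s₃ ≤ s₄ → ∀ p : Fin h → Bool,
            (∀ ω ∈ M.dom s₄, T.coef h p (v' ω) ≠ 0) →
            M.Run s₄ fun ω => (((B' ω + W.length * 2) + W.length * 2) + 1 + 1) + (5 * m + 3) := by
          intro s₄ h₄ p hp
          have h₀₄ := h₀₃.trans h₄
          have kv₄ := M.kn_mono h₄ kv₃
          have ku₄ := M.kn_mono h₄ ku₃
          set κ : Ω → L := fun ω => (T.coef h p (v' ω))⁻¹ with hκ
          set wn : Ω → L := fun ω => κ ω * v' ω with hwn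
          set un : Ω → L := fun ω => κ ω * u' ω with hun
          set W₁ : List ((Fin h → Bool) × (Ω → L) × (Ω → L)) := (p, wn, un) :: W.map fun a =>
            (a.1, fun ω => a.2.1 ω - T.coef h p (a.2.1 ω) * wn ω,
              fun ω => a.2.2 ω - T.coef h p (a.2.1 ω) * un ω) with hW₁
          have ev₁ : ∀ ω, evRows W₁ ω = T.addRow h p (wn ω, un ω) (evRows W ω) := fun ω => by
            simp [hW₁, evRows, addRow, List.map_map, Function.comp_def]
          have spec := fun ω hω => addRow_spec hm (hred ω (M.dom_anti h₀₄ hω)) (x.1 ω, x.2 ω)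
            (hp ω hω) rfl (evPairs l ω) (ev R ω)
          have hred₁ : ∀ ω ∈ M.dom s₄, T.Reduced h (evRows W₁ ω) := fun ω hω => by
            rw [ev₁]
            exact (spec ω hω).1
          have hspan : ∀ ω ∈ M.dom s₄, T.rowSpan h (evPairs l ω) (evRows W₁ ω) (ev R ω) =
              T.rowSpan h (evPairs (x :: l) ω) (evRows W ω) (ev R ω) := fun ω hω => by
            rw [ev₁]
            exact (spec ω hω).2
          have hD₁ : ∀ ω ∈ M.dom s₄, finrank (T.F h) ((T.rowSpan h (evPairs l ω) (evRows W₁ ω)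
              (ev R ω)).map (LinearMap.fst (T.F h) L L)) ≤ D ω := fun ω hω => by
            rw [hspan ω hω]; exact hD ω (M.dom_anti h₀₄ hω)
          have cκ : M.Comp s₄ κ (5 * m + 3) := (kv₄.coef hm p).comp_inv hp
          refine cκ.run fun s₅ h₅ kκ => ?_
          refine Comp.run (n := 1) (f := wn)
            (((Kn.comp kκ).mul (Kn.comp (M.kn_mono h₅ kv₄)))) fun s₆ h₆ kw => ?_
          refine Comp.run (n := 1) (f := un) (((Kn.comp (M.kn_mono h₆ kκ)).mul
            (Kn.comp (M.kn_mono (h₅.trans h₆) ku₄)))) fun s₇ h₇ ku => ?_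
          have h₀₇ := h₀₄.trans (h₅.trans (h₆.trans h₇))
          have kw₇ := M.kn_mono h₇ kw
          refine run_list W (n := 2)
            (f := fun a ω => a.2.1 ω - T.coef h p (a.2.1 ω) * wn ω) (fun a ha =>
            (Kn.comp (M.kn_mono h₀₇ (hW a ha).1)).sub
              ((Kn.comp (M.kn_mono h₀₇ ((hW a ha).1.coef hm p))).mul (Kn.comp kw₇))) ?_
          intro s₈ h₈ k₈
          have h₀₈ := h₀₇.trans h₈
          refine run_list W (n := 2)
            (f := fun a ω => a.2.2 ω - T.coef h p (a.2.1 ω) * un ω) (fun a ha =>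
            (Kn.comp (M.kn_mono h₀₈ (hW a ha).2)).sub
              ((Kn.comp (M.kn_mono h₀₈ ((hW a ha).1.coef hm p))).mul
                (Kn.comp (M.kn_mono h₈ ku)))) ?_
          intro s₉ h₉ k₉
          have h₀₉ := h₀₈.trans h₉
          have h₄₉ : s₄ ≤ s₉ := h₅.trans (h₆.trans (h₇.trans (h₈.trans h₉)))
          have hWl : W₁.length = W.length + 1 := by simp [hW₁]
          have := ih W₁ R s₉
            (fun a ha => ⟨M.kn_mono h₀₉ (hl a (by simp [ha])).1,
              M.kn_mono h₀₉ (hl a (by simp [ha])).2⟩)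
            (fun a ha => ?_) (fun r hr => M.kn_mono h₀₉ (hR r hr))
            (fun ω hω => hred₁ ω (M.dom_anti h₄₉ hω))
            (fun ω hω => hD₁ ω (M.dom_anti h₄₉ hω))
            fun s' h' W' R' kW kR hW' hlen' => hc s' (h₀₉.trans h') W' R' kW kR
              (fun ω hω => ⟨(hW' ω hω).1, (hW' ω hω).2.trans
                (hspan ω (M.dom_anti (h₄₉.trans h') hω))⟩) ?_
          · rw [hWl] at this
            exact this
          · rcases List.mem_cons.1 ha with rfl | ha
            · exact ⟨M.kn_mono (h₈.trans h₉) kw₇, M.kn_mono (h₈.trans h₉) ku⟩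
            · obtain ⟨b, hb, rfl⟩ := List.mem_map.1 ha
              exact ⟨M.kn_mono h₉ (k₈ b hb), k₉ b hb⟩
          · simp only [List.length_cons] at hlen' ⊢; omega
        refine M.run_mono (run_find hm kv₃ hnz pivot) fun ω hω => ?_
        have hl₀ := (hlenW ω (M.dom_anti h₀₃ hω)).trans (min_le_right _ _)
        obtain ⟨q, hq⟩ : ∃ q, D ω = W.length + 1 + q := Nat.exists_eq_add_of_le (hlt ω hω)
        have e1 : D ω - W.length = q + 1 := by omega
        have e2 : D ω - (W.length + 1) = q := by omega
        simp only [B, B', e1, e2]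
        rw [add_mul q 1]
        generalize q * (5 * 2 ^ h + 5 * m + 5) = z₁
        generalize l.length * _ = z₂
        generalize 2 ^ h = z₃ at *
        omega
    refine M.run_mono main fun ω hω => ?_
    have := hlenW ω hω
    simp only [B, List.length_cons]
    rw [add_mul l.length 1]
    omega

end LMachine

/-! ### Stable subspaces and orthogonality -/

set_option linter.unusedSectionVars false

namespace QuadTower

open Module

variable {K : Type u} {L : Type v} [Field K] [Field L] [Algebra K L] {m : ℕ} (T : QuadTower K L m)

section Stable

variable {E : Type*} [AddCommGroup E] [Module K E] [Module L E] [IsScalarTower K L E]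

/-- Stability of a `K`-subspace under `F h`. -/
def Stable (h : ℕ) (X : Submodule K E) : Prop := ∀ c ∈ T.F h, ∀ x ∈ X, c • x ∈ X

/-- The span over `F h` of a subspace over `F (h + 1)`. -/
def up (h : ℕ) (X : Submodule K E) : Submodule K E :=
  X ⊔ X.map (Algebra.lsmul K K E (T.γ h))

/-- The largest subspace over `F h` in a subspace over `F (h + 1)`. -/
def down (h : ℕ) (X : Submodule K E) : Submodule K E :=
  X ⊓ X.comap (Algebra.lsmul K K E (T.γ h))

variable {T}

lemma mem_up {h : ℕ} {X : Submodule K E} {z : E} :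
    z ∈ T.up h X ↔ ∃ x ∈ X, ∃ y ∈ X, x + T.γ h • y = z := by
  simp [up, Submodule.mem_sup]

lemma mem_down {h : ℕ} {X : Submodule K E} {z : E} :
    z ∈ T.down h X ↔ z ∈ X ∧ T.γ h • z ∈ X := by simp [down]

lemma le_up {h : ℕ} {X : Submodule K E} : X ≤ T.up h X := le_sup_left

lemma γ_sq (h : ℕ) : T.γ h * T.γ h =
    (T.γ h + T.θ h (T.γ h)) * T.γ h - T.γ h * T.θ h (T.γ h) := by ring

lemma stable_of_γ {h : ℕ} (hm : h < m) {X : Submodule K E} (hX : T.Stable (h + 1) X)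
    (hγ : ∀ x ∈ X, T.γ h • x ∈ X) : T.Stable h X := by
  intro c hc x hx
  rw [← T.part_add_part h c, add_smul, mul_comm, mul_smul]
  exact X.add_mem (hX _ (T.part_mem hm hc _) _ hx)
    (hX _ (T.part_mem hm hc _) _ (hγ _ hx))

lemma stable_up {h : ℕ} (hm : h < m) {X : Submodule K E} (hX : T.Stable (h + 1) X) :
    T.Stable h (T.up h X) := by
  have h1 : T.Stable (h + 1) (T.up h X) := by
    intro c hc z hz
    obtain ⟨x, hx, y, hy, rfl⟩ := mem_up.1 hz
    exact mem_up.2 ⟨c • x, hX c hc x hx, c • y, hX c hc y hy, by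
      rw [smul_add, smul_comm]⟩
  refine stable_of_γ hm h1 fun z hz => ?_
  obtain ⟨x, hx, y, hy, rfl⟩ := mem_up.1 hz
  refine mem_up.2 ⟨-((T.γ h * T.θ h (T.γ h)) • y), X.neg_mem (hX _ T.θγ_mul_mem y hy),
    x + (T.γ h + T.θ h (T.γ h)) • y, X.add_mem hx (hX _ T.θγ_add_mem y hy), ?_⟩
  rw [smul_add, smul_add, smul_smul, smul_smul, γ_sq h, sub_smul, mul_comm (T.γ h) (_ + _)]
  abel

/-- This is the dimension formula for X and γX: multiplication by γ carries the `down` space onto X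
∩ γX. -/
lemma finrank_up_add_down [FiniteDimensional K E] {h : ℕ} (hm : h < m) (X : Submodule K E) :
    finrank K (T.up h X) + finrank K (T.down h X) = 2 * finrank K X := by
  have hinj : Function.Injective (Algebra.lsmul K K E (T.γ h)) := fun x y hxy =>
    smul_right_injective E (T.γ_ne hm) hxy
  have h1 := Submodule.finrank_sup_add_finrank_inf_eq X (X.map (Algebra.lsmul K K E (T.γ h)))
  have h2 : finrank K (X.map (Algebra.lsmul K K E (T.γ h))) = finrank K X :=
    (Submodule.equivMapOfInjective _ hinj X).finrank_eq.symm
  have h3 : (T.down h X).map (Algebra.lsmul K K E (T.γ h)) =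
      X ⊓ X.map (Algebra.lsmul K K E (T.γ h)) := by
    ext z
    simp only [Submodule.mem_map, mem_down, Submodule.mem_inf, Algebra.lsmul_coe]
    constructor
    · rintro ⟨x, hx, rfl⟩
      exact ⟨hx.2, x, hx.1, rfl⟩
    · rintro ⟨hz, x, hx, rfl⟩
      exact ⟨x, ⟨hx, hz⟩, rfl⟩
  have h4 : finrank K ((T.down h X).map (Algebra.lsmul K K E (T.γ h))) = finrank K (T.down h X) :=
    (Submodule.equivMapOfInjective _ hinj _).finrank_eq.symm
  rw [← h3, h4, h2] at h1
  rw [up]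
  omega

lemma finrank_up_le [FiniteDimensional K E] {h : ℕ} (hm : h < m) (X : Submodule K E) :
    finrank K (T.up h X) ≤ 2 * finrank K X := by
  have := T.finrank_up_add_down hm X
  omega

/-- A stable subspace as a subspace over `F h`. -/
def Stable.toSubmodule {h : ℕ} {X : Submodule K E} (hX : T.Stable h X) : Submodule (T.F h) E where
  carrier := X
  add_mem' := X.add_mem
  zero_mem' := X.zero_mem
  smul_mem' c x hx := hX c c.2 x hx

lemma Stable.map {E' : Type*} [AddCommGroup E'] [Module K E'] [Module L E'] {h : ℕ}
    {X : Submodule K E} (hX : T.Stable h X) {f : E →ₗ[K] E'}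
    (hf : ∀ c ∈ T.F h, ∀ x, f (c • x) = c • f x) : T.Stable h (X.map f) := by
  rintro c hc _ ⟨x, hx, rfl⟩
  exact ⟨c • x, hX c hc x hx, hf c hc x⟩

lemma Stable.comap {E' : Type*} [AddCommGroup E'] [Module K E'] [Module L E'] {h : ℕ}
    {X : Submodule K E'} (hX : T.Stable h X) {f : E →ₗ[K] E'}
    (hf : ∀ c ∈ T.F h, ∀ x, f (c • x) = c • f x) : T.Stable h (X.comap f) := by
  intro c hc x hx
  rw [Submodule.mem_comap] at hx ⊢
  rw [hf c hc]
  exact hX c hc _ hx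

end Stable

variable {T}

variable (T) in
/-- The span over `F h`, as a `K`-subspace. -/
def vspan (h : ℕ) (l : List L) : Submodule K L :=
  (Submodule.span (T.F h) {x | x ∈ l}).restrictScalars K

lemma stable_vspan (h : ℕ) (l : List L) : T.Stable h (T.vspan h l) := fun c hc _ hx =>
  (Submodule.span (T.F h) {x | x ∈ l}).smul_mem ⟨c, hc⟩ hx

lemma mem_vspan {h : ℕ} {l : List L} {x : L} (hx : x ∈ l) : x ∈ T.vspan h l :=
  Submodule.subset_span (R := T.F h) (s := {x | x ∈ l}) hx

lemma vspan_le {h : ℕ} {l : List L} {X : Submodule K L} (hX : T.Stable h X) :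
    T.vspan h l ≤ X ↔ ∀ x ∈ l, x ∈ X := by
  refine ⟨fun H x hx => H (mem_vspan hx), fun H => ?_⟩
  have : Submodule.span (T.F h) {x | x ∈ l} ≤ hX.toSubmodule := Submodule.span_le.2 H
  exact this

lemma finrank_restrictScalars {h : ℕ} (hm : h ≤ m) (X : Submodule (T.F h) L) :
    finrank K (X.restrictScalars K) = 2 ^ (m - h) * finrank (T.F h) X := by
  rw [← T.finrank_F hm]
  exact (finrank_mul_finrank K (T.F h) X).symm

lemma stable_rowSpan (h : ℕ) (l : List (L × L)) (W : List ((Fin h → Bool) × L × L)) (R : List L) :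
    T.Stable h ((T.rowSpan h l W R).restrictScalars K) := fun c hc _ hx =>
  (T.rowSpan h l W R).smul_mem ⟨c, hc⟩ hx

lemma mem_of_mem_rowSpan {h : ℕ} {l : List (L × L)} {W : List ((Fin h → Bool) × L × L)} {R : List L}
    {X : Submodule K (L × L)} (hX : T.Stable h X) (hl : ∀ x ∈ l, x ∈ X) (hW : ∀ a ∈ W, a.2 ∈ X)
    (hR : ∀ r ∈ R, (0, r) ∈ X) {d : L × L} (hd : d ∈ T.rowSpan h l W R) : d ∈ X :=
  (rowSpan_le (S := hX.toSubmodule)).2 ⟨hl, hW, hR⟩ hd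

lemma finrank_fst_rowSpan_le {h : ℕ} (l : List (L × L)) :
    finrank (T.F h) ((T.rowSpan h l [] []).map (LinearMap.fst (T.F h) L L)) ≤ l.length := by
  classical
  have := T.finiteDimensional
  have h1 : (T.rowSpan h l [] []).map (LinearMap.fst (T.F h) L L) =
      Submodule.span (T.F h) ((l.map Prod.fst).toFinset : Set L) := by
    rw [rowSpan, Submodule.map_span]
    congr 1
    ext x
    simp
  rw [h1]
  exact (finrank_span_finset_le_card _).trans ((List.toFinset_card_le _).trans (by simp))

lemma finrank_fst_add {X : Submodule K (L × L)} (hfin : FiniteDimensional K L) :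
    finrank K (X.map (LinearMap.fst K L L)) + finrank K (X.comap (LinearMap.inr K L L)) =
      finrank K X := by
  have h1 := LinearMap.finrank_range_add_finrank_ker ((LinearMap.fst K L L).domRestrict X)
  rw [LinearMap.range_domRestrict] at h1
  rw [← h1]
  congr 1
  refine LinearEquiv.finrank_eq ?_
  refine LinearEquiv.ofBijective (LinearMap.codRestrict _ (LinearMap.codRestrict X
    (LinearMap.inr K L L ∘ₗ (X.comap (LinearMap.inr K L L)).subtype) fun x => x.2) fun x => ?_)
    ⟨fun x y hxy => ?_, fun x => ?_⟩
  · rfl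
  · have := congrArg (fun z => z.1.1.2) hxy
    exact Subtype.ext this
  · obtain ⟨⟨⟨a, b⟩, hx⟩, hx'⟩ := x
    have : a = 0 := hx'
    subst this
    exact ⟨⟨b, hx⟩, rfl⟩

/-- The exchange of the components up to conjugation. -/
lemma two_mul_finrank_comap_inr_le (hfin : FiniteDimensional K L) (i : ℕ) {X : Submodule K (L × L)}
    (hX : ∀ x ∈ X, (T.θ i x.2, T.θ i x.1) ∈ X) :
    2 * finrank K (X.comap (LinearMap.inr K L L)) ≤ finrank K X := by
  have h1 := finrank_fst_add (X := X) hfin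
  -- If (0, u) lies in X, so does (θu, 0). The second kernel is thus no larger than the first
  -- projection, and the two dimensions add up to that of X.
  have h2 : (X.comap (LinearMap.inr K L L)).map (T.θ i).toLinearMap ≤
      X.map (LinearMap.fst K L L) := by
    rintro _ ⟨u, hu, rfl⟩
    have := hX _ hu
    exact ⟨_, this, rfl⟩
  have h3 := Submodule.finrank_mono h2
  have h4 := (Submodule.equivMapOfInjective (T.θ i).toLinearMap (T.θ i).injective
    (X.comap (LinearMap.inr K L L))).finrank_eq
  omega

/-- The pair of vectors of the components of the form `dot (h + 1) v`. -/
noncomputable def vecPair (T : QuadTower K L m) (h : ℕ) : L →ₗ[K] L × L :=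
  LinearMap.prod (T.vec₁ h) ((T.θ h).toLinearMap ∘ₗ T.vec₁ h)

lemma vecPair_apply (h : ℕ) (v : L) : T.vecPair h v = (T.vec₁ h v, T.θ h (T.vec₁ h v)) := rfl

lemma vec₁_mul {h : ℕ} {c : L} (hc : T.θ h c = c) (v : L) : T.vec₁ h (c * v) = c * T.vec₁ h v := by
  rw [vec₁_apply, vec₁_apply, T.part_mul hc, T.part_mul hc]
  ring

lemma vecPair_smul {h : ℕ} {c : L} (hc : c ∈ T.F (h + 1)) (v : L) :
    T.vecPair h (c • v) = c • T.vecPair h v := by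
  have := (T.mem_F_succ.1 hc).2
  rw [vecPair_apply, vecPair_apply, smul_eq_mul, vec₁_mul this, map_mul, this]
  rfl

/-- The exchange (a, b) ↦ (θb, θa) fixes the pairs (w, θw) and is semilinear, hence preserves their
span over F_h. -/
lemma swap_up_vecPair {h : ℕ} (hm : h < m) {V : Submodule K L} (hV : T.Stable (h + 1) V) :
    ∀ x ∈ T.up h (V.map (T.vecPair h)), (T.θ h x.2, T.θ h x.1) ∈ T.up h (V.map (T.vecPair h)) := by
  have hst := stable_up hm (hV.map (f := T.vecPair h) fun c hc x => vecPair_smul hc x)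
  intro x hx
  obtain ⟨_, ⟨v, hv, rfl⟩, _, ⟨w, hw, rfl⟩, rfl⟩ := mem_up.1 hx
  have h1 := le_up (T := T) (h := h) (Submodule.mem_map_of_mem (f := T.vecPair h) hv)
  have h2 := hst _ (T.θ_mem T.γ_mem h) _
    (le_up (T := T) (h := h) (Submodule.mem_map_of_mem (f := T.vecPair h) hw))
  convert Submodule.add_mem _ h1 h2 using 1
  simp [vecPair_apply, T.invol]

end QuadTower

/-! ### Decoding with known row space of the error -/

namespace QuadTower

open Module

variable {K : Type u} {L : Type v} [Field K] [Field L] [Algebra K L] {m : ℕ} {T : QuadTower K L m}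

lemma list_sum_coef_pivots {h : ℕ} {W : List ((Fin h → Bool) × L × L)} (hW : T.Reduced h W)
    (c : ((Fin h → Bool) × L × L) → L) {b : (Fin h → Bool) × L × L} (hb : b ∈ W) :
    (W.map fun a => c a * T.coef h a.1 b.2.1).sum = c b := by
  have aux : ∀ W' : List ((Fin h → Bool) × L × L), (∀ a ∈ W', T.coef h a.1 b.2.1 = 0) →
      (W'.map fun a => c a * T.coef h a.1 b.2.1).sum = 0 := fun W' h' => by
    refine List.sum_eq_zero fun x hx => ?_
    obtain ⟨a, ha, rfl⟩ := List.mem_map.1 hx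
    rw [h' a ha, mul_zero]
  induction W with
  | nil => simp at hb
  | cons a W ih =>
    obtain ⟨h1, h2⟩ := hW
    rw [List.pairwise_cons] at h2
    rw [List.map_cons, List.sum_cons]
    rcases List.mem_cons.1 hb with rfl | hb'
    · rw [h1 _ (by simp), mul_one, aux W fun a ha => (h2.1 a ha).2, add_zero]
    · rw [(h2.1 b hb').1, mul_zero, zero_add]
      exact ih ⟨fun b hb => h1 b (by simp [hb]), h2.2⟩ hb'

lemma dot_list_sum {α : Type*} {h : ℕ} (W : List α) (v : L) (c : α → L) (hc : ∀ a ∈ W, c a ∈ T.F h)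
    (x : α → L) : T.dot h v (W.map fun a => c a * x a).sum =
      (W.map fun a => c a * T.dot h v (x a)).sum := by
  rw [map_list_sum, List.map_map]
  congr 1
  exact List.map_congr_left fun a ha => T.dot_mul (hc a ha) _ _

lemma FLin.list_sum {α : Type*} {h : ℕ} {g : L →ₗ[K] L} (hg : T.FLin h g) (W : List α) (c : α → L)
    (hc : ∀ a ∈ W, c a ∈ T.F h) (x : α → L) : g (W.map fun a => c a * x a).sum =
      (W.map fun a => c a * g (x a)).sum := by
  rw [map_list_sum, List.map_map]
  congr 1
  exact List.map_congr_left fun a ha => hg _ (hc a ha) _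

variable (T) in
/-- The pairs orthogonal to `(y, x)`. -/
def pairPerp (h : ℕ) (x y : L) : Submodule K (L × L) where
  carrier := {d | T.dot h d.2 x + T.dot h d.1 y = 0}
  add_mem' {a b} ha hb := by
    simp only [Set.mem_ofPred_eq] at *
    rw [Prod.snd_add, Prod.fst_add, dot_add_left, dot_add_left]
    linear_combination ha + hb
  zero_mem' := by simp [dot_zero_left]
  smul_mem' c d hd := by
    simp only [Set.mem_ofPred_eq, Prod.smul_snd, Prod.smul_fst] at *
    rw [Algebra.smul_def, Algebra.smul_def, T.dot_mul_left (algebraMap_mem _ _),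
      T.dot_mul_left (algebraMap_mem _ _)]
    linear_combination algebraMap K L c * hd

lemma mem_pairPerp {h : ℕ} {x y : L} {d : L × L} :
    d ∈ T.pairPerp h x y ↔ T.dot h d.2 x + T.dot h d.1 y = 0 := Iff.rfl

lemma stable_pairPerp (h : ℕ) (x y : L) : T.Stable h (T.pairPerp h x y) := by
  intro c hc d hd
  rw [mem_pairPerp] at *
  simp only [Prod.smul_snd, Prod.smul_fst, smul_eq_mul]
  rw [T.dot_mul_left hc, T.dot_mul_left hc]
  linear_combination c * hd

/-- Elements orthogonal to the reduced rows are orthogonal to the descended forms. -/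
lemma dot_vecPair_eq_zero {h : ℕ} {B : List L} {W : List ((Fin h → Bool) × L × L)} {R : List L}
    (hspan : T.rowSpan h [] W R = T.rowSpan h (B.map (T.vecPair h)) [] []) {x y : L}
    (hW : ∀ a ∈ W, T.dot h a.2.2 x + T.dot h a.2.1 y = 0) (hR : ∀ r ∈ R, T.dot h r x = 0)
    {v : L} (hv : v ∈ B) :
    T.dot h (T.θ h (T.vec₁ h v)) x + T.dot h (T.vec₁ h v) y = 0 := by
  have h1 : T.vecPair h v ∈ T.rowSpan h [] W R := by
    rw [hspan]
    exact (contains_rowSpan _ _ _).1 _ (List.mem_map_of_mem hv)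
  have h2 := mem_of_mem_rowSpan (stable_pairPerp h x y) (by simp) hW
    (fun r hr => by rw [mem_pairPerp]; simp [hR r hr, dot_zero_left]) h1
  rw [mem_pairPerp] at h2
  exact h2

/-- The pair condition places both x + θy and γx + θ(γy) in the complement of B, where g vanishes;
`comp_eq` expresses the wanted sum through these two values. -/
lemma comp_eq_zero_of_perp {h : ℕ} (hm : h < m) {g : L →ₗ[K] L} (hg : T.FLin (h + 1) g)
    {B : List L} (hgB : ∀ z, (∀ v ∈ B, T.dot (h + 1) v z = 0) → g z = 0) {x y : L}
    (hxy : ∀ v ∈ B, T.dot h (T.θ h (T.vec₁ h v)) x + T.dot h (T.vec₁ h v) y = 0) :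
    T.comp₀ h g x + T.comp₁ h g y = 0 := by
  have h1 := comp_eq hm hg x y
  rw [hgB _ fun v hv => T.dot_succ_eq_zero hm (hxy v hv) T.γ_mem] at h1
  have h2 := hgB (x + T.θ h y) fun v hv => by
    simpa using T.dot_succ_eq_zero hm (hxy v hv) (one_mem (T.F h))
  rw [h2, mul_zero, sub_zero] at h1
  exact (mul_eq_zero.1 h1).resolve_left (T.sub_ne hm)

/-- For x = 0 the companions and the rows without pivot impose no condition, and only the pivot
vectors remain. -/
lemma comp₁_eq_zero_of_perp {h : ℕ} (hm : h < m) {g : L →ₗ[K] L} (hg : T.FLin (h + 1) g)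
    {B : List L} (hgB : ∀ z, (∀ v ∈ B, T.dot (h + 1) v z = 0) → g z = 0)
    {W : List ((Fin h → Bool) × L × L)} {R : List L}
    (hspan : T.rowSpan h [] W R = T.rowSpan h (B.map (T.vecPair h)) [] []) {y : L}
    (hy : ∀ a ∈ W, T.dot h a.2.1 y = 0) : T.comp₁ h g y = 0 := by
  have := comp_eq_zero_of_perp hm hg hgB (x := 0) (y := y) fun v hv =>
    dot_vecPair_eq_zero hspan (fun a ha => by simp [hy a ha]) (by simp) hv
  simpa using this

/-- The partner of an element orthogonal to the rows without pivot. -/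
lemma dot_vecPair_partner {h : ℕ} (hm : h ≤ m) {B : List L} {W : List ((Fin h → Bool) × L × L)}
    {R : List L} (hW : T.Reduced h W)
    (hspan : T.rowSpan h [] W R = T.rowSpan h (B.map (T.vecPair h)) [] []) {x : L}
    (hx : ∀ r ∈ R, T.dot h r x = 0) {v : L} (hv : v ∈ B) :
    T.dot h (T.θ h (T.vec₁ h v)) x +
      T.dot h (T.vec₁ h v) (-(W.map fun a => T.dot h a.2.2 x * T.bm h a.1).sum) = 0 := by
  refine dot_vecPair_eq_zero hspan (fun b hb => ?_) hx hv
  rw [map_neg, dot_list_sum W _ _ fun a _ => T.dot_mem hm _ _]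
  simp only [T.dot_bm hm]
  rw [list_sum_coef_pivots hW (fun a => T.dot h a.2.2 x) hb, add_neg_cancel]

/-- If x is orthogonal to the rows without pivot, the other conditions can be solved for y at the
pivots. The value of g₀ at x is then minus the value of g₁ at this partner, which uses g₁ only at
pivot monomials. -/
lemma comp₀_eq_sum_of_perp {h : ℕ} (hm : h < m) {g : L →ₗ[K] L} (hg : T.FLin (h + 1) g)
    {B : List L} (hgB : ∀ z, (∀ v ∈ B, T.dot (h + 1) v z = 0) → g z = 0)
    {W : List ((Fin h → Bool) × L × L)} {R : List L} (hW : T.Reduced h W)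
    (hspan : T.rowSpan h [] W R = T.rowSpan h (B.map (T.vecPair h)) [] []) {x : L}
    (hx : ∀ r ∈ R, T.dot h r x = 0) :
    T.comp₀ h g x = (W.map fun a => T.dot h a.2.2 x * T.comp₁ h g (T.bm h a.1)).sum := by
  have := comp_eq_zero_of_perp hm hg hgB fun v hv => dot_vecPair_partner hm.le hW hspan hx hv
  rw [map_neg, (hg.comp₁ hm).list_sum W _ fun a _ => T.dot_mem hm.le _ _] at this
  linear_combination this

lemma rowSpan_vecPair_le {h : ℕ} (hm : h < m) (B : List L) {d : L × L}
    (hd : d ∈ T.rowSpan h (B.map (T.vecPair h)) [] []) :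
    d ∈ T.up h ((T.vspan (h + 1) B).map (T.vecPair h)) := by
  refine mem_of_mem_rowSpan (stable_up hm ((stable_vspan _ _).map
    fun c hc x => vecPair_smul hc x)) (fun x hx => ?_) (by simp) (by simp) hd
  obtain ⟨v, hv, rfl⟩ := List.mem_map.1 hx
  exact le_up (Submodule.mem_map_of_mem (mem_vspan hv))

/-- The pivot vectors lie in a projection of the F_h-span of the descended pairs, whose dimension
over K is at most doubled. The component g₁ has order one less, which makes up for the factor 2. -/
lemma finrank_vspan_pivots_le {h : ℕ} (hm : h < m) {B : List L}
    {W : List ((Fin h → Bool) × L × L)} {R : List L}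
    (hspan : T.rowSpan h [] W R = T.rowSpan h (B.map (T.vecPair h)) [] []) :
    finrank K (T.vspan h (W.map fun a => a.2.1)) ≤ 2 * finrank K (T.vspan (h + 1) B) := by
  have := T.finiteDimensional
  have hst := (stable_up hm ((stable_vspan (h + 1) B).map (f := T.vecPair h)
    fun c hc x => vecPair_smul hc x)).map (f := LinearMap.fst K L L) fun c _ x => rfl
  refine (Submodule.finrank_mono ((vspan_le hst).2 fun x hx => ?_)).trans
    ((Submodule.finrank_map_le _ _).trans ((finrank_up_le hm _).trans
      (Nat.mul_le_mul_left 2 (Submodule.finrank_map_le _ _))))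
  obtain ⟨a, ha, rfl⟩ := List.mem_map.1 hx
  refine Submodule.mem_map_of_mem (f := LinearMap.fst K L L) (rowSpan_vecPair_le hm B ?_)
  rw [← hspan]
  exact (contains_rowSpan _ _ _).2.1 a ha

/-- The span of the pairs may have twice the dimension, but its exchange symmetry allows at most
half of it to consist of pairs (0, u). So g₀, whose order does not drop, loses nothing. -/
lemma finrank_vspan_rest_le {h : ℕ} (hm : h < m) {B : List L}
    {W : List ((Fin h → Bool) × L × L)} {R : List L}
    (hspan : T.rowSpan h [] W R = T.rowSpan h (B.map (T.vecPair h)) [] []) :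
    finrank K (T.vspan h R) ≤ finrank K (T.vspan (h + 1) B) := by
  have hfin := T.finiteDimensional
  have hst := stable_up hm ((stable_vspan (h + 1) B).map (f := T.vecPair h)
    fun c hc x => vecPair_smul hc x)
  have h1 := two_mul_finrank_comap_inr_le hfin h (swap_up_vecPair hm (stable_vspan (T := T) _ B))
  have h2 := (finrank_up_le (T := T) hm ((T.vspan (h + 1) B).map (T.vecPair h))).trans
    (Nat.mul_le_mul_left 2 (Submodule.finrank_map_le _ _))
  have h3 : T.vspan h R ≤ (T.up h ((T.vspan (h + 1) B).map (T.vecPair h))).comap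
      (LinearMap.inr K L L) := by
    refine (vspan_le (hst.comap fun c _ x => by simp)).2 fun r hr => ?_
    refine rowSpan_vecPair_le hm B ?_
    rw [← hspan]
    exact (contains_rowSpan _ _ _).2.2 r hr
  have h4 := Submodule.finrank_mono h3
  omega

/-- Over F_0 = L a single nonzero vector already spans L. -/
lemma eq_zero_of_finrank_vspan_zero {B : List L} (hB : finrank K (T.vspan 0 B) < 2 ^ m) {v : L}
    (hv : v ∈ B) : v = 0 := by
  have hfin := T.finiteDimensional
  by_contra h0
  have : T.vspan 0 B = ⊤ := by
    refine eq_top_iff.2 fun x _ => ?_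
    have := stable_vspan (T := T) 0 B (x * v⁻¹) (fun i hi => absurd hi (by omega)) v (mem_vspan hv)
    simpa [h0] using this
  rw [this, _root_.finrank_top, T.finrank_top] at hB
  exact lt_irrefl _ hB

/-- A vector in the kernel of reduced rows attached to a position without pivot. -/
lemma dot_kernel_vector {h : ℕ} (hm : h ≤ m) {W : List ((Fin h → Bool) × L × L)} {R : List L}
    (hW : T.Reduced h W) {B : List L}
    (hspan : T.rowSpan h [] W R = T.rowSpan h (B.map fun v => (v, 0)) [] []) (A : Fin h → Bool)
    {v : L} (hv : v ∈ B) :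
    T.dot h v (T.bm h A - (W.map fun a => T.coef h A a.2.1 * T.bm h a.1).sum) = 0 := by
  have h1 : (v, 0) ∈ T.rowSpan h [] W R := by
    rw [hspan]
    exact (contains_rowSpan _ _ _).1 _ (List.mem_map.2 ⟨v, hv, rfl⟩)
  have h2 := mem_of_mem_rowSpan (stable_pairPerp h 0
    (T.bm h A - (W.map fun a => T.coef h A a.2.1 * T.bm h a.1).sum)) (by simp) (fun b hb => ?_)
    (fun r hr => by rw [mem_pairPerp]; simp [dot_zero_left]) h1
  · rw [mem_pairPerp] at h2
    simpa using h2
  · rw [mem_pairPerp, map_zero, zero_add, map_sub, dot_list_sum W _ _ fun a _ => T.coef_mem hm _ _]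
    simp only [T.dot_bm hm]
    rw [list_sum_coef_pivots hW (fun a => T.coef h A a.2.1) hb, sub_self]

lemma kernel_vector_ne_zero {h : ℕ} (hm : h ≤ m) {W : List ((Fin h → Bool) × L × L)}
    {A : Fin h → Bool} (hA : ∀ a ∈ W, a.1 ≠ A) :
    T.bm h A - (W.map fun a => T.coef h A a.2.1 * T.bm h a.1).sum ≠ 0 := by
  intro h0
  have h1 := congrArg (T.coef h A) h0
  have h2 : T.coef h A (W.map fun a => T.coef h A a.2.1 * T.bm h a.1).sum = 0 := by
    rw [map_list_sum]
    refine List.sum_eq_zero fun x hx => ?_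
    simp only [List.mem_map] at hx
    obtain ⟨_, ⟨a, ha, rfl⟩, rfl⟩ := hx
    rw [T.coef_mul (T.coef_mem hm _ _), T.coef_bm hm, if_neg (Ne.symm (hA a ha)), mul_zero]
  rw [map_sub, h2, T.coef_bm hm, if_pos rfl, map_zero, sub_zero] at h1
  exact one_ne_zero h1

end QuadTower

/-! ### Erasure decoding on the machine -/

namespace LMachine

open QuadTower Module

variable {K : Type u} {L : Type v} [Field K] [Field L] [Algebra K L] {m : ℕ}
  {T : QuadTower K L m} {Ω : Type w} {M : LMachine T Ω}

theorem run_elim {h : ℕ} (hm : h ≤ m) (D : Ω → ℕ) {c : Ω → ℕ}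
    (l : List ((Ω → L) × (Ω → L))) (s : M.St) (hl : ∀ a ∈ l, M.Kn s a.1 ∧ M.Kn s a.2)
    (hD : ∀ ω ∈ M.dom s, finrank (T.F h) ((T.rowSpan h (evPairs l ω) [] []).map
      (LinearMap.fst (T.F h) L L)) ≤ D ω)
    (hc : ∀ s', s ≤ s' → ∀ (W : List ((Fin h → Bool) × (Ω → L) × (Ω → L))) (R : List (Ω → L)),
      (∀ a ∈ W, M.Kn s' a.2.1 ∧ M.Kn s' a.2.2) → (∀ r ∈ R, M.Kn s' r) →
      (∀ ω ∈ M.dom s', T.Reduced h (evRows W ω) ∧ T.rowSpan h [] (evRows W ω) (ev R ω) =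
        T.rowSpan h (evPairs l ω) [] [] ∧ W.length ≤ D ω) →
      W.length + R.length = l.length → M.Run s' c) :
    M.Run s fun ω => c ω + (l.length * (4 * min (D ω) (2 ^ h) + 3) +
      D ω * (5 * 2 ^ h + 5 * m + 5)) := by
  refine M.run_mono (run_elim_aux hm D l [] [] s hl (by simp) (by simp)
    (fun ω _ => ⟨by simp [evRows], by simp [evRows]⟩) hD fun s' h' W R kW kR hWR hlen =>
      hc s' h' W R kW kR (fun ω hω => ⟨(hWR ω hω).1, (hWR ω hω).2, ?_⟩) (by simpa using hlen))
    fun ω _ => by simp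
  have h1 := (hWR ω hω).1.length_le_finrank [] (ev R ω)
  rw [(hWR ω hω).2] at h1
  simpa [evRows] using h1.trans (hD ω (M.dom_anti h' hω))

/-- The values of the components of a linear map on the basis. -/
theorem run_components {h : ℕ} {s : M.St} {Y : Ω → L →ₗ[K] L}
    (hY : ∀ A, M.Kn s fun ω => Y ω (T.bm (h + 1) A)) {c : Ω → ℕ}
    (hc : ∀ s', s ≤ s' → (∀ A, M.Kn s' fun ω => T.comp₁ h (Y ω) (T.bm h A)) →
      (∀ A, M.Kn s' fun ω => T.comp₀ h (Y ω) (T.bm h A)) → M.Run s' c) :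
    M.Run s fun ω => c ω + 6 * 2 ^ h := by
  have kf : ∀ A : Fin h → Bool, M.Kn s fun ω => Y ω (T.bm h A) := fun A =>
    M.kn_congr (hY (Fin.snoc A false)) fun ω _ => by simp [bm_snoc]
  have kt : ∀ A : Fin h → Bool, M.Kn s fun ω => Y ω (T.γ h * T.bm h A) := fun A =>
    M.kn_congr (hY (Fin.snoc A true)) fun ω _ => by simp [bm_snoc, mul_comm]
  have h1 : M.Run s fun ω => (c ω + Fintype.card (Fin h → Bool) * 1) +
      Fintype.card (Fin h → Bool) * 5 := by
    refine run_family (f := fun (A : Fin h → Bool) ω => T.comp₁ h (Y ω) (T.bm h A)) (fun A => ?_)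
      fun s₁ h₁ k₁ => run_family (f := fun (A : Fin h → Bool) ω => T.comp₀ h (Y ω) (T.bm h A))
        (fun A => ?_) fun s₂ h₂ k₂ => hc s₂ (h₁.trans h₂) (fun A => M.kn_mono h₂ (k₁ A)) k₂
    · refine (((comp_const s (T.θ h (T.γ h) - T.γ h)⁻¹).mul ((Kn.comp (kt A)).sub
        ((comp_const s (T.γ h)).mul (Kn.comp (kf A))))).congr fun ω _ => ?_).le (by omega)
      rw [comp₁_apply, T.θ_bm le_rfl]
    · refine (((Kn.comp (M.kn_mono h₁ (kf A))).sub (Kn.comp (k₁ A))).congr fun ω _ => ?_).le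
        (by omega)
      rw [comp₀_apply, T.θ_bm le_rfl]
  refine M.run_mono h1 fun ω _ => ?_
  simp only [Fintype.card_fun, Fintype.card_bool, Fintype.card_fin]
  omega

/-- The values of a linear map from those of its components. -/
theorem run_assemble {h : ℕ} (hm : h < m) {s : M.St} {Y : Ω → L →ₗ[K] L}
    (hY : ∀ ω ∈ M.dom s, T.FLin (h + 1) (Y ω))
    (h1 : ∀ A, M.Kn s fun ω => T.comp₁ h (Y ω) (T.bm h A))
    (h0 : ∀ A, M.Kn s fun ω => T.comp₀ h (Y ω) (T.bm h A)) {c : Ω → ℕ}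
    (hc : ∀ s', s ≤ s' → (∀ A, M.Kn s' fun ω => Y ω (T.bm (h + 1) A)) → M.Run s' c) :
    M.Run s fun ω => c ω + 10 * 2 ^ h := by
  have h2 : M.Run s fun ω => c ω + Fintype.card (Fin (h + 1) → Bool) * 5 := by
    refine run_family (fun A => ?_) hc
    rw [← Fin.snoc_init_self A]
    generalize (Fin.init A : Fin h → Bool) = A'
    cases A (Fin.last h) with
    | false =>
      refine (((Kn.comp (h0 A')).add (Kn.comp (h1 A'))).congr fun ω _ => ?_).le (by omega)
      rw [bm_snoc, if_neg (by simp), mul_one, T.comp_add h (Y ω), T.θ_bm le_rfl]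
    | true =>
      refine (((comp_const s (T.γ h)).mul (Kn.comp (h0 A'))).add
        ((comp_const s (T.θ h (T.γ h))).mul (Kn.comp (h1 A')))).congr fun ω hω => ?_
      rw [bm_snoc, if_pos rfl, mul_comm (T.bm h A'), T.comp_add h (Y ω), θ_mul, T.θ_bm le_rfl,
        (hY ω hω).comp₀ hm _ T.γ_mem, (hY ω hω).comp₁ hm _ (T.θ_mem T.γ_mem h)]
  refine M.run_mono h2 fun ω _ => ?_
  simp only [Fintype.card_fun, Fintype.card_bool, Fintype.card_fin, pow_succ]
  omega

theorem run_vecPairs {h : ℕ} (hm : h < m) {s : M.St} {B : List (Ω → L)} (hB : ∀ v ∈ B, M.Kn s v)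
    {c : Ω → ℕ}
    (hc : ∀ s', s ≤ s' → (∀ v ∈ B, M.Kn s' (fun ω => T.vec₁ h (v ω)) ∧
      M.Kn s' (fun ω => T.θ h (T.vec₁ h (v ω)))) → M.Run s' c) :
    M.Run s fun ω => c ω + B.length * 8 := by
  have h1 : M.Run s fun ω => (c ω + B.length * 3) + B.length * 5 := by
    refine run_list B (f := fun v ω => T.vec₁ h (v ω)) (fun v hv => ?_)
      fun s₁ h₁ k₁ => run_list B (f := fun v ω => T.θ h (T.vec₁ h (v ω))) (fun v hv => ?_)
        fun s₂ h₂ k₂ => hc s₂ (h₁.trans h₂) fun v hv => ⟨M.kn_mono h₂ (k₁ v hv), k₂ v hv⟩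
    · exact ((comp_const s (T.θ h (T.γ h) - T.γ h)⁻¹).mul
        ((Kn.comp (M.kn_part (hB v hv) hm true)).sub
          ((comp_const s (T.γ h)).mul (Kn.comp (M.kn_part (hB v hv) hm false))))).le (by omega)
    · exact (k₁ v hv).comp_θ hm
  exact M.run_mono h1 fun ω _ => by omega

/-- Elimination of the descended forms. -/
theorem run_descend {h : ℕ} (hm : h < m) (D : Ω → ℕ) {s : M.St} {B : List (Ω → L)}
    (hB : ∀ v ∈ B, M.Kn s v) (hD : ∀ ω ∈ M.dom s, B.length ≤ D ω) {c : Ω → ℕ}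
    (hc : ∀ s', s ≤ s' → ∀ (W : List ((Fin h → Bool) × (Ω → L) × (Ω → L))) (R : List (Ω → L)),
      (∀ a ∈ W, M.Kn s' a.2.1 ∧ M.Kn s' a.2.2) → (∀ r ∈ R, M.Kn s' r) →
      (∀ ω ∈ M.dom s', T.Reduced h (evRows W ω) ∧ T.rowSpan h [] (evRows W ω) (ev R ω) =
        T.rowSpan h ((ev B ω).map (T.vecPair h)) [] []) →
      W.length + R.length = B.length → M.Run s' c) :
    M.Run s fun ω => c ω + D ω * (9 * 2 ^ h + 5 * m + 16) := by
  have hev : ∀ ω, evPairs (B.map fun v => (fun ω => T.vec₁ h (v ω),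
      fun ω => T.θ h (T.vec₁ h (v ω)))) ω = (ev B ω).map (T.vecPair h) := fun ω => by
    simp [evPairs, ev, List.map_map, Function.comp_def, vecPair_apply]
  have h1 := run_vecPairs hm hB (c := fun ω => c ω +
      (B.length * (4 * min (D ω) (2 ^ h) + 3) + D ω * (5 * 2 ^ h + 5 * m + 5))) fun s₁ h₁ k₁ => by
    have h2 := run_elim hm.le D (B.map fun v => (fun ω => T.vec₁ h (v ω),
      fun ω => T.θ h (T.vec₁ h (v ω)))) s₁ (c := c) (fun a ha => ?_) (fun ω hω => ?_)
      fun s₂ h₂ W R kW kR hWR hlen => hc s₂ (h₁.trans h₂) W R kW kR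
        (fun ω hω => ⟨(hWR ω hω).1, by rw [(hWR ω hω).2.1, hev]⟩) (by simpa using hlen)
    · simpa using h2
    · obtain ⟨v, hv, rfl⟩ := List.mem_map.1 ha
      exact k₁ v hv
    · exact (finrank_fst_rowSpan_le _).trans (by simpa [evPairs] using hD ω (M.dom_anti h₁ hω))
  refine M.run_mono h1 fun ω hω => ?_
  have h2 := hD ω hω
  have h3 : B.length * (4 * min (D ω) (2 ^ h) + 3) ≤ D ω * (4 * 2 ^ h + 3) :=
    Nat.mul_le_mul h2 (by have := min_le_right (D ω) (2 ^ h); omega)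
  nlinarith

/-- The cost of decoding with known row space of the error. -/
def eraseCost (m D : ℕ) : ℕ → ℕ
  | 0 => 0
  | h + 1 => 2 * eraseCost m D h + (D + 1) * (24 * 2 ^ h + (5 * m + 24))

/-- The additive term on the left makes the recursion homogeneous. The doubled number of calls is
cancelled by the halved 2^h, so each level adds the same amount. -/
lemma eraseCost_le (m D h : ℕ) :
    eraseCost m D h + (D + 1) * (5 * m + 24) ≤ (D + 1) * (2 ^ h * (12 * h + (5 * m + 24))) := by
  induction h with
  | zero => simp [eraseCost]
  | succ h ih =>
    rw [eraseCost, pow_succ]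
    calc _ = 2 * (eraseCost m D h + (D + 1) * (5 * m + 24)) + (D + 1) * (24 * 2 ^ h) := by ring
      _ ≤ 2 * ((D + 1) * (2 ^ h * (12 * h + (5 * m + 24)))) + (D + 1) * (24 * 2 ^ h) := by gcongr
      _ = _ := by ring

/-- The case of multiples of the identity. -/
theorem run_erase_zero (D : Ω → ℕ) {h : ℕ} (hm : h ≤ m) {s : M.St} {c : Ω → ℕ} {B : List (Ω → L)}
    {Y N : Ω → L →ₗ[K] L} (hB : ∀ v ∈ B, M.Kn s v) (hY : ∀ A, M.Kn s fun ω => Y ω (T.bm h A))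
    (hyp : ∀ ω ∈ M.dom s, T.RM h 0 (N ω) ∧ T.FLin h (Y ω) ∧
      (∀ z, (∀ v ∈ ev B ω, T.dot h v z = 0) → Y ω z = N ω z) ∧
      finrank K (T.vspan h (ev B ω)) < 2 ^ m ∧ B.length ≤ D ω)
    (hc : ∀ s', s ≤ s' → (∀ A, M.Kn s' fun ω => N ω (T.bm h A)) → M.Run s' c) :
    M.Run s fun ω => c ω + (D ω + 1) * (12 * 2 ^ h + (5 * m + 24)) := by
  have hfin := T.finiteDimensional
  have hev : ∀ ω, evPairs (B.map fun v => (v, fun _ => 0)) ω = (ev B ω).map fun v => (v, 0) :=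
    fun ω => by simp [evPairs, ev, List.map_map, Function.comp_def]
  have h1 : M.Run s fun ω => (c ω + 2 ^ h * 2 + 5 * D ω + 5 * m + 7) +
      (B.length * (4 * min (D ω) (2 ^ h) + 3) + D ω * (5 * 2 ^ h + 5 * m + 5)) := by
    have h2 := run_elim hm D (B.map fun v => (v, fun _ => 0)) s
      (c := fun ω => c ω + 2 ^ h * 2 + 5 * D ω + 5 * m + 7) (fun a ha => ?_) (fun ω hω => ?_)
      fun s₁ h₁ W R kW kR hWR hlen => ?_
    · simpa using h2
    · obtain ⟨v, hv, rfl⟩ := List.mem_map.1 ha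
      exact ⟨hB v hv, M.kn_zero s⟩
    · exact (finrank_fst_rowSpan_le _).trans (by simpa [evPairs] using (hyp ω hω).2.2.2.2)
    -- The list W and its pivots belong to the node and not to an instance, so a single instance
    -- suffices to bound its length.
    by_cases hne : (M.dom s₁).Nonempty
    swap
    · exact M.run_empty fun ω hω => hne ⟨ω, hω⟩
    obtain ⟨ω₀, hω₀⟩ := hne
    have hlt : W.length < 2 ^ h := by
      obtain ⟨hred, hspan, -⟩ := hWR ω₀ hω₀
      have e1 := hred.length_le_finrank [] (ev R ω₀)
      rw [hspan, hev] at e1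
      have e2 : (T.rowSpan h ((ev B ω₀).map fun v => (v, 0)) [] []).map
          (LinearMap.fst (T.F h) L L) = Submodule.span (T.F h) {x | x ∈ ev B ω₀} := by
        rw [rowSpan, Submodule.map_span]
        congr 1
        ext x
        simp
      rw [e2] at e1
      have e3 := finrank_restrictScalars hm (Submodule.span (T.F h) {x | x ∈ ev B ω₀})
      have e4 := (hyp ω₀ (M.dom_anti h₁ hω₀)).2.2.2.1
      rw [vspan, e3] at e4
      have e5 : 2 ^ m = 2 ^ (m - h) * 2 ^ h := by rw [← pow_add, Nat.sub_add_cancel hm]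
      rw [e5] at e4
      have e6 := lt_of_mul_lt_mul_left e4 (Nat.zero_le _)
      simp only [evRows, List.length_map] at e1
      exact e1.trans_lt e6
    obtain ⟨A, hA⟩ : ∃ A : Fin h → Bool, ∀ a ∈ W, a.1 ≠ A := by
      classical
      by_contra hcon
      push Not at hcon
      have : (Finset.univ : Finset (Fin h → Bool)) ⊆ (W.map fun a => a.1).toFinset := fun A _ => by
        obtain ⟨a, ha, rfl⟩ := hcon A
        exact List.mem_toFinset.2 (List.mem_map.2 ⟨a, ha, rfl⟩)
      have h3 := (Finset.card_le_card this).trans (List.toFinset_card_le _)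
      simp at h3
      omega
    set x : Ω → L := fun ω => T.bm h A -
      ((evRows W ω).map fun a => T.coef h A a.2.1 * T.bm h a.1).sum with hx
    have cx : M.Comp s₁ x (3 * W.length + 2) := by
      refine (((comp_const s₁ (T.bm h A)).sub (comp_list_sum W (n := 2)
        (f := fun a ω => T.coef h A (a.2.1 ω) * T.bm h a.1) fun a ha =>
          (Kn.comp ((kW a ha).1.coef hm A)).mul (comp_const s₁ _))).congr fun ω _ => ?_).le (by omega)
      simp [hx, evRows, List.map_map, Function.comp_def]
    have cy : M.Comp s₁ (fun ω => Y ω (x ω)) (2 * W.length + 1) := by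
      refine (((Kn.comp (M.kn_mono h₁ (hY A))).sub (comp_list_sum W (n := 1)
        (f := fun a ω => T.coef h A (a.2.1 ω) * Y ω (T.bm h a.1)) fun a ha =>
          (Kn.comp ((kW a ha).1.coef hm A)).mul (Kn.comp (M.kn_mono h₁ (hY a.1))))).congr
            fun ω hω => ?_).le (by omega)
      rw [hx, map_sub, (hyp ω (M.dom_anti h₁ hω)).2.1.list_sum (evRows W ω) _
        fun a _ => T.coef_mem hm _ _]
      simp [evRows, List.map_map, Function.comp_def]
    have hx0 : ∀ ω ∈ M.dom s₁, x ω ≠ 0 := fun ω hω => kernel_vector_ne_zero hm fun a ha => by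
      obtain ⟨b, hb, rfl⟩ := List.mem_map.1 ha
      exact hA b hb
    -- The error vanishes at x, so the multiplier of the codeword is Y(x)/x.
    have hq : ∀ ω ∈ M.dom s₁, ∀ z, N ω z = Y ω (x ω) * (x ω)⁻¹ * z := fun ω hω z => by
      obtain ⟨hRM, -, hN, -⟩ := hyp ω (M.dom_anti h₁ hω)
      obtain ⟨f, hf⟩ := RM_zero_right T |>.1 hRM
      obtain ⟨hred, hspan, -⟩ := hWR ω hω
      rw [hev] at hspan
      rw [hN (x ω) fun v hv => dot_kernel_vector hm hred hspan A hv, hf, hf,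
        mul_inv_cancel_right₀ (hx0 ω hω)]
    have h3 : M.Run s₁ fun ω => ((((c ω + Fintype.card (Fin h → Bool) * 2) + 1) + (5 * m + 3)) +
        (2 * W.length + 1)) + (3 * W.length + 2) := by
      refine cx.run fun s₂ h₂ k₂ => (cy.mono h₂).run fun s₃ h₃ k₃ => ?_
      refine ((M.kn_mono h₃ k₂).comp_inv fun ω hω => hx0 ω (M.dom_anti (h₂.trans h₃) hω)).run
        fun s₄ h₄ k₄ => ?_
      refine Comp.run (n := 1) ((Kn.comp (M.kn_mono h₄ k₃)).mul (Kn.comp k₄)) fun s₅ h₅ k₅ => ?_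
      have h₁₅ := h₂.trans (h₃.trans (h₄.trans h₅))
      refine run_family (f := fun A ω => N ω (T.bm h A)) (fun A => ?_)
        fun s₆ h₆ k₆ => hc s₆ (h₁.trans (h₁₅.trans h₆)) k₆
      exact ((Kn.comp k₅).mul (comp_const s₅ (T.bm h A))).congr fun ω hω =>
        (hq ω (M.dom_anti h₁₅ hω) _).symm
    refine M.run_mono h3 fun ω hω => ?_
    have := (hWR ω hω).2.2
    simp only [Fintype.card_fun, Fintype.card_bool, Fintype.card_fin]
    omega
  refine M.run_mono h1 fun ω hω => ?_
  have h2 := (hyp ω hω).2.2.2.2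
  have h3 : B.length * (4 * min (D ω) (2 ^ h) + 3) ≤ D ω * (4 * 2 ^ h + 3) :=
    Nat.mul_le_mul h2 (by have := min_le_right (D ω) (2 ^ h); omega)
  generalize B.length * (4 * min (D ω) (2 ^ h) + 3) = x at h3 ⊢
  have h4 := Nat.zero_le (D ω * 2 ^ h)
  have h5 : (D ω + 1) * (12 * 2 ^ h + (5 * m + 24)) = D ω * (4 * 2 ^ h + 3) +
    D ω * (5 * 2 ^ h + 5 * m + 5) + 3 * (D ω * 2 ^ h) + 16 * D ω + 12 * 2 ^ h + 5 * m + 24 := by ring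
  omega

/-- Decoding when the error vanishes on the orthogonal complement of known vectors. -/
theorem run_erase (D : Ω → ℕ) (h ρ : ℕ) (hm : h ≤ m) {s : M.St} {c : Ω → ℕ} {B : List (Ω → L)}
    {Y N : Ω → L →ₗ[K] L} (hB : ∀ v ∈ B, M.Kn s v) (hY : ∀ A, M.Kn s fun ω => Y ω (T.bm h A))
    (hyp : ∀ ω ∈ M.dom s, T.RM h ρ (N ω) ∧ T.FLin h (Y ω) ∧
      (∀ z, (∀ v ∈ ev B ω, T.dot h v z = 0) → Y ω z = N ω z) ∧
      finrank K (T.vspan h (ev B ω)) * 2 ^ ρ < 2 ^ m ∧ B.length ≤ D ω)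
    (hc : ∀ s', s ≤ s' → (∀ A, M.Kn s' fun ω => N ω (T.bm h A)) → M.Run s' c) :
    M.Run s fun ω => c ω + eraseCost m (D ω) h := by
  induction h generalizing ρ s c B Y N with
  | zero =>
    -- At the bottom the strict dimension bound forces all vectors of B to vanish, so the received
    -- map is already the codeword.
    refine M.run_mono (hc s le_rfl fun A => M.kn_congr (hY A) fun ω hω => ?_)
      fun ω _ => Nat.le_add_right _ _
    obtain ⟨-, -, h3, h4, -⟩ := hyp ω hω
    have h5 : finrank K (T.vspan 0 (ev B ω)) < 2 ^ m :=
      lt_of_le_of_lt (Nat.le_mul_of_pos_right _ (by positivity)) h4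
    exact h3 _ fun v hv => by rw [eq_zero_of_finrank_vspan_zero h5 hv, dot_zero_left]
  | succ h ih =>
    have hlt : h < m := hm
    cases ρ with
    | zero =>
      refine M.run_mono (run_erase_zero D hm hB hY (fun ω hω => ?_) hc) fun ω _ => ?_
      · simpa using hyp ω hω
      · rw [eraseCost, pow_succ, show 12 * (2 ^ h * 2) = 24 * 2 ^ h by ring]
        omega
    | succ ρ =>
      let E := fun ω => eraseCost m (D ω) h
      have main : M.Run s fun ω => ((((((c ω + 10 * 2 ^ h) + E ω) +
          (2 * D ω + 1) * 2 ^ h) + D ω) + E ω) + D ω * (9 * 2 ^ h + 5 * m + 16)) + 6 * 2 ^ h := by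
        refine run_components hY fun s₁ h₁ kY₁ kY₀ => ?_
        refine run_descend hlt D (fun v hv => M.kn_mono h₁ (hB v hv))
          (fun ω hω => (hyp ω (M.dom_anti h₁ hω)).2.2.2.2) fun s₂ h₂ W R kW kR hWR hlen => ?_
        have h₀₂ := h₁.trans h₂
        have hflin : ∀ ω ∈ M.dom s₂, T.FLin (h + 1) (Y ω - N ω) := fun ω hω =>
          (hyp ω (M.dom_anti h₀₂ hω)).2.1.sub (hyp ω (M.dom_anti h₀₂ hω)).1.flin
        have hvan : ∀ ω ∈ M.dom s₂, ∀ z, (∀ v ∈ ev B ω, T.dot (h + 1) v z = 0) →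
            (Y ω - N ω) z = 0 := fun ω hω z hz => by
          rw [LinearMap.sub_apply, (hyp ω (M.dom_anti h₀₂ hω)).2.2.1 z hz, sub_self]
        have hevW : ∀ ω, ev (W.map fun a => a.2.1) ω = (evRows W ω).map fun a => a.2.1 :=
          fun ω => by simp [ev, evRows, List.map_map, Function.comp_def]
        -- First component: order ρ in place of ρ + 1, against a space of at most twice the
        -- dimension.
        refine ih ρ hlt.le (B := W.map fun a => a.2.1) (Y := fun ω => T.comp₁ h (Y ω))
          (N := fun ω => T.comp₁ h (N ω)) (fun v hv => ?_) (fun A => M.kn_mono h₂ (kY₁ A))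
          (fun ω hω => ?_) fun s₃ h₃ k₃ => ?_
        · obtain ⟨a, ha, rfl⟩ := List.mem_map.1 hv
          exact (kW a ha).1
        · obtain ⟨g1, g2, g3, g4, g5⟩ := hyp ω (M.dom_anti h₀₂ hω)
          refine ⟨g1.comp₁ hlt, g2.comp₁ hlt, fun z hz => ?_, ?_, ?_⟩
          · have := comp₁_eq_zero_of_perp hlt (hflin ω hω) (hvan ω hω) (hWR ω hω).2 (y := z)
              fun a ha => hz _ (by rw [hevW]; exact List.mem_map.2 ⟨a, ha, rfl⟩)
            rw [comp₁_sub, LinearMap.sub_apply] at this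
            exact sub_eq_zero.1 this
          · rw [hevW]
            refine lt_of_le_of_lt (Nat.mul_le_mul_right _
              (finrank_vspan_pivots_le hlt (hWR ω hω).2)) ?_
            rw [pow_succ] at g4
            linarith
          · rw [List.length_map]; omega
        · have h₀₃ := h₀₂.trans h₃
          let Z : ((Fin h → Bool) × (Ω → L) × (Ω → L)) → Ω → L := fun a ω =>
            T.comp₁ h (Y ω) (T.bm h a.1) - T.comp₁ h (N ω) (T.bm h a.1)
          have hrun : M.Run s₃ fun ω => (((c ω + 10 * 2 ^ h) + E ω) +
              Fintype.card (Fin h → Bool) * (2 * W.length + 1)) + W.length * 1 := by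
            refine run_list W (f := Z) (fun a _ => (Kn.comp (M.kn_mono (h₂.trans h₃) (kY₁ a.1))).sub
              (Kn.comp (k₃ a.1))) fun s₄ h₄ k₄ => ?_
            -- With E₁ known at the pivot monomials, the part of E₀ it determines is removed. What
            -- is left agrees with the codeword on the complement of R.
            let Y' : Ω → L →ₗ[K] L := fun ω => T.comp₀ h (Y ω) -
              (W.map fun a => LinearMap.mulLeft K (Z a ω) ∘ₗ T.dot h (a.2.2 ω)).sum
            have hY' : ∀ ω x, Y' ω x = T.comp₀ h (Y ω) x -
                (W.map fun a => T.dot h (a.2.2 ω) x * Z a ω).sum := fun ω x => by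
              have : ∀ l : List (L →ₗ[K] L), l.sum x = (l.map fun g => g x).sum := fun l => by
                induction l with
                | nil => rfl
                | cons g l ih => simp [ih]
              simp [Y', this, List.map_map, Function.comp_def, mul_comm]
            have h₁₄ := h₂.trans (h₃.trans h₄)
            refine run_family (f := fun (A : Fin h → Bool) ω => Y' ω (T.bm h A)) (fun A => ?_)
              fun s₅ h₅ k₅ => ?_
            · refine (((Kn.comp (M.kn_mono h₁₄ (kY₀ A))).sub (comp_list_sum W (n := 1)
                (f := fun a ω => T.coef h A (a.2.2 ω) * Z a ω) fun a ha =>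
                  (Kn.comp (M.kn_mono (h₃.trans h₄) ((kW a ha).2.coef hlt.le A))).mul
                    (Kn.comp (k₄ a ha)))).congr fun ω _ => ?_).le (by omega)
              simp only [hY', T.dot_bm hlt.le]
            · have h₂₅ := h₃.trans (h₄.trans h₅)
              refine ih (ρ + 1) hlt.le (B := R) (Y := Y') (N := fun ω => T.comp₀ h (N ω))
                (fun v hv => M.kn_mono h₂₅ (kR v hv)) k₅ (fun ω hω => ?_) fun s₆ h₆ k₆ => ?_
              · have hω₂ := M.dom_anti h₂₅ hω
                obtain ⟨g1, g2, g3, g4, g5⟩ := hyp ω (M.dom_anti h₀₂ hω₂)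
                refine ⟨g1.comp₀ hlt, fun e he x => ?_, fun z hz => ?_, ?_, by omega⟩
                · rw [hY', hY', g2.comp₀ hlt e he, mul_sub, ← List.sum_map_mul_left]
                  simp only [T.dot_mul he, mul_assoc]
                · have := comp₀_eq_sum_of_perp hlt (hflin ω hω₂) (hvan ω hω₂) (hWR ω hω₂).1
                    (hWR ω hω₂).2 hz
                  rw [comp₀_sub, LinearMap.sub_apply] at this
                  rw [hY', sub_eq_iff_eq_add, ← sub_eq_iff_eq_add', this]
                  simp [evRows, List.map_map, Function.comp_def, Z, comp₁_sub]
                · exact lt_of_le_of_lt (Nat.mul_le_mul_right _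
                    (finrank_vspan_rest_le hlt (hWR ω hω₂).2)) g4
              · have h₃₆ := h₄.trans (h₅.trans h₆)
                exact run_assemble hlt
                  (fun ω hω => (hyp ω (M.dom_anti (h₀₃.trans h₃₆) hω)).1.flin)
                  (fun A => M.kn_mono h₃₆ (k₃ A)) k₆
                  fun s₇ h₇ k₇ => hc s₇ (h₀₃.trans (h₃₆.trans h₇)) k₇
          refine M.run_mono hrun fun ω hω => ?_
          have h5 := (hyp ω (M.dom_anti h₀₃ hω)).2.2.2.2
          have h6 : W.length ≤ D ω := by omega
          simp only [Fintype.card_fun, Fintype.card_bool, Fintype.card_fin]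
          have h7 : 2 ^ h * (2 * W.length + 1) ≤ (2 * D ω + 1) * 2 ^ h := by
            rw [mul_comm]
            gcongr
          omega
      refine M.run_mono main fun ω _ => ?_
      simp only [E]
      rw [eraseCost]
      generalize eraseCost m (D ω) h = e
      generalize 2 ^ h = z
      nlinarith

end LMachine

/-! ### Linear relations -/

namespace QuadTower

open Module

variable {K : Type u} {L : Type v} [Field K] [Field L] [Algebra K L] {m : ℕ} {T : QuadTower K L m}

variable (T) in
/-- The relation `{(z, Y z + a) : z ⊥ B, a ∈ span A}`. -/
def rel (h : ℕ) (Y : L →ₗ[K] L) (A B : List L) : Submodule K (L × L) where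
  carrier := {d | (∀ v ∈ B, T.dot h v d.1 = 0) ∧ d.2 - Y d.1 ∈ T.vspan h A}
  add_mem' {a b} ha hb := by
    refine ⟨fun v hv => by simp [ha.1 v hv, hb.1 v hv], ?_⟩
    have := add_mem ha.2 hb.2
    rwa [sub_add_sub_comm, ← map_add] at this
  zero_mem' := by simp
  smul_mem' c d hd := by
    refine ⟨fun v hv => by simp [hd.1 v hv], ?_⟩
    have := (T.vspan h A).smul_mem c hd.2
    rwa [smul_sub, ← map_smul] at this

lemma mem_rel {h : ℕ} {Y : L →ₗ[K] L} {A B : List L} {d : L × L} : d ∈ T.rel h Y A B ↔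
    (∀ v ∈ B, T.dot h v d.1 = 0) ∧ d.2 - Y d.1 ∈ T.vspan h A := Iff.rfl

lemma stable_rel {h : ℕ} {Y : L →ₗ[K] L} (hY : T.FLin h Y) (A B : List L) :
    T.Stable h (T.rel h Y A B) := by
  intro c hc d hd
  rw [mem_rel] at *
  simp only [Prod.smul_fst, Prod.smul_snd, smul_eq_mul]
  refine ⟨fun v hv => by rw [T.dot_mul hc, hd.1 v hv, mul_zero], ?_⟩
  rw [hY c hc, ← mul_sub]
  exact stable_vspan h A c hc _ hd.2

/-- The map `(z, y) ↦ y - f z`. -/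
def residual (K : Type u) {L : Type v} [Field K] [Field L] [Algebra K L] (f : L) :
    L × L →ₗ[K] L :=
  LinearMap.snd K L L - LinearMap.mulLeft K f ∘ₗ LinearMap.fst K L L

lemma residual_apply (f : L) (d : L × L) : residual K f d = d.2 - f * d.1 := rfl

/-- The defect of a relation with respect to the multiplication by `f`. -/
noncomputable def defect (m : ℕ) (f : L) (X : Submodule K (L × L)) : ℤ :=
  2 * finrank K (X.map (residual K f)) + 2 ^ m - finrank K X

/-- The residual map is L-linear, so it sends the sum into the sum and the intersection into the
intersection formed from its image. Both for X and for the image the two dimensions add up to twice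
the old one. -/
lemma defect_up_add_defect_down (hfin : FiniteDimensional K L) {h : ℕ} (hm : h < m) (f : L)
    (X : Submodule K (L × L)) :
    defect m f (T.up h X) + defect m f (T.down h X) ≤ 2 * defect m f X := by
  have hsm : ∀ (c : L) d, residual K f (c • d) = c • residual K f d := fun c d => by
    simp only [residual_apply, Prod.smul_fst, Prod.smul_snd, smul_eq_mul]; ring
  have h1 : (T.up h X).map (residual K f) ≤ T.up h (X.map (residual K f)) := by
    rintro _ ⟨d, hd, rfl⟩
    obtain ⟨x, hx, y, hy, rfl⟩ := mem_up.1 hd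
    exact mem_up.2 ⟨_, Submodule.mem_map_of_mem hx, _, Submodule.mem_map_of_mem hy, by
      rw [map_add, hsm]⟩
  have h2 : (T.down h X).map (residual K f) ≤ T.down h (X.map (residual K f)) := by
    rintro _ ⟨d, hd, rfl⟩
    obtain ⟨h3, h4⟩ := mem_down.1 hd
    exact mem_down.2 ⟨Submodule.mem_map_of_mem h3, hsm _ d ▸ Submodule.mem_map_of_mem h4⟩
  have e1 := Submodule.finrank_mono h1
  have e2 := Submodule.finrank_mono h2
  have e3 := finrank_up_add_down (T := T) hm (X.map (residual K f))
  have e4 := finrank_up_add_down (T := T) hm X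
  simp only [defect]
  omega

/-- On the kernel of the residual map the first coordinate determines the second, so dim X exceeds
the dimension of the image by at most 2^m. -/
lemma defect_nonneg (T : QuadTower K L m) (f : L) (X : Submodule K (L × L)) : 0 ≤ defect m f X := by
  have hfin := T.finiteDimensional
  have h1 := LinearMap.finrank_range_add_finrank_ker ((residual K f).domRestrict X)
  rw [LinearMap.range_domRestrict] at h1
  have h2 : finrank K ((residual K f).domRestrict X).ker ≤ 2 ^ m := by
    rw [← T.finrank_top]
    refine LinearMap.finrank_le_finrank_of_injective (f := LinearMap.fst K L L ∘ₗ X.subtype ∘ₗ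
      Submodule.subtype _) fun x y hxy => ?_
    obtain ⟨⟨⟨a, b⟩, hx⟩, hx'⟩ := x
    obtain ⟨⟨⟨a', b'⟩, hy⟩, hy'⟩ := y
    have e1 : a = a' := hxy
    have e2 : b - f * a = 0 := hx'
    have e3 : b' - f * a' = 0 := hy'
    have e4 : b = b' := by rw [sub_eq_zero.1 e2, sub_eq_zero.1 e3, e1]
    subst e1 e4
    rfl
  rw [defect]
  have h3 : ((2 ^ m : ℕ) : ℤ) = 2 ^ m := by push_cast; rfl
  omega

/-- The bilinear form `dot h` with values in `F h`. -/
noncomputable def dotForm (T : QuadTower K L m) {h : ℕ} (hm : h ≤ m) : LinearMap.BilinForm (T.F h) L :=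
  LinearMap.mk₂ (T.F h) (fun v x => ⟨T.dot h v x, T.dot_mem hm v x⟩)
    (fun v v' x => Subtype.ext (T.dot_add_left h v v' x))
    (fun c v x => Subtype.ext (T.dot_mul_left c.2 v x))
    (fun _ _ _ => Subtype.ext (map_add _ _ _))
    (fun c v x => Subtype.ext (T.dot_mul c.2 v x))

lemma dotForm_apply {h : ℕ} (hm : h ≤ m) (v x : L) : (T.dotForm hm v x : L) = T.dot h v x := rfl

variable (T) in
/-- The orthogonal complement. -/
def perp (h : ℕ) (B : List L) : Submodule K L where
  carrier := {z | ∀ v ∈ B, T.dot h v z = 0}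
  add_mem' ha hb v hv := by rw [map_add, ha v hv, hb v hv, add_zero]
  zero_mem' v _ := map_zero _
  smul_mem' c x hx v hv := by rw [map_smul, hx v hv, smul_zero]

lemma mem_perp {h : ℕ} {B : List L} {z : L} : z ∈ T.perp h B ↔ ∀ v ∈ B, T.dot h v z = 0 := Iff.rfl

lemma finrank_perp {h : ℕ} (hm : h ≤ m) (B : List L) :
    finrank K (T.perp h B) + finrank K (T.vspan h B) = 2 ^ m := by
  have hfin := T.finiteDimensional
  have hrefl : (T.dotForm hm).IsRefl := fun x y hxy => by
    refine Subtype.ext ?_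
    rw [dotForm_apply, dot_comm, ← dotForm_apply hm, hxy]
  have hnd : (T.dotForm hm).Nondegenerate := by
    refine hrefl.nondegenerate_iff_separatingLeft.2 fun v hv => ?_
    refine T.ext_coef (h := h) fun A => ?_
    rw [← T.dot_bm hm, ← dotForm_apply hm, hv, map_zero]
    rfl
  set V := Submodule.span (T.F h) {x | x ∈ B} with hV
  have h1 := LinearMap.BilinForm.finrank_orthogonal hnd V
  have h2 := Submodule.finrank_le V
  have h3 : T.perp h B = ((T.dotForm hm).orthogonal V).restrictScalars K := by
    ext z
    rw [Submodule.restrictScalars_mem, LinearMap.BilinForm.mem_orthogonal_iff, mem_perp]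
    constructor
    · intro hz n hn
      induction hn using Submodule.span_induction with
      | mem x hx => exact Subtype.ext (hz x hx)
      | zero => exact Subtype.ext (T.dot_zero_left h z)
      | add x y _ _ hx hy =>
        exact Subtype.ext (by
          rw [dotForm_apply, dot_add_left, ← dotForm_apply hm, ← dotForm_apply hm, hx, hy]; simp)
      | smul c x _ hx =>
        exact Subtype.ext (by
          rw [dotForm_apply]
          have := T.dot_mul_left c.2 x z
          rw [← dotForm_apply hm x z, hx] at this
          simpa [Algebra.smul_def] using this)
    · intro hz v hv
      rw [← dotForm_apply hm, hz v (Submodule.subset_span hv)]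
      rfl
  rw [h3, finrank_restrictScalars hm, vspan, finrank_restrictScalars hm, ← mul_add, h1,
    Nat.sub_add_cancel h2, T.finrank_F_top hm, ← pow_add, Nat.sub_add_cancel hm]

lemma finrank_rel {h : ℕ} (hm : h ≤ m) (Y : L →ₗ[K] L) (A B : List L) :
    finrank K (T.rel h Y A B) + finrank K (T.vspan h B) = 2 ^ m + finrank K (T.vspan h A) := by
  have hfin := T.finiteDimensional
  have h1 := finrank_fst_add (X := T.rel h Y A B) hfin
  have h2 : (T.rel h Y A B).map (LinearMap.fst K L L) = T.perp h B := by
    ext z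
    constructor
    · rintro ⟨d, hd, rfl⟩
      exact hd.1
    · intro hz
      exact ⟨(z, Y z), ⟨hz, by simp⟩, rfl⟩
  have h3 : (T.rel h Y A B).comap (LinearMap.inr K L L) = T.vspan h A := by
    ext z
    simp [mem_rel]
  have h4 := finrank_perp (T := T) hm B
  rw [h2, h3] at h1
  omega

/-- With a = dim ⟨A⟩ and b = dim ⟨B⟩ over K, the relation has dimension 2^m + a - b and its residual
image contains ⟨A⟩. Thus the defect is at least 2a - (a - b) = a + b. A small defect therefore keeps
the lists A and B short after reduction. -/
lemma finrank_add_le_defect {h : ℕ} (hm : h ≤ m) (Y : L →ₗ[K] L) (A B : List L) (f : L) :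
    ((finrank K (T.vspan h A) + finrank K (T.vspan h B) : ℕ) : ℤ) ≤
      defect m f (T.rel h Y A B) := by
  have hfin := T.finiteDimensional
  have h1 := finrank_rel (T := T) hm Y A B
  have h2 : T.vspan h A ≤ (T.rel h Y A B).map (residual K f) := fun a ha =>
    ⟨(0, a), ⟨by simp, by simpa using ha⟩, by simp [residual_apply]⟩
  have h3 := Submodule.finrank_mono h2
  rw [defect]
  have h4 : ((2 ^ m : ℕ) : ℤ) = 2 ^ m := by push_cast; rfl
  omega

lemma finrank_span_le_of_defect_le {h D : ℕ} (hm : h ≤ m) {Y : L →ₗ[K] L} {A B : List L} {f : L}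
    (hD : defect m f (T.rel h Y A B) ≤ 2 ^ (m - h) * D) :
    finrank (T.F h) (Submodule.span (T.F h) {x | x ∈ A}) ≤ D ∧
      finrank (T.F h) (Submodule.span (T.F h) {x | x ∈ B}) ≤ D := by
  have h1 := (finrank_add_le_defect hm Y A B f).trans hD
  rw [vspan, vspan, finrank_restrictScalars hm, finrank_restrictScalars hm, ← mul_add] at h1
  have h2 := le_of_mul_le_mul_left (by exact_mod_cast h1) (show 0 < 2 ^ (m - h) by positivity)
  omega

/-! #### The sum of the conjugates of a relation -/

lemma mem_pairPerp_of_mem_rowSpan {h : ℕ} {B : List L} {x y : L}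
    (hxy : ∀ v ∈ B, T.dot h (T.θ h (T.vec₁ h v)) x + T.dot h (T.vec₁ h v) y = 0) {d : L × L}
    (hd : d ∈ T.rowSpan h (B.map (T.vecPair h)) [] []) : T.dot h d.2 x + T.dot h d.1 y = 0 := by
  have := mem_of_mem_rowSpan (stable_pairPerp h x y) (fun p hp => ?_) (by simp) (by simp) hd
  · rwa [mem_pairPerp] at this
  · obtain ⟨v, hv, rfl⟩ := List.mem_map.1 hp
    rw [mem_pairPerp]
    exact hxy v hv

/-- The elements x + θy and γx + θ(γy) are orthogonal to B, and an F_h-combination of their graph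
points has x as its first coordinate; its second coordinate is given by `comp_eq`. -/
lemma mem_up_rel_of_perp {h : ℕ} (hm : h < m) {Y : L →ₗ[K] L} (hY : T.FLin (h + 1) Y)
    {A B : List L} {x y : L}
    (hxy : ∀ v ∈ B, T.dot h (T.θ h (T.vec₁ h v)) x + T.dot h (T.vec₁ h v) y = 0) :
    (x, T.comp₀ h Y x + T.comp₁ h Y y) ∈ T.up h (T.rel (h + 1) Y A B) := by
  have hst := stable_up hm (stable_rel hY A B)
  have hne := T.sub_ne hm
  have hγ := T.γ_mem (h := h)
  have hmem : ∀ c ∈ T.F h, ((c * x + T.θ h (c * y), Y (c * x + T.θ h (c * y))) : L × L) ∈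
      T.up h (T.rel (h + 1) Y A B) := fun c hc =>
    le_up ⟨fun v hv => T.dot_succ_eq_zero hm (hxy v hv) hc, by simp⟩
  have h1 := hst _ (inv_mem (sub_mem hγ (T.θ_mem hγ h))) _
    (Submodule.sub_mem _ (hmem _ hγ) (hst _ (T.θ_mem hγ h) _ (hmem 1 (one_mem _))))
  convert h1 using 1
  have h2 := comp_eq hm hY x y
  ext
  · simp only [Prod.smul_fst, Prod.fst_sub, smul_eq_mul, one_mul]
    rw [eq_inv_mul_iff_mul_eq₀ hne, map_mul]
    ring
  · simp only [Prod.smul_snd, Prod.snd_sub, smul_eq_mul, one_mul]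
    rw [eq_inv_mul_iff_mul_eq₀ hne, h2]

/-- After extension of scalars the relation consists of all (x, Y₀x + Y₁t + a) with (x, t) subject
to the descended conditions. Eliminating t leaves the rows R as conditions on x, turns the dependent
part of t into the correction in Y', and turns its free part into new vectors Q(b) next to A. -/
lemma up_rel {h : ℕ} (hm : h < m) {Y : L →ₗ[K] L} (hY : T.FLin (h + 1) Y) {A B : List L}
    {W : List ((Fin h → Bool) × L × L)} {R : List L} (hW : T.Reduced h W)
    (hspan : T.rowSpan h [] W R = T.rowSpan h (B.map (T.vecPair h)) [] []) {Y' Q : L →ₗ[K] L}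
    (hY' : ∀ x, Y' x = T.comp₀ h Y x -
      (W.map fun a => T.dot h a.2.2 x * T.comp₁ h Y (T.bm h a.1)).sum)
    (hQ : ∀ x, Q x = T.comp₁ h Y x -
      (W.map fun a => T.dot h a.2.1 x * T.comp₁ h Y (T.bm h a.1)).sum)
    {A' : List L}
    (hA' : T.vspan h A' = T.vspan h (Finset.univ.toList.map (fun p => Q (T.bm h p)) ++ A)) :
    T.up h (T.rel (h + 1) Y A B) = T.rel h Y' A' R := by
  have hγ := T.γ_mem (h := h)
  have hst := stable_up hm (stable_rel hY A B)
  have hc1 := hY.comp₁ hm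
  have hc0 := hY.comp₀ hm
  have hQl : T.FLin h Q := fun c hc x => by
    rw [hQ, hQ, hc1 c hc, mul_sub, ← List.sum_map_mul_left]
    simp only [T.dot_mul hc, mul_assoc]
  apply le_antisymm
  · intro d hd
    obtain ⟨⟨z, y⟩, hr, ⟨z', y'⟩, hr', rfl⟩ := mem_up.1 hd
    rw [mem_rel] at hr hr'
    simp only at hr hr'
    -- The pair (x, t) is the image of z ⊗ 1 + z' ⊗ γ under L ⊗ F_h ≅ L × L.
    set x := z + T.γ h * z' with hx
    set t := T.θ h z + T.γ h * T.θ h z' with ht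
    have hxt : ∀ v ∈ B, T.dot h (T.θ h (T.vec₁ h v)) x + T.dot h (T.vec₁ h v) t = 0 := by
      intro v hv
      have h1 := hr.1 v hv
      have h2 := hr'.1 v hv
      rw [T.dot_succ hm] at h1 h2
      rw [hx, ht, map_add, map_add, T.dot_mul hγ, T.dot_mul hγ]
      linear_combination h1 + T.γ h * h2
    have hD := fun d => mem_pairPerp_of_mem_rowSpan (d := d) hxt
    rw [← hspan] at hD
    refine mem_rel.2 ⟨fun r hr => ?_, ?_⟩
    · have := hD _ ((contains_rowSpan (T := T) [] W R).2.2 r hr)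
      change T.dot h r x = 0
      simpa [dot_zero_left] using this
    · have e1 : (W.map fun a => T.dot h a.2.2 x * T.comp₁ h Y (T.bm h a.1)).sum =
          -(W.map fun a => T.dot h a.2.1 t * T.comp₁ h Y (T.bm h a.1)).sum := by
        have e2 : ∀ l : List ((Fin h → Bool) × L × L), (∀ a ∈ l, a ∈ W) →
            (l.map fun a => T.dot h a.2.2 x * T.comp₁ h Y (T.bm h a.1)).sum =
            -(l.map fun a => T.dot h a.2.1 t * T.comp₁ h Y (T.bm h a.1)).sum := by
          intro l hl
          induction l with
          | nil => simp
          | cons a l ih =>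
            have := hD _ ((contains_rowSpan (T := T) [] W R).2.1 a (hl a (by simp)))
            rw [List.map_cons, List.sum_cons, List.map_cons, List.sum_cons,
              ih fun b hb => hl b (by simp [hb])]
            linear_combination T.comp₁ h Y (T.bm h a.1) * this
        exact e2 W fun _ h => h
      have e3 : Y z + T.γ h * Y z' = T.comp₀ h Y x + T.comp₁ h Y t := by
        rw [T.comp_add h Y z, T.comp_add h Y z', hx, ht, map_add, map_add, hc0 _ hγ, hc1 _ hγ]
        ring
      have e4 : y + T.γ h * y' - Y' x = (y - Y z) + T.γ h * (y' - Y z') + Q t := by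
        rw [hY', hQ, e1]
        linear_combination e3
      have e5 : T.vspan (h + 1) A ≤ T.vspan h A' := by
        have hst' : T.Stable (h + 1) (T.vspan h A') := fun c hc x hx =>
          stable_vspan h A' c (T.F_anti (Nat.le_succ h) hc) x hx
        refine (vspan_le hst').2 fun a ha => ?_
        rw [hA']
        exact mem_vspan (by simp [ha])
      change y + T.γ h * y' - Y' x ∈ T.vspan h A'
      rw [e4]
      refine add_mem (add_mem (e5 hr.2) (stable_vspan h A' _ hγ _ (e5 hr'.2))) ?_
      rw [hQl.apply_eq hm.le t]
      refine sum_mem fun p _ => stable_vspan h A' _ (T.coef_mem hm.le p t) _ ?_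
      rw [hA']
      exact mem_vspan (List.mem_append_left _ (List.mem_map.2 ⟨p, by simp, rfl⟩))
  · rintro ⟨x, y⟩ ⟨h1, h2⟩
    simp only at h1 h2
    have e1 : ((x, Y' x) : L × L) ∈ T.up h (T.rel (h + 1) Y A B) := by
      have := mem_up_rel_of_perp hm hY (A := A)
        fun v hv => dot_vecPair_partner hm.le hW hspan h1 hv
      rw [map_neg, hc1.list_sum W _ fun a _ => T.dot_mem hm.le _ _, ← sub_eq_add_neg, ← hY'] at this
      exact this
    -- For x = 0 the admissible t are spanned by the monomials reduced modulo the pivots; their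
    -- values under Y₁ are the vectors Q(b).
    have e2 : T.vspan h A' ≤ (T.up h (T.rel (h + 1) Y A B)).comap (LinearMap.inr K L L) := by
      rw [hA']
      refine (vspan_le (hst.comap fun c _ x => by simp)).2 fun g hg => ?_
      rw [Submodule.mem_comap, LinearMap.inr_apply]
      rcases List.mem_append.1 hg with hg | hg
      · obtain ⟨p, -, rfl⟩ := List.mem_map.1 hg
        have := mem_up_rel_of_perp hm hY (A := A) (B := B) (x := 0)
          (y := T.bm h p - (W.map fun a => T.coef h p a.2.1 * T.bm h a.1).sum)
          fun v hv => dot_vecPair_eq_zero hspan (fun b hb => ?_) (by simp) hv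
        · rw [map_zero, zero_add, map_sub, hc1.list_sum W _ fun a _ => T.coef_mem hm.le _ _] at this
          rw [hQ]
          simpa only [T.dot_bm hm.le] using this
        · rw [map_zero, zero_add, map_sub, dot_list_sum W _ _ fun a _ => T.coef_mem hm.le _ _]
          simp only [T.dot_bm hm.le]
          rw [list_sum_coef_pivots hW (fun a => T.coef h p a.2.1) hb, sub_self]
      · exact le_up ⟨by simp, by simpa using mem_vspan hg⟩
    have e3 := add_mem e1 (Submodule.mem_comap.1 (e2 h2))
    simpa using e3

end QuadTower

namespace QuadTower

open Module

variable {K : Type u} {L : Type v} [Field K] [Field L] [Algebra K L] {m : ℕ} {T : QuadTower K L m}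

/-! #### The intersection of the conjugates of a relation -/

lemma remainder_add {h : ℕ} (W : List ((Fin h → Bool) × L × L)) (x y : L × L) :
    T.remainder h W (x + y) = T.remainder h W x + T.remainder h W y := by
  simp only [remainder, Prod.fst_add, Prod.snd_add, map_add, add_mul, List.sum_map_add,
    Prod.mk_add_mk, Prod.mk.injEq]
  constructor <;> ring

lemma remainder_mul {h : ℕ} (W : List ((Fin h → Bool) × L × L)) {c : L} (hc : c ∈ T.F h)
    (x : L × L) : T.remainder h W (c * x.1, c * x.2) =
      (c * (T.remainder h W x).1, c * (T.remainder h W x).2) := by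
  simp only [remainder, T.coef_mul hc, mul_assoc, List.sum_map_mul_left, mul_sub]

lemma mem_rowSpan_iff {h : ℕ} (hm : h ≤ m) {W : List ((Fin h → Bool) × L × L)} {R : List L}
    (hW : T.Reduced h W) {d : L × L} : d ∈ T.rowSpan h [] W R ↔
      (T.remainder h W d).1 = 0 ∧ (T.remainder h W d).2 ∈ T.vspan h R := by
  have hcon := contains_rowSpan (T := T) [] W R
  constructor
  · intro hd
    induction hd using Submodule.span_induction with
    | mem x hx =>
      rcases hx with (hx | ⟨b, hb, rfl⟩) | ⟨r, hr, rfl⟩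
      · simp at hx
      · have e1 := list_sum_coef_pivots hW (fun a => a.2.1) hb
        have e2 := list_sum_coef_pivots hW (fun a => a.2.2) hb
        simp only [mul_comm _ (T.coef h _ _)] at e1 e2
        simp [remainder, e1, e2]
      · have e1 : T.remainder h W (0, r) = (0, r) := by simp [remainder]
        rw [e1]
        exact ⟨rfl, mem_vspan hr⟩
    | zero => simp [remainder]
    | add x y _ _ hx hy =>
      rw [remainder_add]
      exact ⟨by simp [hx.1, hy.1], add_mem hx.2 hy.2⟩
    | smul c x _ hx =>
      have e1 : c • x = ((c : L) * x.1, (c : L) * x.2) := rfl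
      rw [e1, remainder_mul W c.2]
      exact ⟨by simp [hx.1], stable_vspan h R c c.2 _ hx.2⟩
  · rintro ⟨h1, h2⟩
    have h3 : T.vspan h R ≤ ((T.rowSpan h [] W R).restrictScalars K).comap (LinearMap.inr K L L) :=
      (vspan_le ((stable_rowSpan h [] W R).comap fun c _ x => by simp)).2 fun r hr => hcon.2.2 r hr
    have h4 : ((0, (T.remainder h W d).2) : L × L) ∈ T.rowSpan h [] W R := h3 h2
    rw [← h1] at h4
    exact (remainder_mem hm _ hcon.2.1 d).1 h4

/-- The span of the pairs `(θ a, a)`. -/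
lemma mem_rowSpan_conj {h : ℕ} (hm : h < m) (A : List L) (p q : L) :
    (-T.θ h p, q) ∈ T.rowSpan h (A.map fun a => (T.θ h a, a)) [] [] ↔
      q - p ∈ T.vspan (h + 1) A ∧ T.γ h * q - T.θ h (T.γ h) * p ∈ T.vspan (h + 1) A := by
  have hγ := T.γ_mem (h := h)
  constructor
  · intro hd
    -- The pairs with both values in the span of A form an F_h-space: multiplying a pair by γ moves
    -- f₁ to f₂ and f₂ to trace · f₂ - norm · f₁.
    let f₁ : L × L →ₗ[K] L := LinearMap.snd K L L + (T.θ h).toLinearMap ∘ₗ LinearMap.fst K L L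
    let f₂ : L × L →ₗ[K] L := LinearMap.mulLeft K (T.γ h) ∘ₗ LinearMap.snd K L L +
      LinearMap.mulLeft K (T.θ h (T.γ h)) ∘ₗ (T.θ h).toLinearMap ∘ₗ LinearMap.fst K L L
    have hf₁ : ∀ d, f₁ d = d.2 + T.θ h d.1 := fun d => rfl
    have hf₂ : ∀ d, f₂ d = T.γ h * d.2 + T.θ h (T.γ h) * T.θ h d.1 := fun d => rfl
    have hst : T.Stable h ((T.vspan (h + 1) A).comap f₁ ⊓ (T.vspan (h + 1) A).comap f₂) := by
      refine stable_of_γ hm (fun c hc d hd => ?_) fun d hd => ?_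
      · have hcθ := (T.mem_F_succ.1 hc).2
        rw [Submodule.mem_inf, Submodule.mem_comap, Submodule.mem_comap] at hd ⊢
        have e1 : f₁ (c • d) = c * f₁ d := by
          simp only [hf₁, Prod.smul_fst, Prod.smul_snd, smul_eq_mul, map_mul, hcθ]; ring
        have e2 : f₂ (c • d) = c * f₂ d := by
          simp only [hf₂, Prod.smul_fst, Prod.smul_snd, smul_eq_mul, map_mul, hcθ]; ring
        rw [e1, e2]
        exact ⟨stable_vspan _ A c hc _ hd.1, stable_vspan _ A c hc _ hd.2⟩
      · rw [Submodule.mem_inf, Submodule.mem_comap, Submodule.mem_comap] at hd ⊢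
        have e1 : f₁ (T.γ h • d) = f₂ d := by
          simp only [hf₁, hf₂, Prod.smul_fst, Prod.smul_snd, smul_eq_mul, map_mul]
        have e2 : f₂ (T.γ h • d) = (T.γ h + T.θ h (T.γ h)) * f₂ d -
            (T.γ h * T.θ h (T.γ h)) * f₁ d := by
          simp only [hf₁, hf₂, Prod.smul_fst, Prod.smul_snd, smul_eq_mul, map_mul]; ring
        rw [e1, e2]
        exact ⟨hd.2, sub_mem (stable_vspan _ A _ T.θγ_add_mem _ hd.2)
          (stable_vspan _ A _ T.θγ_mul_mem _ hd.1)⟩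
    have h1 := mem_of_mem_rowSpan hst (fun x hx => ?_) (by simp) (by simp) hd
    · rw [Submodule.mem_inf, Submodule.mem_comap, Submodule.mem_comap, hf₁, hf₂] at h1
      simpa [T.invol, sub_eq_add_neg] using h1
    · obtain ⟨a, ha, rfl⟩ := List.mem_map.1 hx
      rw [Submodule.mem_inf, Submodule.mem_comap, Submodule.mem_comap, hf₁, hf₂]
      simp only [T.invol, ← add_mul]
      exact ⟨add_mem (mem_vspan ha) (mem_vspan ha),
        stable_vspan _ A _ T.θγ_add_mem _ (mem_vspan ha)⟩
  · rintro ⟨h1, h2⟩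
    have hst := stable_rowSpan (T := T) h (A.map fun a => (T.θ h a, a)) [] []
    have h3 : T.vspan (h + 1) A ≤ ((T.rowSpan h (A.map fun a => (T.θ h a, a)) [] []).restrictScalars
        K).comap (LinearMap.prod (T.θ h).toLinearMap LinearMap.id) := by
      refine (vspan_le fun c hc x hx => ?_).2 fun a ha =>
        (contains_rowSpan _ _ _).1 _ (List.mem_map.2 ⟨a, ha, rfl⟩)
      have hc' := T.mem_F_succ.1 hc
      rw [Submodule.mem_comap] at hx ⊢
      have := hst c hc'.1 _ hx
      convert this using 1
      simp [hc'.2]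
    have h4 := hst _ (inv_mem (sub_mem hγ (T.θ_mem hγ h))) _
      (Submodule.sub_mem _ (h3 h2) (hst _ (T.θ_mem hγ h) _ (h3 h1)))
    have hne := T.sub_ne hm
    rw [Submodule.restrictScalars_mem] at h4
    convert h4 using 1
    ext
    · change -T.θ h p = (T.γ h - T.θ h (T.γ h))⁻¹ * (T.θ h (T.γ h * q - T.θ h (T.γ h) * p) -
        T.θ h (T.γ h) * T.θ h (q - p))
      rw [eq_inv_mul_iff_mul_eq₀ hne]
      simp only [map_sub, map_mul, T.invol]
      ring
    · change q = (T.γ h - T.θ h (T.γ h))⁻¹ * ((T.γ h * q - T.θ h (T.γ h) * p) -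
        T.θ h (T.γ h) * (q - p))
      rw [eq_inv_mul_iff_mul_eq₀ hne]
      ring

/-- With c the value on the right, the two values on the left are c + θc and γc + θγ · θc. As γ ≠ θγ
they vanish together only for c = 0. -/
lemma dot_succ_pair_eq_zero_iff {h : ℕ} (hm : h < m) (v z : L) :
    (T.dot (h + 1) v z = 0 ∧ T.dot (h + 1) v (T.γ h * z) = 0) ↔
      T.dot h (T.θ h (T.vec₁ h v)) z = 0 := by
  have hγ := T.γ_mem (h := h)
  have hθ : T.dot h (T.vec₁ h v) (T.θ h z) = T.θ h (T.dot h (T.θ h (T.vec₁ h v)) z) := by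
    rw [← T.dot_θ le_rfl, T.invol]
  rw [T.dot_succ hm, T.dot_succ hm, θ_mul, T.dot_mul hγ, T.dot_mul (T.θ_mem hγ h), hθ]
  constructor
  · rintro ⟨h1, h2⟩
    have : (T.γ h - T.θ h (T.γ h)) * T.dot h (T.θ h (T.vec₁ h v)) z = 0 := by
      linear_combination h2 - T.θ h (T.γ h) * h1
    exact (mul_eq_zero.1 this).resolve_left (T.sub_ne hm)
  · intro h1
    simp [h1]

/-- Put p = Y₁(θz) and q = y - Y₀z. That (z, y) and γ(z, y) both lie in the relation means, apart
from conditions on z alone, that (-θp, q) lies in the F_h-span of the pairs (θa, a). Eliminating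
first components turns this into a further condition on z, a correction of Y, and membership in the
span of R. -/
lemma down_rel {h : ℕ} (hm : h < m) {Y : L →ₗ[K] L} (hY : T.FLin (h + 1) Y) {A B : List L}
    {W : List ((Fin h → Bool) × L × L)} {R : List L} (hW : T.Reduced h W)
    (hspan : T.rowSpan h [] W R = T.rowSpan h (A.map fun a => (T.θ h a, a)) [] [])
    {Y' : L →ₗ[K] L}
    (hY' : ∀ x, Y' x = T.comp₀ h Y x -
      (W.map fun a => T.coef h a.1 (T.θ h (T.comp₁ h Y (T.θ h x))) * a.2.2).sum)
    {B' : List L}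
    (hB' : ∀ z, (∀ v ∈ B', T.dot h v z = 0) ↔
      (∀ v ∈ B, T.dot h (T.θ h (T.vec₁ h v)) z = 0) ∧ T.θ h (T.comp₁ h Y (T.θ h z)) -
        (W.map fun a => T.coef h a.1 (T.θ h (T.comp₁ h Y (T.θ h z))) * a.2.1).sum = 0) :
    T.down h (T.rel (h + 1) Y A B) = T.rel h Y' R B' := by
  have hγ := T.γ_mem (h := h)
  ext ⟨z, y⟩
  rw [mem_down, mem_rel, mem_rel, mem_rel, hB']
  simp only [Prod.smul_fst, Prod.smul_snd, smul_eq_mul]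
  have e1 : y - Y z = (y - T.comp₀ h Y z) - T.comp₁ h Y (T.θ h z) := by
    rw [T.comp_add h Y z]; ring
  have e2 : T.γ h * y - Y (T.γ h * z) = T.γ h * (y - T.comp₀ h Y z) -
      T.θ h (T.γ h) * T.comp₁ h Y (T.θ h z) := by
    rw [T.comp_add h Y (T.γ h * z), θ_mul, hY.comp₀ hm _ hγ, hY.comp₁ hm _ (T.θ_mem hγ h)]
    ring
  have e3 := mem_rowSpan_conj (T := T) hm A (T.comp₁ h Y (T.θ h z)) (y - T.comp₀ h Y z)
  rw [← e1, ← e2, ← hspan, mem_rowSpan_iff hm.le hW] at e3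
  have hneg : ∀ g : (Fin h → Bool) × L × L → L, (W.map fun a => -g a).sum = -(W.map g).sum :=
    fun g => by simpa using List.sum_map_mul_left W g (-1)
  have e4 : (T.remainder h W (-T.θ h (T.comp₁ h Y (T.θ h z)), y - T.comp₀ h Y z)).1 = 0 ↔
      T.θ h (T.comp₁ h Y (T.θ h z)) -
        (W.map fun a => T.coef h a.1 (T.θ h (T.comp₁ h Y (T.θ h z))) * a.2.1).sum = 0 := by
    rw [← neg_eq_zero]
    simp only [remainder, map_neg, neg_mul, hneg, sub_neg_eq_add, neg_add_rev, neg_neg]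
    rw [← sub_eq_neg_add]
  have e5 : (T.remainder h W (-T.θ h (T.comp₁ h Y (T.θ h z)), y - T.comp₀ h Y z)).2 = y - Y' z := by
    rw [hY']
    simp only [remainder, map_neg, neg_mul]
    rw [hneg]
    ring
  rw [e4, e5] at e3
  have e6 : (∀ v ∈ B, T.dot h (T.θ h (T.vec₁ h v)) z = 0) ↔
      (∀ v ∈ B, T.dot (h + 1) v z = 0) ∧ ∀ v ∈ B, T.dot (h + 1) v (T.γ h * z) = 0 :=
    ⟨fun H => ⟨fun v hv => ((dot_succ_pair_eq_zero_iff hm v z).2 (H v hv)).1,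
      fun v hv => ((dot_succ_pair_eq_zero_iff hm v z).2 (H v hv)).2⟩,
      fun H v hv => (dot_succ_pair_eq_zero_iff hm v z).1 ⟨H.1 v hv, H.2 v hv⟩⟩
  rw [e6]
  tauto

/-- The vectors of the coordinate functions of a linear map. -/
lemma dot_row {h : ℕ} (hm : h ≤ m) {g : L →ₗ[K] L} (hg : T.FLin h g) (p : Fin h → Bool) (z : L) :
    T.dot h (∑ A, T.coef h p (g (T.bm h A)) * T.bm h A) z = T.coef h p (g z) := by
  rw [dot_apply, hg.apply_eq hm z, map_sum]
  refine Finset.sum_congr rfl fun A _ => ?_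
  rw [T.coef_sum hm _ fun A => T.coef_mem hm _ _, T.coef_mul (T.coef_mem hm _ _), mul_comm]

/-- Elimination of vectors without companions. -/
lemma vspan_pivots {h : ℕ} {l : List L} {W : List ((Fin h → Bool) × L × L)} {R : List L}
    (hspan : T.rowSpan h [] W R = T.rowSpan h (l.map fun v => (v, 0)) [] []) :
    T.vspan h (W.map fun a => a.2.1) = T.vspan h l := by
  have h1 := contains_rowSpan (T := T) [] W R
  have h2 := contains_rowSpan (T := T) (l.map fun v => (v, 0)) ([] : List ((Fin h → Bool) × L × L)) []
  apply le_antisymm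
  · refine (vspan_le (stable_vspan h l)).2 fun x hx => ?_
    obtain ⟨a, ha, rfl⟩ := List.mem_map.1 hx
    have := h1.2.1 a ha
    rw [hspan] at this
    have hst : T.Stable h ((T.vspan h l).comap (LinearMap.fst K L L)) :=
      (stable_vspan h l).comap fun c _ x => rfl
    have h3 := mem_of_mem_rowSpan hst (fun x hx => ?_) (by simp) (by simp) this
    · exact h3
    · obtain ⟨v, hv, rfl⟩ := List.mem_map.1 hx
      exact Submodule.mem_comap.2 (mem_vspan hv)
  · refine (vspan_le (stable_vspan h _)).2 fun v hv => ?_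
    have := h2.1 _ (List.mem_map.2 ⟨v, hv, rfl⟩)
    rw [← hspan] at this
    have hst : T.Stable h ((T.vspan h (W.map fun a => a.2.1)).comap (LinearMap.fst K L L)) :=
      (stable_vspan h _).comap fun c _ x => rfl
    have h3 := mem_of_mem_rowSpan hst (by simp) (fun a ha => Submodule.mem_comap.2 <|
      mem_vspan (List.mem_map.2 ⟨a, ha, rfl⟩)) (fun r _ => by
        rw [Submodule.mem_comap, LinearMap.fst_apply]; exact zero_mem _) this
    exact h3

lemma perp_eq_of_vspan_eq {h : ℕ} {l l' : List L} (hl : T.vspan h l = T.vspan h l') (z : L) :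
    (∀ v ∈ l, T.dot h v z = 0) ↔ ∀ v ∈ l', T.dot h v z = 0 := by
  have key : ∀ l : List L, (∀ v ∈ l, T.dot h v z = 0) ↔ ∀ v ∈ T.vspan h l, T.dot h v z = 0 := by
    intro l
    refine ⟨fun H => ?_, fun H v hv => H v (mem_vspan hv)⟩
    let X : Submodule K L :=
      { carrier := {v | T.dot h v z = 0}
        add_mem' := fun {a b} ha hb => by
          change T.dot h (a + b) z = 0
          rw [dot_add_left, ha, hb, add_zero]
        zero_mem' := T.dot_zero_left h z
        smul_mem' := fun c v hv => by
          change T.dot h (c • v) z = 0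
          rw [Algebra.smul_def, T.dot_mul_left (algebraMap_mem _ _), hv, mul_zero] }
    have hX : T.Stable h X := fun c hc v hv => by
      change T.dot h (c * v) z = 0
      rw [T.dot_mul_left hc, hv, mul_zero]
    exact fun v hv => (vspan_le hX).2 H hv
  rw [key, hl, ← key]

/-! #### Relations over the top field -/

/-- Over L a nonzero vector spans a space of dimension 2^m, which bounds the defect from below. Such
a leaf may abstain. -/
lemma defect_leaf_of_ne {Y : L →ₗ[K] L} {A B : List L} (f : L)
    (h0 : ∃ v, (v ∈ A ∨ v ∈ B) ∧ v ≠ 0) : 2 ^ m ≤ defect m f (T.rel 0 Y A B) := by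
  have h1 := finrank_add_le_defect (T := T) (Nat.zero_le m) Y A B f
  have key : ∀ l : List L, (∃ v ∈ l, v ≠ 0) → 2 ^ m ≤ finrank K (T.vspan 0 l) := fun l hl => by
    by_contra hcon
    push Not at hcon
    obtain ⟨v, hv, hv0⟩ := hl
    exact hv0 (eq_zero_of_finrank_vspan_zero hcon hv)
  obtain ⟨v, hv | hv, hv0⟩ := h0
  · have := key A ⟨v, hv, hv0⟩
    refine le_trans ?_ h1
    exact_mod_cast this.trans (Nat.le_add_right _ _)
  · have := key B ⟨v, hv, hv0⟩
    refine le_trans ?_ h1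
    exact_mod_cast this.trans (Nat.le_add_left _ _)

/-- The leaf is the graph of multiplication by Y(1). For a different slope f the residual map is
onto, so a wrong vote comes with defect 2 · 2^m. -/
lemma defect_leaf_of_eq {Y : L →ₗ[K] L} (hY : T.FLin 0 Y) {A B : List L}
    (hA : ∀ v ∈ A, v = 0) (hB : ∀ v ∈ B, v = 0) {f : L} (hf : f ≠ Y 1) :
    defect m f (T.rel 0 Y A B) = 2 * 2 ^ m := by
  have hfin := T.finiteDimensional
  have hbot : ∀ l : List L, (∀ v ∈ l, v = 0) → T.vspan 0 l = ⊥ := fun l hl =>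
    le_bot_iff.1 ((vspan_le fun c _ x hx => by
      rw [Submodule.mem_bot] at hx ⊢; rw [hx, smul_zero]).2 fun v hv => by simp [hl v hv])
  have h1 := finrank_rel (T := T) (Nat.zero_le m) Y A B
  rw [hbot A hA, hbot B hB, finrank_bot] at h1
  have h2 : (T.rel 0 Y A B).map (residual K f) = ⊤ := by
    refine eq_top_iff.2 fun y _ => ?_
    have hne : Y 1 - f ≠ 0 := sub_ne_zero.2 (Ne.symm hf)
    refine ⟨((Y 1 - f)⁻¹ * y, Y ((Y 1 - f)⁻¹ * y)), ⟨fun v hv => ?_, by simp⟩, ?_⟩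
    · rw [hB v hv, dot_zero_left]
    · have : Y ((Y 1 - f)⁻¹ * y) = ((Y 1 - f)⁻¹ * y) * Y 1 := by
        have := hY ((Y 1 - f)⁻¹ * y) (fun i hi => absurd hi (by omega)) 1
        rwa [mul_one] at this
      rw [residual_apply]
      simp only
      rw [this]
      field_simp
  rw [defect, h2, _root_.finrank_top, T.finrank_top]
  have : (finrank K (T.rel 0 Y A B) : ℤ) = 2 ^ m := by exact_mod_cast h1
  rw [this]
  push_cast
  ring

end QuadTower

/-! ### Decoding of multiples of the identity -/

namespace QuadTower

open Module

variable {K : Type u} {L : Type v} [Field K] [Field L] [Algebra K L] {m : ℕ} {T : QuadTower K L m}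

lemma list_sum_apply {α : Type*} (l : List α) (g : α → L →ₗ[K] L) (x : L) :
    (l.map g).sum x = (l.map fun a => g a x).sum := by
  induction l with
  | nil => rfl
  | cons a l ih => simp [ih]

lemma map_fst_rowSpan {h : ℕ} (l : List L) :
    (T.rowSpan h (l.map fun v => (v, 0)) [] []).map (LinearMap.fst (T.F h) L L) =
      Submodule.span (T.F h) {x | x ∈ l} := by
  rw [rowSpan, Submodule.map_span]
  congr 1
  ext x
  simp

end QuadTower

/-! ### One descent step for relations on the machine -/

namespace LMachine

open QuadTower Module

variable {K : Type u} {L : Type v} [Field K] [Field L] [Algebra K L] {m : ℕ}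
  {T : QuadTower K L m} {Ω : Type w} {M : LMachine T Ω}

theorem run_reduce {h : ℕ} (hm : h ≤ m) (D : Ω → ℕ) {c : Ω → ℕ} (l : List (Ω → L)) {s : M.St}
    (hl : ∀ v ∈ l, M.Kn s v)
    (hD : ∀ ω ∈ M.dom s, finrank (T.F h) (Submodule.span (T.F h) {x | x ∈ ev l ω}) ≤ D ω)
    (hc : ∀ s', s ≤ s' → ∀ V : List (Ω → L), (∀ v ∈ V, M.Kn s' v) →
      (∀ ω ∈ M.dom s', T.vspan h (ev V ω) = T.vspan h (ev l ω) ∧ V.length ≤ D ω) → M.Run s' c) :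
    M.Run s fun ω => c ω + (l.length * (4 * min (D ω) (2 ^ h) + 3) +
      D ω * (5 * 2 ^ h + 5 * m + 5)) := by
  have hev : ∀ ω, evPairs (l.map fun v => (v, fun _ => 0)) ω = (ev l ω).map fun v => (v, 0) :=
    fun ω => by simp [evPairs, ev, List.map_map, Function.comp_def]
  have h1 := run_elim hm D (l.map fun v => (v, fun _ => 0)) s (c := c) (fun a ha => ?_)
    (fun ω hω => ?_) fun s' h' W R kW _ hWR _ => hc s' h' (W.map fun a => a.2.1) (fun v hv => ?_)
      fun ω hω => ?_
  · simpa using h1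
  · obtain ⟨v, hv, rfl⟩ := List.mem_map.1 ha
    exact ⟨hl v hv, M.kn_zero s⟩
  · rw [hev, map_fst_rowSpan]
    exact hD ω hω
  · obtain ⟨a, ha, rfl⟩ := List.mem_map.1 hv
    exact (kW a ha).1
  · obtain ⟨-, h3, h4⟩ := hWR ω hω
    rw [hev] at h3
    refine ⟨?_, by simpa using h4⟩
    rw [← vspan_pivots h3]
    congr 1
    simp [ev, evRows, List.map_map, Function.comp_def]

theorem run_up {h : ℕ} (hm : h < m) (D : Ω → ℕ) {c : Ω → ℕ} {s : M.St} {A B : List (Ω → L)}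
    {Y : Ω → L →ₗ[K] L} {f : Ω → L} (hA : ∀ v ∈ A, M.Kn s v) (hB : ∀ v ∈ B, M.Kn s v)
    (hY₁ : ∀ p, M.Kn s fun ω => T.comp₁ h (Y ω) (T.bm h p))
    (hY₀ : ∀ p, M.Kn s fun ω => T.comp₀ h (Y ω) (T.bm h p))
    (hyp : ∀ ω ∈ M.dom s, T.FLin (h + 1) (Y ω) ∧ A.length ≤ D ω ∧ B.length ≤ D ω ∧
      defect m (f ω) (T.up h (T.rel (h + 1) (Y ω) (ev A ω) (ev B ω))) ≤ 2 ^ (m - h) * D ω)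
    (hc : ∀ s', s ≤ s' → ∀ (A' B' : List (Ω → L)) (Y' : Ω → L →ₗ[K] L), (∀ v ∈ A', M.Kn s' v) →
      (∀ v ∈ B', M.Kn s' v) → (∀ p, M.Kn s' fun ω => Y' ω (T.bm h p)) →
      (∀ ω ∈ M.dom s', T.FLin h (Y' ω) ∧ A'.length ≤ D ω ∧ B'.length ≤ D ω ∧
        T.up h (T.rel (h + 1) (Y ω) (ev A ω) (ev B ω)) = T.rel h (Y' ω) (ev A' ω) (ev B' ω)) →
      M.Run s' c) :
    M.Run s fun ω => c ω + (D ω + 1) * (26 * 2 ^ h + 10 * m + 24) := by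
  have main : M.Run s fun ω => ((c ω + ((2 ^ h + D ω) * (4 * min (D ω) (2 ^ h) + 3) +
      D ω * (5 * 2 ^ h + 5 * m + 5))) + 2 * (2 ^ h * (2 * D ω + 1))) +
      D ω * (9 * 2 ^ h + 5 * m + 16) := by
    refine run_descend hm D hB (fun ω hω => (hyp ω hω).2.2.1) fun s₁ h₁ W R kW kR hWR hlen => ?_
    let Z : ((Fin h → Bool) × (Ω → L) × (Ω → L)) → Ω → L := fun a ω =>
      T.comp₁ h (Y ω) (T.bm h a.1)
    let Y' : Ω → L →ₗ[K] L := fun ω => T.comp₀ h (Y ω) -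
      (W.map fun a => LinearMap.mulLeft K (Z a ω) ∘ₗ T.dot h (a.2.2 ω)).sum
    let Q : Ω → L →ₗ[K] L := fun ω => T.comp₁ h (Y ω) -
      (W.map fun a => LinearMap.mulLeft K (Z a ω) ∘ₗ T.dot h (a.2.1 ω)).sum
    have hY' : ∀ ω x, Y' ω x = T.comp₀ h (Y ω) x -
        (W.map fun a => T.dot h (a.2.2 ω) x * Z a ω).sum := fun ω x => by
      simp [Y', list_sum_apply, mul_comm]
    have hQ : ∀ ω x, Q ω x = T.comp₁ h (Y ω) x -
        (W.map fun a => T.dot h (a.2.1 ω) x * Z a ω).sum := fun ω x => by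
      simp [Q, list_sum_apply, mul_comm]
    have hrun : M.Run s₁ fun ω => ((c ω + ((2 ^ h + A.length) * (4 * min (D ω) (2 ^ h) + 3) +
        D ω * (5 * 2 ^ h + 5 * m + 5))) + Fintype.card (Fin h → Bool) * (2 * W.length + 1)) +
        Fintype.card (Fin h → Bool) * (2 * W.length + 1) := by
      refine run_family (f := fun (p : Fin h → Bool) ω => Y' ω (T.bm h p)) (fun p => ?_)
        fun s₂ h₂ kY' => run_family (f := fun (p : Fin h → Bool) ω => Q ω (T.bm h p)) (fun p => ?_)
          fun s₃ h₃ kQ => ?_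
      · refine (((Kn.comp (M.kn_mono h₁ (hY₀ p))).sub (comp_list_sum W (n := 1)
          (f := fun a ω => T.coef h p (a.2.2 ω) * Z a ω) fun a ha =>
            (Kn.comp ((kW a ha).2.coef hm.le p)).mul
              (Kn.comp (M.kn_mono h₁ (hY₁ a.1))))).congr fun ω _ => ?_).le (by omega)
        simp only [hY', T.dot_bm hm.le]
      · refine (((Kn.comp (M.kn_mono (h₁.trans h₂) (hY₁ p))).sub (comp_list_sum W (n := 1)
          (f := fun a ω => T.coef h p (a.2.1 ω) * Z a ω) fun a ha =>
            (Kn.comp (M.kn_mono h₂ ((kW a ha).1.coef hm.le p))).mul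
              (Kn.comp (M.kn_mono (h₁.trans h₂) (hY₁ a.1))))).congr fun ω _ => ?_).le (by omega)
        simp only [hQ, T.dot_bm hm.le]
      · have h₁₃ := h₂.trans h₃
        have h₀₃ := h₁.trans h₁₃
        -- There are 2^h + |A| generators, but the defect bounds the dimension of their span by D,
        -- so the reduced list is short again.
        let l : List (Ω → L) := Finset.univ.toList.map (fun p ω => Q ω (T.bm h p)) ++ A
        have hev : ∀ ω, ev l ω = Finset.univ.toList.map (fun p => Q ω (T.bm h p)) ++ ev A ω :=
          fun ω => by simp [l, ev, List.map_map, Function.comp_def]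
        have key : ∀ ω ∈ M.dom s₃, ∀ A' : List L, T.vspan h A' = T.vspan h (ev l ω) →
            T.up h (T.rel (h + 1) (Y ω) (ev A ω) (ev B ω)) = T.rel h (Y' ω) A' (ev R ω) := by
          intro ω hω A' hA'
          obtain ⟨hred, hspan⟩ := hWR ω (M.dom_anti h₁₃ hω)
          refine up_rel hm (hyp ω (M.dom_anti h₀₃ hω)).1 hred hspan (Q := Q ω)
            (fun x => ?_) (fun x => ?_) (by rw [hA', hev])
          · rw [hY']; simp [evRows, List.map_map, Function.comp_def, Z]
          · rw [hQ]; simp [evRows, List.map_map, Function.comp_def, Z]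
        have hlen' : l.length = 2 ^ h + A.length := by simp [l]
        have := run_reduce hm.le D l (s := s₃) (c := c) (fun v hv => ?_) (fun ω hω => ?_)
          fun s₄ h₄ V kV hV => hc s₄ (h₀₃.trans h₄) V R Y' kV
            (fun v hv => M.kn_mono (h₁₃.trans h₄) (kR v hv))
            (fun p => M.kn_mono (h₃.trans h₄) (kY' p)) fun ω hω => ⟨fun e he x => ?_, (hV ω hω).2, ?_,
              key ω (M.dom_anti h₄ hω) _ (hV ω hω).1⟩
        · rwa [hlen'] at this
        · rcases List.mem_append.1 hv with hv | hv
          · obtain ⟨p, -, rfl⟩ := List.mem_map.1 hv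
            exact kQ p
          · exact M.kn_mono h₀₃ (hA v hv)
        · have h5 := (hyp ω (M.dom_anti h₀₃ hω)).2.2.2
          rw [key ω hω _ rfl] at h5
          exact (finrank_span_le_of_defect_le hm.le h5).1
        · rw [hY', hY', (hyp ω (M.dom_anti (h₀₃.trans h₄) hω)).1.comp₀ hm e he, mul_sub,
            ← List.sum_map_mul_left]
          simp only [T.dot_mul he, mul_assoc]
        · have := (hyp ω (M.dom_anti (h₀₃.trans h₄) hω)).2.2.1
          omega
    refine M.run_mono hrun fun ω hω => ?_
    obtain ⟨-, h5, h6, -⟩ := hyp ω (M.dom_anti h₁ hω)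
    have h7 : 2 ^ h * (2 * W.length + 1) ≤ 2 ^ h * (2 * D ω + 1) := Nat.mul_le_mul_left _ (by omega)
    have h8 : (2 ^ h + A.length) * (4 * min (D ω) (2 ^ h) + 3) ≤
      (2 ^ h + D ω) * (4 * min (D ω) (2 ^ h) + 3) := Nat.mul_le_mul_right _ (by omega)
    simp only [Fintype.card_fun, Fintype.card_bool, Fintype.card_fin]
    omega
  refine M.run_mono main fun ω _ => ?_
  have h1 : 2 ^ h * (4 * min (D ω) (2 ^ h) + 3) ≤ 2 ^ h * (4 * D ω + 3) :=
    Nat.mul_le_mul_left _ (by omega)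
  have h2 : D ω * (4 * min (D ω) (2 ^ h) + 3) ≤ D ω * (4 * 2 ^ h + 3) :=
    Nat.mul_le_mul_left _ (by omega)
  rw [add_mul]
  generalize 2 ^ h * (4 * min (D ω) (2 ^ h) + 3) = x at *
  generalize D ω * (4 * min (D ω) (2 ^ h) + 3) = y at *
  generalize 2 ^ h = z at *
  nlinarith

theorem run_down {h : ℕ} (hm : h < m) (D : Ω → ℕ) {c : Ω → ℕ} {s : M.St} {A B : List (Ω → L)}
    {Y : Ω → L →ₗ[K] L} {f : Ω → L} (hA : ∀ v ∈ A, M.Kn s v) (hB : ∀ v ∈ B, M.Kn s v)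
    (hY₁ : ∀ p, M.Kn s fun ω => T.comp₁ h (Y ω) (T.bm h p))
    (hY₀ : ∀ p, M.Kn s fun ω => T.comp₀ h (Y ω) (T.bm h p))
    (hyp : ∀ ω ∈ M.dom s, T.FLin (h + 1) (Y ω) ∧ A.length ≤ D ω ∧ B.length ≤ D ω ∧
      defect m (f ω) (T.down h (T.rel (h + 1) (Y ω) (ev A ω) (ev B ω))) ≤ 2 ^ (m - h) * D ω)
    (hc : ∀ s', s ≤ s' → ∀ (A' B' : List (Ω → L)) (Y' : Ω → L →ₗ[K] L), (∀ v ∈ A', M.Kn s' v) →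
      (∀ v ∈ B', M.Kn s' v) → (∀ p, M.Kn s' fun ω => Y' ω (T.bm h p)) →
      (∀ ω ∈ M.dom s', T.FLin h (Y' ω) ∧ A'.length ≤ D ω ∧ B'.length ≤ D ω ∧
        T.down h (T.rel (h + 1) (Y ω) (ev A ω) (ev B ω)) = T.rel h (Y' ω) (ev A' ω) (ev B' ω)) →
      M.Run s' c) :
    M.Run s fun ω => c ω + (D ω + 1) * (26 * 2 ^ h + 10 * m + 27) := by
  have main : M.Run s fun ω => ((((c ω + ((2 ^ h + D ω) * (4 * min (D ω) (2 ^ h) + 3) +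
      D ω * (5 * 2 ^ h + 5 * m + 5))) + (2 * (2 ^ h * (2 * D ω + 1)) + 2 ^ h * 3 + D ω * 8)) +
      (D ω * (4 * min (D ω) (2 ^ h) + 3) + D ω * (5 * 2 ^ h + 5 * m + 5)))) + A.length * 3 := by
    refine run_list A (f := fun a ω => T.θ h (a ω)) (fun a ha => (hA a ha).comp_θ hm)
      fun s₁ h₁ kθ => ?_
    have hev : ∀ ω, evPairs (A.map fun a => (fun ω => T.θ h (a ω), a)) ω =
        (ev A ω).map fun a => (T.θ h a, a) := fun ω => by
      simp [evPairs, ev, List.map_map, Function.comp_def]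
    have helim := run_elim hm.le D (A.map fun a => (fun ω => T.θ h (a ω), a)) s₁
      (c := fun ω => ((c ω + ((2 ^ h + D ω) * (4 * min (D ω) (2 ^ h) + 3) +
      D ω * (5 * 2 ^ h + 5 * m + 5))) + (2 * (2 ^ h * (2 * D ω + 1)) + 2 ^ h * 3 + D ω * 8)))
      (fun a ha => ?_) (fun ω hω => (finrank_fst_rowSpan_le _).trans
        (by simpa [evPairs] using (hyp ω (M.dom_anti h₁ hω)).2.1)) ?_
    · refine M.run_mono helim fun ω hω => ?_
      have h5 := (hyp ω (M.dom_anti h₁ hω)).2.1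
      have h6 : A.length * (4 * min (D ω) (2 ^ h) + 3) ≤ D ω * (4 * min (D ω) (2 ^ h) + 3) :=
        Nat.mul_le_mul_right _ h5
      simp only [List.length_map]
      omega
    · obtain ⟨v, hv, rfl⟩ := List.mem_map.1 ha
      exact ⟨kθ v hv, M.kn_mono h₁ (hA v hv)⟩
    intro s₂ h₂ W R kW kR hWR hlen
    rw [List.length_map] at hlen
    have h₀₂ := h₁.trans h₂
    let Q : Ω → L →ₗ[K] L := fun ω =>
      (T.θ h).toLinearMap ∘ₗ T.comp₁ h (Y ω) ∘ₗ (T.θ h).toLinearMap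
    have hQ : ∀ ω x, Q ω x = T.θ h (T.comp₁ h (Y ω) (T.θ h x)) := fun ω x => rfl
    let Y' : Ω → L →ₗ[K] L := fun ω => T.comp₀ h (Y ω) -
      (W.map fun a => LinearMap.mulLeft K (a.2.2 ω) ∘ₗ T.coef h a.1 ∘ₗ Q ω).sum
    let Q' : Ω → L →ₗ[K] L := fun ω => Q ω -
      (W.map fun a => LinearMap.mulLeft K (a.2.1 ω) ∘ₗ T.coef h a.1 ∘ₗ Q ω).sum
    have hY' : ∀ ω x, Y' ω x = T.comp₀ h (Y ω) x -
        (W.map fun a => T.coef h a.1 (Q ω x) * a.2.2 ω).sum := fun ω x => by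
      simp [Y', list_sum_apply, mul_comm]
    have hQ' : ∀ ω x, Q' ω x = Q ω x -
        (W.map fun a => T.coef h a.1 (Q ω x) * a.2.1 ω).sum := fun ω x => by
      simp [Q', list_sum_apply, mul_comm]
    have hQl : ∀ ω ∈ M.dom s, T.FLin h (Q ω) := fun ω hω e he x => by
      rw [hQ, hQ, map_mul, (hyp ω hω).1.comp₁ hm _ (T.θ_mem he h), map_mul, T.invol]
    have hQl' : ∀ ω ∈ M.dom s, T.FLin h (Q' ω) := fun ω hω e he x => by
      rw [hQ', hQ', hQl ω hω e he, mul_sub, ← List.sum_map_mul_left]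
      simp only [T.coef_mul he, mul_assoc]
    have hrun : M.Run s₂ fun ω => ((((c ω + ((2 ^ h + B.length) * (4 * min (D ω) (2 ^ h) + 3) +
        D ω * (5 * 2 ^ h + 5 * m + 5))) + B.length * 8) +
        Fintype.card (Fin h → Bool) * (2 * W.length + 1)) +
        Fintype.card (Fin h → Bool) * (2 * W.length + 1)) + Fintype.card (Fin h → Bool) * 3 := by
      refine run_family (f := fun (p : Fin h → Bool) ω => Q ω (T.bm h p)) (fun p => ?_)
        fun s₃ h₃ kQ =>
        run_family (f := fun (p : Fin h → Bool) ω => Y' ω (T.bm h p)) (fun p => ?_)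
        fun s₄ h₄ kY' => run_family (f := fun (p : Fin h → Bool) ω => Q' ω (T.bm h p)) (fun p => ?_)
        fun s₅ h₅ kQ' => run_vecPairs hm (fun v hv => M.kn_mono
          (h₀₂.trans (h₃.trans (h₄.trans h₅))) (hB v hv)) fun s₆ h₆ kv => ?_
      · refine ((M.kn_mono h₀₂ (hY₁ p)).comp_θ hm).congr fun ω _ => ?_
        rw [hQ, T.θ_bm le_rfl]
      · refine (((Kn.comp (M.kn_mono (h₀₂.trans h₃) (hY₀ p))).sub (comp_list_sum W (n := 1)
          (f := fun a ω => T.coef h a.1 (Q ω (T.bm h p)) * a.2.2 ω) fun a ha =>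
            (Kn.comp ((kQ p).coef hm.le a.1)).mul
              (Kn.comp (M.kn_mono h₃ (kW a ha).2)))).congr fun ω _ => ?_).le (by omega)
        simp only [hY']
      · refine (((Kn.comp (M.kn_mono h₄ (kQ p))).sub (comp_list_sum W (n := 1)
          (f := fun a ω => T.coef h a.1 (Q ω (T.bm h p)) * a.2.1 ω) fun a ha =>
            (Kn.comp (M.kn_mono h₄ ((kQ p).coef hm.le a.1))).mul
              (Kn.comp (M.kn_mono (h₃.trans h₄) (kW a ha).1)))).congr fun ω _ => ?_).le (by omega)
        simp only [hQ']
      · have h₂₆ := h₃.trans (h₄.trans (h₅.trans h₆))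
        have h₀₆ := h₀₂.trans h₂₆
        -- The condition Q'(z) = 0 is expressed by orthogonality to the rows of the matrix of Q',
        -- which are available for free by transposition.
        let l : List (Ω → L) := Finset.univ.toList.map (fun p ω =>
          ∑ q, T.coef h p (Q' ω (T.bm h q)) * T.bm h q) ++ B.map fun v ω => T.θ h (T.vec₁ h (v ω))
        have key : ∀ ω ∈ M.dom s₆, ∀ B' : List L, T.vspan h B' = T.vspan h (ev l ω) →
            T.down h (T.rel (h + 1) (Y ω) (ev A ω) (ev B ω)) = T.rel h (Y' ω) (ev R ω) B' := by
          intro ω hω B' hB'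
          obtain ⟨hred, hspan, -⟩ := hWR ω (M.dom_anti h₂₆ hω)
          rw [hev] at hspan
          have hω₀ := M.dom_anti h₀₆ hω
          refine down_rel hm (hyp ω hω₀).1 hred hspan (fun x => ?_) fun z => ?_
          · rw [hY']; simp [evRows, List.map_map, Function.comp_def, hQ]
          · rw [perp_eq_of_vspan_eq hB']
            have e1 : (∀ v ∈ ev l ω, T.dot h v z = 0) ↔ (∀ p, T.coef h p (Q' ω z) = 0) ∧
                ∀ v ∈ ev B ω, T.dot h (T.θ h (T.vec₁ h v)) z = 0 := by
              have e2 : ev l ω = Finset.univ.toList.map (fun p =>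
                  ∑ q, T.coef h p (Q' ω (T.bm h q)) * T.bm h q) ++
                  (ev B ω).map fun v => T.θ h (T.vec₁ h v) := by
                simp [l, ev, List.map_map, Function.comp_def]
              rw [e2]
              simp only [List.forall_mem_append, List.forall_mem_map, Finset.mem_toList,
                Finset.mem_univ, forall_const, dot_row hm.le (hQl' ω hω₀)]
            rw [e1, and_comm]
            refine and_congr Iff.rfl ?_
            have e3 : T.θ h (T.comp₁ h (Y ω) (T.θ h z)) - ((evRows W ω).map fun a =>
                T.coef h a.1 (T.θ h (T.comp₁ h (Y ω) (T.θ h z))) * a.2.1).sum = Q' ω z := by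
              rw [hQ']; simp [evRows, List.map_map, Function.comp_def, hQ]
            rw [e3]
            exact ⟨fun H => T.ext_coef (h := h) fun p => by rw [H p, map_zero],
              fun H p => by rw [H, map_zero]⟩
        have hlen' : l.length = 2 ^ h + B.length := by simp [l]
        have := run_reduce hm.le D l (s := s₆) (c := c) (fun v hv => ?_) (fun ω hω => ?_)
          fun s₇ h₇ V kV hV => hc s₇ (h₀₆.trans h₇) R V Y'
            (fun v hv => M.kn_mono (h₂₆.trans h₇) (kR v hv)) kV
            (fun p => M.kn_mono (h₅.trans (h₆.trans h₇)) (kY' p))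
            fun ω hω => ⟨fun e he x => ?_, ?_, (hV ω hω).2,
              key ω (M.dom_anti h₇ hω) _ (hV ω hω).1⟩
        · rwa [hlen'] at this
        · rcases List.mem_append.1 hv with hv | hv
          · obtain ⟨p, -, rfl⟩ := List.mem_map.1 hv
            exact M.kn_transpose hm.le (fun q => M.kn_mono h₆ (kQ' q)) p
          · obtain ⟨b, hb, rfl⟩ := List.mem_map.1 hv
            exact (kv b hb).2
        · have h5 := (hyp ω (M.dom_anti h₀₆ hω)).2.2.2
          rw [key ω hω _ rfl] at h5
          exact (finrank_span_le_of_defect_le hm.le h5).2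
        · have hω₀ := M.dom_anti (h₀₆.trans h₇) hω
          rw [hY', hY', (hyp ω hω₀).1.comp₀ hm e he, mul_sub, ← List.sum_map_mul_left,
            hQl ω hω₀ e he]
          simp only [T.coef_mul he, mul_assoc]
        · have := (hyp ω (M.dom_anti (h₀₆.trans h₇) hω)).2.1
          omega
    refine M.run_mono hrun fun ω hω => ?_
    obtain ⟨-, h5, h6, -⟩ := hyp ω (M.dom_anti h₀₂ hω)
    have h7 : 2 ^ h * (2 * W.length + 1) ≤ 2 ^ h * (2 * D ω + 1) := Nat.mul_le_mul_left _ (by omega)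
    have h8 : (2 ^ h + B.length) * (4 * min (D ω) (2 ^ h) + 3) ≤
      (2 ^ h + D ω) * (4 * min (D ω) (2 ^ h) + 3) := Nat.mul_le_mul_right _ (by omega)
    simp only [Fintype.card_fun, Fintype.card_bool, Fintype.card_fin]
    omega
  refine M.run_mono main fun ω hω => ?_
  have h0 := (hyp ω hω).2.1
  have h1 : 2 ^ h * (4 * min (D ω) (2 ^ h) + 3) ≤ 2 ^ h * (4 * D ω + 3) :=
    Nat.mul_le_mul_left _ (by omega)
  have h2 : D ω * (4 * min (D ω) (2 ^ h) + 3) ≤ D ω * (4 * 2 ^ h + 3) :=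
    Nat.mul_le_mul_left _ (by omega)
  rw [add_mul]
  generalize 2 ^ h * (4 * min (D ω) (2 ^ h) + 3) = x at *
  generalize D ω * (4 * min (D ω) (2 ^ h) + 3) = y at *
  generalize 2 ^ h = z at *
  nlinarith

end LMachine

/-! ### Majority vote and decoding of order zero -/

namespace LMachine

open QuadTower Module

variable {K : Type u} {L : Type v} [Field K] [Field L] [Algebra K L] {m : ℕ}
  {T : QuadTower K L m} {Ω : Type w} {M : LMachine T Ω}

lemma run_all_zero {s : M.St} (l : List (Ω → L)) (hl : ∀ v ∈ l, M.Kn s v) {c : Ω → ℕ}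
    (hz : ∀ s', s ≤ s' → (∀ ω ∈ M.dom s', ∀ v ∈ l, v ω = 0) → M.Run s' c)
    (hn : ∀ s', s ≤ s' → (∀ ω ∈ M.dom s', ∃ v ∈ l, v ω ≠ 0) → M.Run s' c) :
    M.Run s fun ω => c ω + l.length := by
  induction l generalizing s with
  | nil => exact M.run_mono (hz s le_rfl (by simp)) fun ω _ => by simp
  | cons v l ih =>
    have h1 := M.run_test (c := fun ω => c ω + l.length) (hl v (by simp))
      (fun s₁ h₁ e₁ => ih (fun u hu => M.kn_mono h₁ (hl u (by simp [hu])))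
        (fun s₂ h₂ e₂ => hz s₂ (h₁.trans h₂) fun ω hω u hu => by
          rcases List.mem_cons.1 hu with rfl | hu
          · exact e₁ ω (M.dom_anti h₂ hω)
          · exact e₂ ω hω u hu)
        fun s₂ h₂ e₂ => hn s₂ (h₁.trans h₂) fun ω hω => by
          obtain ⟨u, hu, h0⟩ := e₂ ω hω
          exact ⟨u, by simp [hu], h0⟩)
      fun s₁ h₁ e₁ => M.run_mono (hn s₁ h₁ fun ω hω => ⟨v, by simp, e₁ ω hω⟩)
        fun ω _ => by omega
    exact M.run_mono h1 fun ω _ => by rw [List.length_cons]; omega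

open Classical in
/-- The score of `f` for a candidate `g` of weight `n`. -/
noncomputable def score (f g : L) (n : ℕ) : ℤ := if f = g then n else -n

lemma score_self (f : L) (n : ℕ) : score f f n = n := if_pos rfl

lemma score_of_ne {f g : L} (h : f ≠ g) (n : ℕ) : score f g n = -n := if_neg h

lemma score_add (f g : L) (n k : ℕ) : score f g n + score f g k = score f g (n + k) := by
  unfold score
  split_ifs <;> push_cast <;> ring

/-- Votes for different candidates cancel. This is exact if f is one of them, and otherwise only
raises the bound on a negative score. -/
lemma score_add_le {g₁ g₂ : L} (hg : g₁ ≠ g₂) (f : L) {n k : ℕ} (hk : k ≤ n) :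
    score f g₁ n + score f g₂ k ≤ score f g₁ (n - k) := by
  by_cases h1 : f = g₁
  · subst h1
    rw [score_self, score_self, score_of_ne hg]
    omega
  · rw [score_of_ne h1, score_of_ne h1]
    by_cases h2 : f = g₂
    · subst h2
      rw [score_self]
      omega
    · rw [score_of_ne h2]
      omega

/-- The cost of decoding multiples of the identity. -/
def baseCost (m D : ℕ) : ℕ → ℕ
  | 0 => 2 * D
  | h + 1 => 2 * baseCost m D h + (D + 1) * (58 * 2 ^ h + (20 * m + 53))

lemma baseCost_le (m D h : ℕ) :
    baseCost m D h + (D + 1) * (20 * m + 53) ≤ (D + 1) * (2 ^ h * (29 * h + (20 * m + 55))) := by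
  induction h with
  | zero => rw [baseCost]; nlinarith
  | succ h ih =>
    rw [baseCost, pow_succ]
    calc _ = 2 * (baseCost m D h + (D + 1) * (20 * m + 53)) + (D + 1) * (58 * 2 ^ h) := by ring
      _ ≤ 2 * ((D + 1) * (2 ^ h * (29 * h + (20 * m + 55)))) + (D + 1) * (58 * 2 ^ h) := by gcongr
      _ = _ := by ring

/-- The run delivers a candidate g with a surplus n of votes such that the score of the unknown f is
at least the scaled difference of 2^m and the defect. The number n depends only on the node of the
tree, so that counting votes is free. -/
theorem run_base (D : Ω → ℕ) (f : Ω → L) (h : ℕ) (hm : h ≤ m) {c : Ω → ℕ} {s : M.St}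
    {A B : List (Ω → L)} {Y : Ω → L →ₗ[K] L} (hA : ∀ v ∈ A, M.Kn s v) (hB : ∀ v ∈ B, M.Kn s v)
    (hY : ∀ p, M.Kn s fun ω => Y ω (T.bm h p))
    (hyp : ∀ ω ∈ M.dom s, T.FLin h (Y ω) ∧ A.length ≤ D ω ∧ B.length ≤ D ω ∧
      defect m (f ω) (T.rel h (Y ω) (ev A ω) (ev B ω)) ≤ 2 ^ (m - h) * D ω)
    (hc : ∀ s', s ≤ s' → ∀ (g : Ω → L) (n : ℕ), M.Kn s' g → (∀ ω ∈ M.dom s',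
      2 ^ m - defect m (f ω) (T.rel h (Y ω) (ev A ω) (ev B ω)) ≤
        2 ^ (m - h) * score (f ω) (g ω) n) → M.Run s' c) :
    M.Run s fun ω => c ω + baseCost m (D ω) h := by
  have hfin := T.finiteDimensional
  induction h generalizing s c A B Y with
  | zero =>
    have h1 := run_all_zero (A ++ B) (s := s) (c := c)
      (fun v hv => (List.mem_append.1 hv).elim (hA v) (hB v))
      (fun s₁ h₁ e₁ => hc s₁ h₁ (fun ω => Y ω 1) 1 ?_ fun ω hω => ?_)
      fun s₁ h₁ e₁ => hc s₁ h₁ (fun _ => 0) 0 (M.kn_zero _) fun ω hω => ?_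
    · refine M.run_mono h1 fun ω hω => ?_
      obtain ⟨-, h2, h3, -⟩ := hyp ω hω
      rw [baseCost, List.length_append]
      omega
    · exact M.kn_congr (M.kn_mono h₁ (hY fun _ => false)) fun ω _ => by simp [bm]
    -- A leaf without vectors votes for Y(1) with weight one. The defect is nonnegative if f is this
    -- slope, and 2 · 2^m if not.
    · rw [Nat.sub_zero]
      by_cases hf : f ω = Y ω 1
      · have := T.defect_nonneg (f ω) (T.rel 0 (Y ω) (ev A ω) (ev B ω))
        rw [hf] at this ⊢
        rw [score_self]
        push_cast
        linarith
      · rw [score_of_ne hf, defect_leaf_of_eq (hyp ω (M.dom_anti h₁ hω)).1 _ _ hf]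
        · push_cast
          linarith
        · intro v hv
          obtain ⟨a, ha, rfl⟩ := List.mem_map.1 hv
          exact e₁ ω hω a (by simp [ha])
        · intro v hv
          obtain ⟨a, ha, rfl⟩ := List.mem_map.1 hv
          exact e₁ ω hω a (by simp [ha])
    -- The leaf abstains with weight 0; its defect is at least 2^m.
    · have : 2 ^ m ≤ defect m (f ω) (T.rel 0 (Y ω) (ev A ω) (ev B ω)) := by
        refine defect_leaf_of_ne (f ω) ?_
        obtain ⟨v, hv, hv0⟩ := e₁ ω hω
        refine ⟨v ω, (List.mem_append.1 hv).imp ?_ ?_, hv0⟩ <;>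
          exact fun hv => List.mem_map.2 ⟨v, hv, rfl⟩
      have h0 : score (f ω) 0 0 = 0 := by unfold score; simp
      rw [h0]
      linarith
  | succ h ih =>
    have hlt : h < m := hm
    let X : Ω → Submodule K (L × L) := fun ω => T.rel (h + 1) (Y ω) (ev A ω) (ev B ω)
    have hpow : ∀ x : ℤ, 2 ^ (m - h) * x = 2 * (2 ^ (m - (h + 1)) * x) := fun x => by
      rw [show m - h = m - (h + 1) + 1 by omega, pow_succ]
      ring
    -- Since neither new defect is negative, each is at most twice the old one. The factor 2 is
    -- absorbed in the scale 2^{m-h}, so the same D serves all levels.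
    have hdef : ∀ ω ∈ M.dom s, defect m (f ω) (T.up h (X ω)) ≤ 2 ^ (m - h) * D ω ∧
        defect m (f ω) (T.down h (X ω)) ≤ 2 ^ (m - h) * D ω := fun ω hω => by
      have h1 := defect_up_add_defect_down (T := T) hfin hlt (f ω) (X ω)
      have h2 := T.defect_nonneg (f ω) (T.up h (X ω))
      have h3 := T.defect_nonneg (f ω) (T.down h (X ω))
      have h4 := (hyp ω hω).2.2.2
      rw [hpow]
      constructor <;> linarith
    have main : M.Run s fun ω => (((((c ω + 1 + 1) + baseCost m (D ω) h) +
        (D ω + 1) * (26 * 2 ^ h + 10 * m + 27)) + baseCost m (D ω) h) +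
        (D ω + 1) * (26 * 2 ^ h + 10 * m + 24)) + 6 * 2 ^ h := by
      refine run_components hY fun s₁ h₁ k₁ k₀ => ?_
      refine run_up hlt D (f := f) (fun v hv => M.kn_mono h₁ (hA v hv))
        (fun v hv => M.kn_mono h₁ (hB v hv)) k₁ k₀ (fun ω hω => ?_)
        fun s₂ h₂ A₁ B₁ Y₁ kA₁ kB₁ kY₁ hu => ?_
      · have hω₀ := M.dom_anti h₁ hω
        exact ⟨(hyp ω hω₀).1, (hyp ω hω₀).2.1, (hyp ω hω₀).2.2.1, (hdef ω hω₀).1⟩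
      have h₀₂ := h₁.trans h₂
      refine ih hlt.le kA₁ kB₁ kY₁ (fun ω hω => ?_) fun s₃ h₃ g₁ n₁ kg₁ hg₁ => ?_
      · obtain ⟨e1, e2, e3, e4⟩ := hu ω hω
        exact ⟨e1, e2, e3, e4 ▸ (hdef ω (M.dom_anti h₀₂ hω)).1⟩
      have h₁₃ := h₂.trans h₃
      have h₀₃ := h₁.trans h₁₃
      refine run_down hlt D (f := f) (fun v hv => M.kn_mono h₀₃ (hA v hv))
        (fun v hv => M.kn_mono h₀₃ (hB v hv)) (fun p => M.kn_mono h₁₃ (k₁ p))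
        (fun p => M.kn_mono h₁₃ (k₀ p)) (fun ω hω => ?_)
        fun s₄ h₄ A₂ B₂ Y₂ kA₂ kB₂ kY₂ hd => ?_
      · have hω₀ := M.dom_anti h₀₃ hω
        exact ⟨(hyp ω hω₀).1, (hyp ω hω₀).2.1, (hyp ω hω₀).2.2.1, (hdef ω hω₀).2⟩
      have h₀₄ := h₀₃.trans h₄
      refine ih hlt.le kA₂ kB₂ kY₂ (fun ω hω => ?_) fun s₅ h₅ g₂ n₂ kg₂ hg₂ => ?_
      · obtain ⟨e1, e2, e3, e4⟩ := hd ω hω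
        exact ⟨e1, e2, e3, e4 ▸ (hdef ω (M.dom_anti h₀₄ hω)).2⟩
      have h₃₅ := h₄.trans h₅
      have kg₁' := M.kn_mono h₃₅ kg₁
      have hsum : ∀ ω ∈ M.dom s₅, 2 ^ m - defect m (f ω) (X ω) ≤ 2 ^ (m - (h + 1)) *
          (score (f ω) (g₁ ω) n₁ + score (f ω) (g₂ ω) n₂) := fun ω hω => by
        have e1 := hg₁ ω (M.dom_anti h₃₅ hω)
        have e2 := hg₂ ω hω
        rw [← (hu ω (M.dom_anti (h₃.trans h₃₅) hω)).2.2.2, hpow] at e1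
        rw [← (hd ω (M.dom_anti h₅ hω)).2.2.2, hpow] at e2
        have e3 := defect_up_add_defect_down (T := T) hfin hlt (f ω) (X ω)
        simp only [X] at e3 ⊢
        linarith
      refine M.run_sub kg₁' kg₂ fun s₆ h₆ k₆ => M.run_test k₆ (fun s₇ h₇ e₇ => ?_) fun s₇ h₇ e₇ => ?_
      · have h₅₇ := h₆.trans h₇
        refine hc s₇ (h₀₃.trans (h₃₅.trans h₅₇)) g₁ (n₁ + n₂) (M.kn_mono h₅₇ kg₁') fun ω hω => ?_
        have e1 := hsum ω (M.dom_anti h₅₇ hω)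
        rwa [← sub_eq_zero.1 (e₇ ω hω), score_add] at e1
      · have h₅₇ := h₆.trans h₇
        rcases le_total n₂ n₁ with hn | hn
        · refine hc s₇ (h₀₃.trans (h₃₅.trans h₅₇)) g₁ (n₁ - n₂) (M.kn_mono h₅₇ kg₁') fun ω hω => ?_
          refine (hsum ω (M.dom_anti h₅₇ hω)).trans ?_
          gcongr
          exact score_add_le (sub_ne_zero.1 (e₇ ω hω)) _ hn
        · refine hc s₇ (h₀₃.trans (h₃₅.trans h₅₇)) g₂ (n₂ - n₁) (M.kn_mono h₅₇ kg₂) fun ω hω => ?_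
          refine (hsum ω (M.dom_anti h₅₇ hω)).trans ?_
          gcongr
          rw [add_comm]
          exact score_add_le (sub_ne_zero.1 (e₇ ω hω)).symm _ hn
    refine M.run_mono main fun ω _ => ?_
    rw [baseCost]
    generalize 2 ^ h = z
    nlinarith [Nat.zero_le (D ω * z)]

/-- Decoding of multiples of the identity, for errors of small rank. -/
theorem run_base_decode (t : Ω → ℕ) {h : ℕ} (hm : h ≤ m) {c : Ω → ℕ} {s : M.St}
    {Y N : Ω → L →ₗ[K] L} (hY : ∀ p, M.Kn s fun ω => Y ω (T.bm h p))
    (hyp : ∀ ω ∈ M.dom s, T.RM h 0 (N ω) ∧ T.FLin h (Y ω) ∧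
      finrank K (Y ω - N ω).range = 2 ^ (m - h) * t ω ∧ 2 * t ω < 2 ^ h)
    (hc : ∀ s', s ≤ s' → (∀ p, M.Kn s' fun ω => N ω (T.bm h p)) → M.Run s' c) :
    M.Run s fun ω => c ω + (baseCost m (2 * t ω) h + 2 * 2 ^ h) := by
  have hfin := T.finiteDimensional
  have hN : ∀ ω ∈ M.dom s, ∀ x, N ω x = N ω 1 * x := fun ω hω x => by
    obtain ⟨g, hg⟩ := (T.RM_zero_right).1 (hyp ω hω).1
    rw [hg, hg, mul_one]
  -- With empty lists the relation is the graph of Y, of dimension 2^m, and its residual image is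
  -- the range of the error.
  have hdef : ∀ ω ∈ M.dom s, defect m (N ω 1) (T.rel h (Y ω) (ev [] ω) (ev [] ω)) =
      2 ^ (m - h) * ((2 * t ω : ℕ) : ℤ) := fun ω hω => by
    have e1 := finrank_rel (T := T) hm (Y ω) (ev [] ω) (ev [] ω)
    have e2 : (T.rel h (Y ω) (ev [] ω) (ev [] ω)).map (residual K (N ω 1)) =
        (Y ω - N ω).range := by
      have e3 : T.vspan h (ev ([] : List (Ω → L)) ω) = ⊥ := by
        refine le_bot_iff.1 ((vspan_le fun c _ x hx => ?_).2 (by simp [ev]))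
        rw [Submodule.mem_bot] at hx ⊢
        rw [hx, smul_zero]
      ext y
      constructor
      · rintro ⟨d, hd, rfl⟩
        have hd2 := hd.2
        rw [e3, Submodule.mem_bot] at hd2
        refine ⟨d.1, ?_⟩
        rw [LinearMap.sub_apply, residual_apply, sub_eq_zero.1 hd2, hN ω hω d.1]
      · rintro ⟨z, rfl⟩
        refine ⟨(z, Y ω z), ⟨by simp [ev], by simp⟩, ?_⟩
        rw [LinearMap.sub_apply, residual_apply, hN ω hω z]
    rw [defect, e2, (hyp ω hω).2.2.1]
    have e4 : finrank K (T.rel h (Y ω) (ev [] ω) (ev [] ω)) = 2 ^ m := by omega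
    rw [e4]
    push_cast
    ring
  have main : M.Run s fun ω => (c ω + Fintype.card (Fin h → Bool) * 2) +
      baseCost m (2 * t ω) h := by
    refine run_base (fun ω => 2 * t ω) (fun ω => N ω 1) h hm (A := []) (B := []) (by simp) (by simp)
      hY (fun ω hω => ⟨(hyp ω hω).2.1, by simp, by simp, (hdef ω hω).le⟩)
      fun s₁ h₁ g n kg hg => ?_
    refine run_family (f := fun p ω => N ω (T.bm h p)) (fun p => ?_)
      fun s₂ h₂ k₂ => hc s₂ (h₁.trans h₂) k₂
    refine ((Kn.comp kg).mul (comp_const s₁ (T.bm h p))).congr fun ω hω => ?_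
    have hω₀ := M.dom_anti h₁ hω
    have e1 := hg ω hω
    rw [hdef ω hω₀] at e1
    have e2 : (2 : ℤ) ^ m = 2 ^ (m - h) * 2 ^ h := by rw [← pow_add, Nat.sub_add_cancel hm]
    rw [e2, ← mul_sub] at e1
    have e3 := le_of_mul_le_mul_left e1 (by positivity)
    have e4 : ((2 * t ω : ℕ) : ℤ) < 2 ^ h := by exact_mod_cast (hyp ω hω₀).2.2.2
    -- The score is at least 2^h - 2t > 0, which a wrong candidate cannot have.
    have e5 : N ω 1 = g ω := by
      by_contra hne
      rw [score_of_ne hne] at e3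
      omega
    rw [← e5, ← hN ω hω₀]
  refine M.run_mono main fun ω _ => ?_
  simp only [Fintype.card_fun, Fintype.card_bool, Fintype.card_fin]
  omega

end LMachine

/-! ### Decoding of Reed–Muller maps -/

namespace QuadTower

open Module

variable {K : Type u} {L : Type v} [Field K] [Field L] [Algebra K L] {m : ℕ} {T : QuadTower K L m}

variable (T) in
/-- The iterated components `comp₁` of depth at most `r` have rank `t`. -/
def RankChain (t : ℕ) : ℕ → ℕ → (L →ₗ[K] L) → Prop
  | 0, h, E => finrank K E.range = 2 ^ (m - h) * t
  | _ + 1, 0, E => finrank K E.range = 2 ^ m * t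
  | r + 1, h + 1, E => finrank K E.range = 2 ^ (m - (h + 1)) * t ∧ RankChain t r h (T.comp₁ h E)

lemma RankChain.finrank_range {t r h : ℕ} {E : L →ₗ[K] L} (hE : T.RankChain t r h E) :
    finrank K E.range = 2 ^ (m - h) * t := by
  match r, h, hE with
  | 0, _, hE => exact hE
  | _ + 1, 0, hE => exact hE
  | _ + 1, _ + 1, hE => exact hE.1

/-- A map of which the component `comp₁` has maximal rank vanishes on the conjugate of the kernel
of this component. -/
lemma comp₀_eq_zero_of_comp₁ {h t : ℕ} (hm : h < m) {E : L →ₗ[K] L}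
    (h0 : finrank K E.range = 2 ^ (m - (h + 1)) * t)
    (h1 : finrank K (T.comp₁ h E).range = 2 ^ (m - h) * t) {x : L}
    (hx : T.comp₁ h E (T.θ h x) = 0) : T.comp₀ h E x = 0 := by
  have hfin := T.finiteDimensional
  let G := T.comp₁ h E ∘ₗ (T.θ h).toLinearMap
  have e1 := LinearMap.finrank_range_add_finrank_ker E
  have e2 := LinearMap.finrank_range_add_finrank_ker G
  have e3 := finrank_up_add_down (T := T) hm E.ker
  have e4 := Submodule.finrank_le (T.up h E.ker)
  have e5 : G.range = (T.comp₁ h E).range :=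
    LinearMap.range_comp_of_range_eq_top _ (LinearMap.range_eq_top.2 (T.θ h).surjective)
  have e6 : 2 ^ (m - h) * t = 2 * (2 ^ (m - (h + 1)) * t) := by
    rw [show m - h = m - (h + 1) + 1 by omega, pow_succ]
    ring
  have e7 : T.down h E.ker ≤ G.ker := fun z hz => by
    obtain ⟨hz1, hz2⟩ := mem_down.1 hz
    rw [LinearMap.mem_ker] at hz1 hz2 ⊢
    change T.comp₁ h E (T.θ h z) = 0
    rw [comp₁_apply, T.invol, hz1, ← smul_eq_mul, ← smul_eq_mul, hz2]
    simp
  -- The `up` space has dimension at most 2^m, so the `down` space of the kernel has codimension at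
  -- most twice the rank of E over K, which is exactly the rank of G.
  have e8 : T.down h E.ker = G.ker := Submodule.eq_of_le_of_finrank_le e7 (by
    rw [e5] at e2
    omega)
  have e9 : x ∈ T.down h E.ker := by
    rw [e8]
    exact hx
  rw [comp₀_apply, hx, sub_zero]
  exact (mem_down.1 e9).1

/-- The vector g(z) lies in the column space of g, where the coordinates at the pivots are the
coefficients with respect to the reduced basis. Hence the rows of g at these pivots suffice to cut
out its kernel. -/
lemma eq_zero_of_coef_pivots {h : ℕ} (hm : h ≤ m) {g : L →ₗ[K] L} (hg : T.FLin h g)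
    {W : List ((Fin h → Bool) × L × L)} {R : List L} (hW : T.Reduced h W)
    (hspan : T.rowSpan h [] W R =
      T.rowSpan h ((Finset.univ.toList.map fun p => g (T.bm h p)).map fun v => (v, 0)) [] [])
    {z : L} (hz : ∀ a ∈ W, T.coef h a.1 (g z) = 0) : g z = 0 := by
  have h1 : (g z, 0) ∈ T.rowSpan h [] W R := by
    rw [hspan, hg.apply_eq hm z]
    have e1 : ((∑ p, T.coef h p z * g (T.bm h p), 0) : L × L) =
        ∑ p, (T.coef h p z * g (T.bm h p), T.coef h p z * 0) := by
      ext
      · rw [Prod.fst_sum]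
      · rw [Prod.snd_sum]; simp
    rw [e1]
    refine sum_mem fun p _ => mul_mem_pair _ (T.coef_mem hm _ _)
      ((contains_rowSpan _ _ _).1 (g (T.bm h p), 0) ?_)
    simp
  have h2 := ((mem_rowSpan_iff hm hW).1 h1).1
  have h3 : (W.map fun a => T.coef h a.1 (g z) * a.2.1).sum = 0 := by
    refine List.sum_eq_zero fun y hy => ?_
    obtain ⟨a, ha, rfl⟩ := List.mem_map.1 hy
    rw [hz a ha, zero_mul]
  rw [remainder] at h2
  simpa [h3] using h2

lemma finrank_span_columns {h : ℕ} (hm : h ≤ m) {g : L →ₗ[K] L} (hg : T.FLin h g) :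
    2 ^ (m - h) * finrank (T.F h) (Submodule.span (T.F h)
      {x | x ∈ (Finset.univ.toList.map fun p => g (T.bm h p))}) = finrank K g.range := by
  rw [← finrank_restrictScalars hm]
  suffices T.vspan h (Finset.univ.toList.map fun p => g (T.bm h p)) = g.range by
    rw [← this]; rfl
  apply le_antisymm
  · have hst : T.Stable h g.range := by
      rintro c hc _ ⟨x, rfl⟩
      exact ⟨c * x, hg c hc x⟩
    refine (vspan_le hst).2 fun x hx => ?_
    obtain ⟨p, -, rfl⟩ := List.mem_map.1 hx
    exact ⟨_, rfl⟩
  · rintro _ ⟨x, rfl⟩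
    rw [hg.apply_eq hm x]
    exact sum_mem fun p _ => stable_vspan h _ _ (T.coef_mem hm p x) _
      (mem_vspan (List.mem_map.2 ⟨p, by simp, rfl⟩))

end QuadTower

/-! ### The decoding recursion on the machine -/

namespace LMachine

open QuadTower Module

variable {K : Type u} {L : Type v} [Field K] [Field L] [Algebra K L] {m : ℕ}
  {T : QuadTower K L m} {Ω : Type w} {M : LMachine T Ω}

/-- The cost of decoding. -/
def decodeCost (m t : ℕ) : ℕ → ℕ → ℕ
  | 0, h => baseCost m (2 * t) h + 2 * 2 ^ h
  | _ + 1, 0 => 0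
  | r + 1, h + 1 => decodeCost m t r h + eraseCost m t h + (t + 1) * (20 * 2 ^ h + 5 * m + 8)

/-- There is one recursive call of half the size, so the level costs form a geometric series. The
constants come from order zero with D = 2t: 98 = 2(29 + 20) and 112 = 2 · 55 + 2. -/
lemma decodeCost_le (m t r h : ℕ) (hm : h ≤ m) :
    decodeCost m t r h ≤ (t + 1) * (2 ^ h * (98 * m + 112)) := by
  induction r generalizing h with
  | zero =>
    rw [decodeCost]
    have h1 := baseCost_le m (2 * t) h
    have h2 : (2 * t + 1) * (2 ^ h * (29 * h + (20 * m + 55))) ≤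
      (2 * t + 1) * (2 ^ h * (49 * m + 55)) :=
      Nat.mul_le_mul_left _ (Nat.mul_le_mul_left _ (by omega))
    have h3 : (t + 1) * (2 ^ h * (98 * m + 112)) = (2 * t + 1) * (2 ^ h * (49 * m + 55)) +
      2 * (t * 2 ^ h) + 2 ^ h * (49 * m + 55) + 2 * 2 ^ h := by ring
    have h4 := Nat.zero_le (t * 2 ^ h)
    omega
  | succ r ih =>
    cases h with
    | zero => rw [decodeCost]; positivity
    | succ h =>
      have h1 := ih h (by omega)
      have h2 := (Nat.le_add_right _ _).trans (eraseCost_le m t h)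
      have h3 : (t + 1) * (2 ^ h * (12 * h + (5 * m + 24))) ≤ (t + 1) * (2 ^ h * (17 * m + 24)) :=
        Nat.mul_le_mul_left _ (Nat.mul_le_mul_left _ (by omega))
      have h4 : (t + 1) * (20 * 2 ^ h + 5 * m + 8) ≤ (t + 1) * (2 ^ h * (5 * m + 28)) := by
        gcongr
        have : 1 ≤ 2 ^ h := Nat.one_le_two_pow
        nlinarith
      have h5 : (t + 1) * (2 ^ (h + 1) * (98 * m + 112)) = (t + 1) * (2 ^ h * (98 * m + 112)) +
        (t + 1) * (2 ^ h * (17 * m + 24)) + (t + 1) * (2 ^ h * (5 * m + 28)) +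
        (t + 1) * (2 ^ h * (76 * m + 60)) := by ring
      rw [decodeCost]
      omega

/-- Decoding of a Reed–Muller map with an error all of whose iterated components have the same
small rank. -/
theorem run_decode (t : Ω → ℕ) (r h : ℕ) (hr : r ≤ h) (hm : h ≤ m) {c : Ω → ℕ} {s : M.St}
    {Y N : Ω → L →ₗ[K] L} (hY : ∀ p, M.Kn s fun ω => Y ω (T.bm h p))
    (hyp : ∀ ω ∈ M.dom s, T.RM h r (N ω) ∧ T.FLin h (Y ω) ∧
      T.RankChain (t ω) r h (Y ω - N ω) ∧ 2 * t ω < 2 ^ (h - r))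
    (hc : ∀ s', s ≤ s' → (∀ p, M.Kn s' fun ω => N ω (T.bm h p)) → M.Run s' c) :
    M.Run s fun ω => c ω + decodeCost m (t ω) r h := by
  induction r generalizing h s c Y N with
  | zero =>
    exact run_base_decode t hm hY (fun ω hω => ⟨(hyp ω hω).1, (hyp ω hω).2.1, (hyp ω hω).2.2.1,
      (hyp ω hω).2.2.2⟩) hc
  | succ r ih =>
    obtain ⟨h, rfl⟩ : ∃ k, h = k + 1 := ⟨h - 1, by omega⟩
    have hlt : h < m := hm
    let G : Ω → L →ₗ[K] L := fun ω => T.comp₁ h (Y ω - N ω)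
    have hG : ∀ ω ∈ M.dom s, T.FLin h (G ω) ∧ finrank K (G ω).range = 2 ^ (m - h) * t ω ∧
        T.RankChain (t ω) r h (G ω) ∧ finrank K (Y ω - N ω).range = 2 ^ (m - (h + 1)) * t ω :=
      fun ω hω => by
        obtain ⟨e1, e2, e3, -⟩ := hyp ω hω
        exact ⟨(e2.sub e1.flin).comp₁ hlt, e3.2.finrank_range, e3.2, e3.1⟩
    have main : M.Run s fun ω => ((((((c ω + 10 * 2 ^ h) + eraseCost m (t ω) h) + t ω * 3) +
        (2 ^ h * (4 * min (t ω) (2 ^ h) + 3) + t ω * (5 * 2 ^ h + 5 * m + 5))) + 2 ^ h * 1) +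
        decodeCost m (t ω) r h) + 6 * 2 ^ h := by
      refine run_components hY fun s₁ h₁ k₁ k₀ => ?_
      refine ih h (by omega) hlt.le (Y := fun ω => T.comp₁ h (Y ω))
        (N := fun ω => T.comp₁ h (N ω)) k₁ (fun ω hω => ?_) fun s₂ h₂ k₂ => ?_
      · have hω₀ := M.dom_anti h₁ hω
        obtain ⟨e1, e2, e3, e4⟩ := hyp ω hω₀
        refine ⟨e1.comp₁ hlt, e2.comp₁ hlt, ?_, ?_⟩
        · rw [← comp₁_sub]
          exact (hG ω hω₀).2.2.1
        · rwa [Nat.add_sub_add_right] at e4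
      have h₀₂ := h₁.trans h₂
      have hfam : M.Run s₂ fun ω => (((((c ω + 10 * 2 ^ h) + eraseCost m (t ω) h) + t ω * 3) +
        (2 ^ h * (4 * min (t ω) (2 ^ h) + 3) + t ω * (5 * 2 ^ h + 5 * m + 5)))) +
          Fintype.card (Fin h → Bool) * 1 := by
        refine run_family (f := fun (p : Fin h → Bool) ω => G ω (T.bm h p)) (fun p => ?_)
          fun s₃ h₃ kG => ?_
        · refine ((Kn.comp (M.kn_mono h₂ (k₁ p))).sub (Kn.comp (k₂ p))).congr fun ω _ => ?_
          simp only [G]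
          rw [comp₁_sub, LinearMap.sub_apply]
        have h₀₃ := h₀₂.trans h₃
        -- Eliminating the columns of the known map G finds its rank many pivot positions; the rows
        -- there describe the kernel.
        let l : List ((Ω → L) × (Ω → L)) :=
          (Finset.univ.toList.map fun p ω => G ω (T.bm h p)).map fun v => (v, fun _ => 0)
        have hev : ∀ ω, evPairs l ω =
            (Finset.univ.toList.map fun p => G ω (T.bm h p)).map fun v => (v, 0) := fun ω => by
          simp [l, evPairs, List.map_map, Function.comp_def]
        have hlen : l.length = 2 ^ h := by simp [l]
        have helim := run_elim hlt.le t l s₃ (c := fun ω => ((c ω + 10 * 2 ^ h) +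
          eraseCost m (t ω) h) + t ω * 3) (fun a ha => ?_) (fun ω hω => ?_) ?_
        · rwa [hlen] at helim
        · simp only [l, List.mem_map] at ha
          obtain ⟨_, ⟨p, -, rfl⟩, rfl⟩ := ha
          exact ⟨kG p, M.kn_zero _⟩
        · rw [hev, map_fst_rowSpan]
          have e1 := finrank_span_columns hlt.le (hG ω (M.dom_anti h₀₃ hω)).1
          rw [(hG ω (M.dom_anti h₀₃ hω)).2.1] at e1
          exact (Nat.eq_of_mul_eq_mul_left (by positivity) e1).le
        · intro s₄ h₄ W R kW kR hWR _
          have h₀₄ := h₀₃.trans h₄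
          let row : ((Fin h → Bool) × (Ω → L) × (Ω → L)) → Ω → L := fun a ω =>
            ∑ q, T.coef h a.1 (G ω (T.bm h q)) * T.bm h q
          have hrow : M.Run s₄ fun ω => ((c ω + 10 * 2 ^ h) + eraseCost m (t ω) h) +
              W.length * 3 := by
            refine run_list W (f := fun a ω => T.θ h (row a ω)) (fun a _ =>
              Kn.comp_θ (M.kn_transpose hlt.le (fun q => M.kn_mono h₄ (kG q)) a.1) hlt)
              fun s₅ h₅ k₅ => ?_
            have h₀₅ := h₀₄.trans h₅
            have h₁₅ := h₂.trans (h₃.trans (h₄.trans h₅))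
            refine run_erase t h (r + 1) hlt.le (B := W.map fun a ω => T.θ h (row a ω))
              (Y := fun ω => T.comp₀ h (Y ω)) (N := fun ω => T.comp₀ h (N ω)) (fun v hv => ?_)
              (fun p => M.kn_mono h₁₅ (k₀ p)) (fun ω hω => ?_) fun s₆ h₆ k₆ => ?_
            · obtain ⟨a, ha, rfl⟩ := List.mem_map.1 hv
              exact k₅ a ha
            · have hω₀ := M.dom_anti h₀₅ hω
              obtain ⟨e1, e2, e3, e4⟩ := hyp ω hω₀
              obtain ⟨g1, g2, g3, g4⟩ := hG ω hω₀
              obtain ⟨w1, w2, w3⟩ := hWR ω (M.dom_anti h₅ hω)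
              rw [hev] at w2
              refine ⟨e1.comp₀ hlt, e2.comp₀ hlt, fun z hz => ?_, ?_, by simpa using w3⟩
              -- The rows are conjugated by θ_h because the relevant kernel is that of G ∘ θ_h.
              · have hz' : G ω (T.θ h z) = 0 := by
                  refine eq_zero_of_coef_pivots hlt.le g1 w1 w2 fun a ha => ?_
                  obtain ⟨b, hb, rfl⟩ := List.mem_map.1 ha
                  have e5 := hz (T.θ h (row b ω)) (List.mem_map.2 ⟨_, List.mem_map.2 ⟨b, hb, rfl⟩, rfl⟩)
                  rw [← dot_row hlt.le g1]
                  have e6 := T.dot_θ (le_refl h) (T.θ h (row b ω)) z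
                  rw [T.invol, e5, map_zero] at e6
                  exact e6
                have e7 := comp₀_eq_zero_of_comp₁ hlt g4 g2 hz'
                rw [comp₀_sub, LinearMap.sub_apply] at e7
                exact sub_eq_zero.1 e7
              · classical
                have e5 : finrank K (T.vspan h (ev (W.map fun a ω => T.θ h (row a ω)) ω)) ≤
                    2 ^ (m - h) * t ω := by
                  rw [vspan, finrank_restrictScalars hlt.le]
                  refine Nat.mul_le_mul_left _ (le_trans ?_ w3)
                  have e6 : {x | x ∈ ev (W.map fun a ω => T.θ h (row a ω)) ω} =
                      ((ev (W.map fun a ω => T.θ h (row a ω)) ω).toFinset : Set L) := by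
                    ext x; simp
                  rw [e6]
                  exact (finrank_span_finset_le_card _).trans
                    ((List.toFinset_card_le _).trans (by simp [ev]))
                refine lt_of_le_of_lt (Nat.mul_le_mul_right _ e5) ?_
                rw [Nat.add_sub_add_right] at e4
                have e7 : 2 ^ m = 2 ^ (m - h) * 2 ^ (h - r) * 2 ^ r := by
                  rw [← pow_add, ← pow_add]; congr 1; omega
                rw [e7]
                calc 2 ^ (m - h) * t ω * 2 ^ (r + 1) = 2 ^ (m - h) * (2 * t ω) * 2 ^ r := by ring
                  _ < _ := by gcongr
            · have h₂₆ := h₃.trans (h₄.trans (h₅.trans h₆))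
              exact run_assemble hlt
                (fun ω hω => (hyp ω (M.dom_anti (h₀₅.trans h₆) hω)).1.flin)
                (fun p => M.kn_mono h₂₆ (k₂ p)) k₆
                fun s₇ h₇ k₇ => hc s₇ (h₀₅.trans (h₆.trans h₇)) k₇
          refine M.run_mono hrow fun ω hω => ?_
          have := (hWR ω hω).2.2
          omega
      refine M.run_mono hfam fun ω _ => ?_
      simp
    refine M.run_mono main fun ω _ => ?_
    rw [decodeCost]
    have h1 : 2 ^ h * (4 * min (t ω) (2 ^ h) + 3) ≤ 2 ^ h * (4 * t ω + 3) :=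
      Nat.mul_le_mul_left _ (by omega)
    generalize 2 ^ h * (4 * min (t ω) (2 ^ h) + 3) = x at *
    generalize 2 ^ h = z at *
    nlinarith [Nat.zero_le (t ω * z)]

end LMachine

/-! ### The machine over the top field given by computation trees over the base field -/

namespace KRun

variable {Ω : Type w} {K : Type u} [Field K] {κ : Type} {G : κ → Ω → K}

lemma of_dom_empty {S : KState Ω K} {c : Ω → ℝ} (h : ∀ ω ∈ S.dom, False) : KRun G S c :=
  .done (fun _ => ⟨_, S.zero_mem, fun ω hω => (h ω hω).elim⟩) fun ω hω => (h ω hω).elim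

/-- Test a finite family for zero. -/
lemma test_family {ι : Type*} [Fintype ι] {S : KState Ω K} {f : ι → Ω → K} (hf : ∀ i, S.Knows (f i))
    {c : Ω → ℝ}
    (hz : ∀ S', S ≤ S' → (∀ ω ∈ S'.dom, ∀ i, f i ω = 0) → KRun G S' c)
    (hn : ∀ S', S ≤ S' → (∀ ω ∈ S'.dom, ∃ i, f i ω ≠ 0) → KRun G S' c) :
    KRun G S fun ω => c ω + Fintype.card ι := by
  have key : ∀ l : List ι, ∀ S', S ≤ S' → (∀ ω ∈ S'.dom, ∀ i, i ∉ l → f i ω = 0) →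
      KRun G S' fun ω => c ω + l.length := by
    intro l
    induction l with
    | nil => exact fun S' h' e => (hz S' h' fun ω hω i => e ω hω i (by simp)).mono fun ω _ => by simp
    | cons a l ih =>
      intro S' h' e
      refine .test (c := fun ω => c ω + l.length) (f a) ((hf a).mono h') ?_ ?_ fun ω _ => ?_
      · refine ih _ (h'.trans (S'.le_restrict _)) fun ω hω i hi => ?_
        by_cases hia : i = a
        · rw [hia]; exact hω.2
        · exact e ω hω.1 i (by simp [hia, hi])
      · refine (hn _ (h'.trans (S'.le_restrict _)) fun ω hω => ⟨a, hω.2⟩).mono fun ω _ => ?_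
        simp
      · rw [List.length_cons]; push_cast; linarith
  simpa using key Finset.univ.toList S le_rfl fun ω _ i hi => absurd (by simp) hi

end KRun

namespace QuadTower

variable {K : Type u} {L : Type v} [Field K] [Field L] [Algebra K L] {m : ℕ} (T : QuadTower K L m)

lemma crd_part {i : ℕ} (hi : i < m) (A : Fin m → Bool) (b : Bool) (x : L) :
    T.crd A (T.part i b x) = if A ⟨i, hi⟩ then 0 else T.crd (Function.update A ⟨i, hi⟩ b) x := by
  have h := T.coef_part_of_lt le_rfl hi A b x
  split_ifs with hA
  · rw [if_pos hA] at h
    exact T.crd_eq_zero h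
  · rw [if_neg hA] at h
    exact T.crd_eq_of_coef_eq h

/-- Expanded over K, a matrix entry is addressed by a column index, h row bits and the remaining
bits. Extracting row p puts the column index in the place of the first h bits and merely selects
existing coordinates. -/
lemma crd_transpose {h : ℕ} (hm : h ≤ m) (p : Fin h → Bool) (A : Fin m → Bool)
    (x : (Fin h → Bool) → L) : T.crd A (∑ B, T.coef h p (x B) * T.bm h B) =
      T.crd (fun i => if hi : i.1 < h then p ⟨i, hi⟩ else A i)
        (x fun i => A (Fin.castLE hm i)) := by
  apply T.crd_eq_of_coef_eq
  rw [T.coef_eq_coef_clear le_rfl hm A, T.coef_sum hm _ fun B => T.coef_mem hm _ _,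
    T.coef_eq_coef_clear le_rfl hm (fun i => if hi : i.1 < h then p ⟨i, hi⟩ else A i)]
  have h1 : clear h A = clear h fun i => if hi : i.1 < h then p ⟨i, hi⟩ else A i := by
    funext i
    simp only [clear]
    split_ifs <;> rfl
  have h2 : p = fun i : Fin h => if hi : (Fin.castLE hm i).1 < h then p ⟨Fin.castLE hm i, hi⟩ else
      A (Fin.castLE hm i) := by
    funext i
    simp
  rw [← h1, ← h2]

lemma crd_of_mem {x : L} (hx : x ∈ T.F m) (A : Fin m → Bool) :
    algebraMap K L (T.crd A x) = if A = fun _ => false then x else 0 := by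
  rw [algebraMap_crd]
  have h := T.coef_bm_mul le_rfl hx A fun _ => false
  rw [show T.bm m (fun _ => false) = 1 by simp [bm], one_mul] at h
  exact h

lemma crd_inv {x : L} (hx : x ∈ T.F m) (A : Fin m → Bool) :
    T.crd A x⁻¹ = if A = fun _ => false then (T.crd A x)⁻¹ else 0 := by
  apply (algebraMap K L).injective
  rw [T.crd_of_mem (inv_mem hx)]
  split_ifs with hA
  · rw [map_inv₀, T.crd_of_mem hx, if_pos hA]
  · rw [map_zero]

end QuadTower

open KRun in
/-- The machine that computes with coordinates over the base field; the unit of cost is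
`2 * mulCost`. -/
noncomputable def LMachine.ofTrees {K : Type u} {L : Type v} [Field K] [Field L] [Algebra K L]
    {m : ℕ} (T : QuadTower K L m) {Ω : Type w} {κ : Type} (G : κ → Ω → K) : LMachine T Ω :=
  have hs : ∀ x : L, ∃ z : (Fin m → Bool) → K, ∑ i, z i • T.bm m i = x :=
    fun x => ⟨fun A => T.crd A x, T.sum_crd x⟩
  -- One unit of cost pays for one operation on each of the 2^m coordinates.
  have hU : ((2 ^ m : ℕ) : ℝ) ≤ ((2 * mulCost K (T.bm m) : ℕ) : ℝ) := by
    have := card_le_two_mul_mulCost hs T.linearIndependent_bm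
    simp only [Fintype.card_fun, Fintype.card_bool, Fintype.card_fin] at this
    exact_mod_cast this
  have hcard : (Fintype.card (Fin m → Bool) : ℝ) ≤ ((2 * mulCost K (T.bm m) : ℕ) : ℝ) := by
    refine le_trans (le_of_eq ?_) hU
    simp
  -- Inverting an element of the base field takes two operations, loading 1 and dividing; the unit
  -- is positive and even.
  have hU2 : (2 : ℝ) ≤ ((2 * mulCost K (T.bm m) : ℕ) : ℝ) := by
    have h1 : ((1 : ℕ) : ℝ) ≤ ((2 ^ m : ℕ) : ℝ) := by exact_mod_cast Nat.one_le_two_pow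
    have h2 := h1.trans hU
    have h3 : 1 ≤ 2 * mulCost K (T.bm m) := by exact_mod_cast h2
    have h4 : 2 ≤ 2 * mulCost K (T.bm m) := by omega
    exact_mod_cast h4
  { St := KState Ω K
    pre := inferInstance
    dom := fun S => S.dom
    Kn := fun S f => ∀ A, S.Knows fun ω => T.crd A (f ω)
    Run := fun S c => KRun G S fun ω => ((2 * mulCost K (T.bm m) : ℕ) : ℝ) * c ω
    dom_anti := fun {S S'} (h : (S : KState Ω K) ≤ S') => h.1
    kn_mono := fun h hf A => (hf A).mono h
    kn_congr := fun hf h A => (hf A).congr fun ω hω => by rw [h ω hω]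
    kn_zero := fun S A => S.knows_zero.congr fun ω _ => (T.crd_eq_zero (map_zero _)).symm
    kn_part := fun {S f i} hf hi b A => by
      simp only [T.crd_part hi]
      split_ifs
      · exact S.knows_zero
      · exact hf _
    kn_transpose := fun {S h} hm f hf p A => by
      simp only [T.crd_transpose hm]
      exact hf _ _
    run_mono := fun h hc => h.mono fun ω hω =>
      mul_le_mul_of_nonneg_left (by exact_mod_cast hc ω hω) (by positivity)
    run_empty := fun h => of_dom_empty h
    run_const := fun {S c} a hc => by
      refine (computes_pi (f := fun A (_ : Ω) => T.crd A a)
        (fun A => computes_const S (T.crd A a)) S le_rfl _ fun S' h' k => hc S' h' k).mono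
        fun ω _ => ?_
      push_cast at hcard ⊢
      linarith
    run_add := fun {S c f g} hf hg hc => by
      refine (computes_pi (f := fun A ω => T.crd A (f ω) + T.crd A (g ω))
        (fun A => computes_arith .add (hf A) (hg A) (by simp)) S le_rfl _
        fun S' h' k => hc S' h' fun A => (k A).congr fun ω _ => (T.crd_add A _ _).symm).mono
        fun ω _ => ?_
      push_cast at hcard ⊢
      linarith
    run_sub := fun {S c f g} hf hg hc => by
      refine (computes_pi (f := fun A ω => T.crd A (f ω) - T.crd A (g ω))
        (fun A => computes_arith .sub (hf A) (hg A) (by simp)) S le_rfl _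
        fun S' h' k => hc S' h' fun A => (k A).congr fun ω _ => (T.crd_sub A _ _).symm).mono
        fun ω _ => ?_
      push_cast at hcard ⊢
      linarith
    run_mul := fun {S c f g} hf hg hc => by
      obtain ⟨P, hP, hPs⟩ := mulCost_spec hs
      have henv : ∀ ω, (fun a => Sum.elim (Sum.elim (fun A ω => T.crd A (f ω))
          fun A ω => T.crd A (g ω)) (fun _ _ => 0) a ω) =
          Prog.init (Sum.elim (fun A => T.crd A (f ω)) fun A => T.crd A (g ω)) := fun ω => by
        funext a
        rcases a with (A | A) | d <;> rfl
      refine (of_prog P hP (fun A ω => T.crd A (f ω * g ω)) _ S (mulCost K (T.bm m))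
        (Sum.elim (Sum.elim (fun A ω => T.crd A (f ω)) fun A ω => T.crd A (g ω)) fun _ _ => 0)
        (fun a => ?_) (fun ω _ => ?_) fun S' h' k => hc S' h' k).mono fun ω _ => ?_
      · rcases a with (A | A) | d
        · exact hf A
        · exact hg A
        · exact S.knows_zero
      · rw [henv]
        obtain ⟨h1, z, h2, h3⟩ := hPs (fun A => T.crd A (f ω)) fun A => T.crd A (g ω)
        rw [T.sum_crd, T.sum_crd] at h3
        have h4 : z = fun A => T.crd A (f ω * g ω) := by
          funext A
          rw [← h3, T.crd_sum_smul]
        exact ⟨h4 ▸ h2, h1⟩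
      · have : (0 : ℝ) ≤ mulCost K (T.bm m) := by positivity
        push_cast
        linarith
    run_base_inv := fun {S c f} hf h0 hc => by
      refine ((computes_const S (1 : K)).trans (n' := 1) (fun S' h' k =>
        computes_arith .div (k ()) ((hf fun _ => false).mono h') fun _ ω hω hz => ?_) S le_rfl
          _ fun S' h' k => hc S' h' fun A => ?_).mono fun ω _ => ?_
      · have h1 := T.crd_of_mem (h0 ω (h'.1 hω)).1 fun _ => false
        rw [hz, if_pos rfl, map_zero] at h1
        exact (h0 ω (h'.1 hω)).2 h1.symm
      · by_cases hA : A = fun _ => false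
        · refine (k ()).congr fun ω hω => ?_
          rw [T.crd_inv (h0 ω (h'.1 hω)).1, if_pos hA, hA]
          simp [ArithOp.eval]
        · refine S'.knows_zero.congr fun ω hω => ?_
          rw [T.crd_inv (h0 ω (h'.1 hω)).1, if_neg hA]
      · push_cast at hU2 ⊢
        linarith
    run_test := fun {S c f} hf hz hn => by
      refine (test_family hf
        (fun S' h' e => hz S' h' fun ω hω => T.eq_zero_of_crd (e ω hω))
        fun S' h' e => hn S' h' fun ω hω h0 => ?_).mono fun ω _ => ?_
      · obtain ⟨A, hA⟩ := e ω hω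
        exact hA (by rw [h0]; exact T.crd_eq_zero (map_zero _))
      · push_cast at hcard ⊢
        linarith }

/-! ### Matrices of linear maps and foldings -/

open Matrix in
lemma Matrix.rank_map_of_eq_transvec {F R n : Type*} [Field F] [Field R] [Fintype n]
    [DecidableEq n] [DecidableEq F] (f : F →+* R) {P Q : List (TransvectionStruct n F)} {D : n → F}
    {A : Matrix n n F} (hA : A = (P.map TransvectionStruct.toMatrix).prod * diagonal D *
      (Q.map TransvectionStruct.toMatrix).prod) :
    (A.map f).rank = Fintype.card {i // D i ≠ 0} := by
  classical
  have hdet : ∀ l : List (TransvectionStruct n F),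
      IsUnit ((l.map TransvectionStruct.toMatrix).prod.map f).det := fun l => by
    have h := f.map_det (l.map TransvectionStruct.toMatrix).prod
    rw [RingHom.mapMatrix_apply] at h
    rw [← h, TransvectionStruct.det_toMatrix_prod, map_one]
    exact isUnit_one
  rw [hA, Matrix.map_mul, Matrix.map_mul, rank_mul_eq_left_of_isUnit_det _ _ (hdet Q),
    rank_mul_eq_right_of_isUnit_det _ _ (hdet P), diagonal_map (map_zero f), rank_diagonal]
  exact Fintype.card_congr (Equiv.subtypeEquivRight fun i => by simp)

/-- Transvections over F bring A to diagonal form, and they remain invertible over L. -/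
lemma Matrix.rank_map_algebraMap {F L n : Type*} [Field F] [Field L] [Algebra F L] [Fintype n]
    [DecidableEq n] (A : Matrix n n F) : (A.map (algebraMap F L)).rank = A.rank := by
  classical
  obtain ⟨P, Q, D, hD⟩ := Matrix.Pivot.exists_list_transvec_mul_diagonal_mul_list_transvec A
  have h := rank_map_of_eq_transvec (RingHom.id F) hD
  rw [RingHom.coe_id, Matrix.map_id] at h
  rw [h, rank_map_of_eq_transvec _ hD]

namespace QuadTower

open Module

variable {K : Type u} {L : Type v} [Field K] [Field L] [Algebra K L] {m : ℕ} (T : QuadTower K L m)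

/-- The matrix over `F h` of a linear map with respect to `bm h`. -/
def mat (h : ℕ) (g : L →ₗ[K] L) : Matrix (Fin h → Bool) (Fin h → Bool) L :=
  Matrix.of fun A B => T.coef h A (g (T.bm h B))

variable {T}

lemma finrank_range_eq {h : ℕ} (hm : h ≤ m) {g : L →ₗ[K] L} (hg : T.FLin h g) :
    finrank K g.range = 2 ^ (m - h) * (T.mat h g).rank := by
  classical
  let f : L →ₗ[T.F h] L :=
    { toFun := g
      map_add' := map_add g
      map_smul' := fun c x => hg c c.2 x }
  let b : Basis (Fin h → Bool) (T.F h) L := Basis.ofEquivFun (T.coefEquiv hm)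
  have hb : ∀ B, b B = T.bm h B := fun B => by
    simp [b, coefEquiv, Pi.single_apply, apply_ite]
  have h1 : T.mat h g = (LinearMap.toMatrix b b f).map (algebraMap (T.F h) L) := by
    ext A B
    rw [Matrix.map_apply, LinearMap.toMatrix_apply, hb]
    rfl
  rw [h1, Matrix.rank_map_algebraMap, Matrix.rank_eq_finrank_range_toLin _ b b,
    Matrix.toLin_toMatrix, ← T.finrank_F hm]
  have h2 : g.range = (LinearMap.range f).restrictScalars K := by
    ext x; rfl
  rw [h2]
  exact (finrank_mul_finrank K (T.F h) (LinearMap.range f)).symm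

variable (T)

lemma blockFold_smul {k : ℕ} (a b : Bool → L) (u : L)
    (E : Matrix (Fin (k + 1) → Bool) (Fin (k + 1) → Bool) L) :
    blockFold a b (u • E) = u • blockFold a b E := by
  ext A B
  simp only [blockFold, Matrix.of_apply, Matrix.smul_apply, smul_eq_mul, Finset.mul_sum]
  exact Finset.sum_congr rfl fun _ _ => Finset.sum_congr rfl fun _ _ => by ring

lemma fold_smul {k : ℕ} (a u : L) (E : Matrix (Fin (k + 1) → Bool) (Fin (k + 1) → Bool) L) :
    fold a (u • E) = u • fold a E := by
  unfold fold
  split_ifs <;> exact blockFold_smul _ _ u E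

lemma mat_snoc {h : ℕ} (g : L →ₗ[K] L) (A B : Fin h → Bool) (x y : Bool) :
    T.mat (h + 1) g (Fin.snoc (α := fun _ => Bool) A x) (Fin.snoc (α := fun _ => Bool) B y) =
      T.part h x (T.coef h A (g (T.bm h B * if y then T.γ h else 1))) := by
  rw [mat, Matrix.of_apply, coef_snoc, bm_snoc]

lemma mat_comp₁ {h : ℕ} (g : L →ₗ[K] L) (A B : Fin h → Bool) :
    T.mat h (T.comp₁ h g) A B = (T.θ h (T.γ h) - T.γ h)⁻¹ *
      (T.coef h A (g (T.bm h B * T.γ h)) - T.γ h * T.coef h A (g (T.bm h B))) := by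
  have hF : (T.θ h (T.γ h) - T.γ h)⁻¹ ∈ T.F h :=
    inv_mem (sub_mem (T.θ_mem T.γ_mem _) T.γ_mem)
  rw [mat, Matrix.of_apply, comp₁_apply, T.θ_bm le_rfl, T.coef_mul hF, map_sub,
    T.coef_mul T.γ_mem, mul_comm (T.γ h) (T.bm h B)]

/-- The left factor of the folding reassembles a coefficient over F_h from its two parts, up to a
power of γ. The right factor forms g(b) - γ⁻¹ g(γb), in characteristic 2 with the equal sign +,
which is proportional to the commutator g(γb) - γ g(b) defining `comp₁`. -/
lemma exists_fold_eq_smul {h : ℕ} (hm : h < m) (g : L →ₗ[K] L) :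
    ∃ u : L, u ≠ 0 ∧ fold (T.γ h) (T.mat (h + 1) g) = u • T.mat h (T.comp₁ h g) := by
  have hγ := T.γ_ne hm
  have hne := T.sub_ne' hm
  by_cases h2 : ringChar L = 2
  · have : CharP L 2 := h2 ▸ ringChar.charP L
    refine ⟨(T.γ h)⁻¹ * (T.θ h (T.γ h) - T.γ h), mul_ne_zero (inv_ne_zero hγ) hne, ?_⟩
    ext A B
    rw [fold, if_pos h2, Matrix.smul_apply, mat_comp₁, blockFold, Matrix.of_apply]
    simp only [Fintype.sum_bool, mat_snoc, if_true, Bool.false_eq_true, if_false, mul_one, one_mul]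
    have e1 := T.part_add_part h (T.coef h A (g (T.bm h B)))
    have e2 := T.part_add_part h (T.coef h A (g (T.bm h B * T.γ h)))
    have e3 : ∀ z : L, z - T.γ h * T.coef h A (g (T.bm h B)) =
      z + T.γ h * T.coef h A (g (T.bm h B)) := fun z => by rw [CharTwo.sub_eq_add]
    rw [e3, smul_eq_mul]
    conv_rhs => rw [← e1, ← e2]
    field_simp
    ring
  · refine ⟨-((T.γ h)⁻¹ ^ 2 * (T.θ h (T.γ h) - T.γ h)),
      neg_ne_zero.2 (mul_ne_zero (pow_ne_zero _ (inv_ne_zero hγ)) hne), ?_⟩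
    ext A B
    rw [fold, if_neg h2, Matrix.smul_apply, mat_comp₁, blockFold, Matrix.of_apply]
    simp only [Fintype.sum_bool, mat_snoc, if_true, Bool.false_eq_true, if_false, mul_one, one_mul]
    have e1 := T.part_add_part h (T.coef h A (g (T.bm h B)))
    have e2 := T.part_add_part h (T.coef h A (g (T.bm h B * T.γ h)))
    rw [smul_eq_mul]
    conv_rhs => rw [← e1, ← e2]
    field_simp
    ring

variable {T}

/-- Folding is linear, so the nonzero scalars met on the way accumulate in one factor u, which does
not affect ranks. -/
lemma rankChain_of_foldings {t : ℕ} (r h : ℕ) (hm : h ≤ m) {g : L →ₗ[K] L} (hg : T.FLin h g)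
    {u : L} (hu : u ≠ 0)
    (H : FoldingsHaveRank t r h (fun i : Fin h => T.γ i) (u • T.mat h g)) :
    T.RankChain t r h g := by
  have hr : ∀ {h : ℕ} {g : L →ₗ[K] L} {u : L}, h ≤ m → T.FLin h g → u ≠ 0 →
      (u • T.mat h g).rank = t → finrank K g.range = 2 ^ (m - h) * t := by
    intro h g u hm hg hu H
    rw [finrank_range_eq hm hg, ← H,
      Matrix.rank_smul_of_mem_nonZeroDivisors _ (mem_nonZeroDivisors_of_ne_zero hu)]
  induction r generalizing h g u with
  | zero => exact hr hm hg hu H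
  | succ r ih =>
    cases h with
    | zero => exact hr hm hg hu H
    | succ h =>
      obtain ⟨h1, h2, -⟩ := H
      refine ⟨hr hm hg hu h1, ?_⟩
      obtain ⟨u', hu', e⟩ := T.exists_fold_eq_smul (show h < m by omega) g
      refine ih h (by omega) (hg.comp₁ (by omega)) (mul_ne_zero hu hu') ?_
      rw [mul_smul, ← e, ← fold_smul]
      exact h2

variable (T)

/-- The linear map with a given matrix over `K` with respect to `bm m`. -/
noncomputable def ofMat (Y : Matrix (Fin m → Bool) (Fin m → Bool) K) : L →ₗ[K] L :=
  ∑ B, ∑ A, LinearMap.mulLeft K (Y A B • T.bm m A) ∘ₗ T.coef m B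

lemma ofMat_bm (Y : Matrix (Fin m → Bool) (Fin m → Bool) K) (B : Fin m → Bool) :
    T.ofMat Y (T.bm m B) = ∑ A, Y A B • T.bm m A := by
  simp only [ofMat, LinearMap.sum_apply, LinearMap.comp_apply, LinearMap.mulLeft_apply,
    T.coef_bm le_rfl, mul_ite, mul_one, mul_zero]
  rw [Finset.sum_comm]
  simp

lemma crd_ofMat_bm (Y : Matrix (Fin m → Bool) (Fin m → Bool) K) (A B : Fin m → Bool) :
    T.crd A (T.ofMat Y (T.bm m B)) = Y A B := by
  rw [ofMat_bm, crd_sum_smul]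

lemma flin_top (g : L →ₗ[K] L) : T.FLin m g := by
  intro c hc x
  obtain ⟨a, rfl⟩ := T.base c hc
  rw [← Algebra.smul_def, map_smul, Algebra.smul_def]

lemma ofMat_add (X Y : Matrix (Fin m → Bool) (Fin m → Bool) K) :
    T.ofMat (X + Y) = T.ofMat X + T.ofMat Y := by
  refine FLin.ext le_rfl (T.flin_top _) (T.flin_top _) fun B => ?_
  simp [ofMat_bm, add_smul, Finset.sum_add_distrib]

lemma mat_ofMat (Y : Matrix (Fin m → Bool) (Fin m → Bool) K) :
    T.mat m (T.ofMat Y) = Y.map (algebraMap K L) := by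
  ext A B
  rw [mat, Matrix.of_apply, ← algebraMap_crd, crd_ofMat_bm, Matrix.map_apply]

end QuadTower

/-! ### The tower of an adapted family of generators -/

section Adapted

variable {K : Type u} {L : Type v} [Field K] [Field L] [Algebra K L]

/-- The product of the `θ i` with `A i = true`. -/
def galWord (θ : ℕ → L ≃ₐ[K] L) : (h : ℕ) → (Fin h → Bool) → L ≃ₐ[K] L
  | 0, _ => 1
  | h + 1, A => galWord θ h (Fin.init A) * if A (Fin.last h) then θ h else 1

lemma galWord_snoc (θ : ℕ → L ≃ₐ[K] L) {h : ℕ} (A : Fin h → Bool) (b : Bool) :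
    galWord θ (h + 1) (Fin.snoc (α := fun _ => Bool) A b) =
      galWord θ h A * if b then θ h else 1 := by
  rw [galWord, Fin.init_snoc, Fin.snoc_last]

lemma galWord_false (θ : ℕ → L ≃ₐ[K] L) (h : ℕ) : galWord θ h (fun _ => false) = 1 := by
  induction h with
  | zero => rfl
  | succ h ih =>
    have : Fin.init (fun _ : Fin (h + 1) => false) = fun _ => false := rfl
    rw [galWord, this, ih]
    simp

lemma galWord_fixed (θ : ℕ → L ≃ₐ[K] L) {h : ℕ} {x : L} (hx : ∀ i < h, θ i x = x)
    (A : Fin h → Bool) : galWord θ h A x = x := by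
  induction h with
  | zero => rfl
  | succ h ih =>
    rw [galWord, AlgEquiv.mul_apply]
    split_ifs
    · rw [hx h (by omega), ih fun i hi => hx i (by omega)]
    · exact ih (fun i hi => hx i (by omega)) _

variable {m : ℕ} (e : (L ≃ₐ[K] L) ≃* Multiplicative (Fin m → ZMod 2))

/-- The generators `galGen`, continued by the identity. -/
def galSeq (i : ℕ) : L ≃ₐ[K] L := if h : i < m then galGen e ⟨i, h⟩ else 1

lemma toAdd_galWord {h : ℕ} (hm : h ≤ m) (A : Fin h → Bool) (i : Fin m) :
    Multiplicative.toAdd (e (galWord (galSeq e) h A)) i =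
      if hi : i.1 < h then (if A ⟨i, hi⟩ then 1 else 0) else 0 := by
  induction h with
  | zero => simp [galWord]
  | succ h ih =>
    rw [galWord, map_mul, toAdd_mul, Pi.add_apply, ih (by omega)]
    have hl : Multiplicative.toAdd (e (if A (Fin.last h) then galSeq e h else 1)) i =
        if i.1 = h ∧ A (Fin.last h) then 1 else 0 := by
      cases hA : A (Fin.last h)
      · simp
      · simp [galSeq, galGen, show h < m by omega, Pi.single_apply, Fin.ext_iff]
    rw [hl]
    rcases lt_trichotomy i.1 h with hi | hi | hi
    · rw [dif_pos hi, dif_pos (by omega), if_neg (c := i.1 = h ∧ _) (fun h' => hi.ne h'.1),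
        add_zero]
      rfl
    · have hi' : (⟨i.1, by omega⟩ : Fin (h + 1)) = Fin.last h := Fin.ext hi
      rw [dif_neg (by omega), dif_pos (show i.1 < h + 1 by omega), zero_add, hi']
      simp only [hi, true_and]
    · rw [dif_neg (by omega), dif_neg (by omega), if_neg (fun h' => hi.ne' h'.1), add_zero]

/-- Every automorphism is a word in the generators in a unique way. -/
noncomputable def galEquiv : (Fin m → Bool) ≃ (L ≃ₐ[K] L) :=
  Equiv.ofBijective (galWord (galSeq e) m) (by
    constructor
    · intro A B hAB
      funext i
      have h := toAdd_galWord e le_rfl A i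
      rw [hAB, toAdd_galWord e le_rfl B i, dif_pos i.2, dif_pos i.2] at h
      revert h
      cases A ⟨i, i.2⟩ <;> cases B ⟨i, i.2⟩ <;> simp
    · intro g
      refine ⟨fun i => decide (Multiplicative.toAdd (e g) i = 1), e.injective ?_⟩
      refine Multiplicative.toAdd.injective (funext fun i => ?_)
      rw [toAdd_galWord e le_rfl, dif_pos i.2]
      generalize Multiplicative.toAdd (e g) i = z
      revert z
      decide)

lemma galWeight_galEquiv (A : Fin m → Bool) :
    galWeight e (galEquiv e A) = (Finset.univ.filter fun i => A i = true).card := by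
  rw [galWeight, hammingNorm]
  congr 1
  ext i
  simp only [Finset.mem_filter, Finset.mem_univ, true_and]
  rw [show galEquiv e A = galWord (galSeq e) m A from rfl, toAdd_galWord e le_rfl, dif_pos i.2]
  simp

variable {e}

/-- The tower of an adapted family of generators. -/
def IsAdapted.tower [FiniteDimensional K L] [IsGalois K L] {γ : Fin m → L} (hγ : IsAdapted e γ) :
    QuadTower K L m where
  γ i := if h : i < m then γ ⟨i, h⟩ else 0
  θ := galSeq e
  fix i j hij := by
    by_cases hj : j < m
    · by_cases hi : i < m
      · simp only [galSeq, dif_pos hi, dif_pos hj]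
        have hne : (⟨i, hi⟩ : Fin m) ≠ ⟨j, hj⟩ := fun h => hij (congrArg Fin.val h)
        by_cases h2 : ringChar K = 2
        · rw [(hγ.artinSchreier h2 _).2, if_neg hne]
        · rw [(hγ.kummer h2 _).2.2, if_neg hne]
      · simp [galSeq, dif_neg hi]
    · simp [dif_neg hj]
  ne i hi := by
    simp only [galSeq, dif_pos hi]
    by_cases h2 : ringChar K = 2
    · rw [(hγ.artinSchreier h2 _).2, if_pos rfl]
      simp
    · rw [(hγ.kummer h2 _).2.2, if_pos rfl]
      intro h0
      -- Outside characteristic 2, -γ = γ only for γ = 0.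
      have h3 : ringChar L ≠ 2 := by rwa [← Algebra.ringChar_eq K L]
      exact (hγ.kummer h2 ⟨i, hi⟩).1 ((Ring.eq_self_iff_eq_zero_of_char_ne_two h3).1 h0)
  invol i x := by
    by_cases hi : i < m
    · simp only [galSeq, dif_pos hi, ← AlgEquiv.mul_apply]
      have : galGen e ⟨i, hi⟩ * galGen e ⟨i, hi⟩ = 1 := by
        rw [galGen, ← map_mul, ← ofAdd_add, ← Pi.single_add]
        have : (1 + 1 : ZMod 2) = 0 := rfl
        rw [this, Pi.single_zero, ofAdd_zero, map_one]
      rw [this, AlgEquiv.one_apply]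
    · simp [galSeq, dif_neg hi]
  comm i j x := by
    rw [← AlgEquiv.mul_apply, ← AlgEquiv.mul_apply]
    congr 1
    apply e.injective
    rw [map_mul, map_mul, mul_comm]
  base x hx := by
    rw [RingHom.mem_range]
    refine (IsGalois.mem_range_algebraMap_iff_fixed x).2 fun g => ?_
    rw [← (galEquiv e).apply_symm_apply g]
    exact galWord_fixed _ hx _

end Adapted

/-! ### Codewords as Reed–Muller maps -/

namespace QuadTower

variable {K : Type u} {L : Type v} [Field K] [Field L] [Algebra K L] {m : ℕ} (T : QuadTower K L m)

/-- Words are split by their last letter; removing a letter θ_h lowers the weight by one, which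
matches the two orders in the recursion of `RM`. -/
lemma RM_of_sum {h r : ℕ} {M : L →ₗ[K] L} (c : (Fin h → Bool) → L)
    (hc : ∀ A, c A ≠ 0 → (Finset.univ.filter fun i => A i = true).card ≤ r)
    (hM : ∀ x, M x = ∑ A, c A * galWord T.θ h A x) : T.RM h r M := by
  induction h generalizing r M with
  | zero => exact ⟨c Fin.elim0, fun x => by
      rw [hM, Fintype.sum_eq_single Fin.elim0 fun A hA => absurd (Subsingleton.elim _ _) hA]
      rfl⟩
  | succ h ih =>
    cases r with
    | zero =>
      refine ⟨c fun _ => false, fun x => ?_⟩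
      rw [hM, Finset.sum_eq_single fun _ => false]
      · rw [galWord_false]; rfl
      · intro A _ hA
        by_cases h0 : c A = 0
        · rw [h0, zero_mul]
        · refine absurd (funext fun i => ?_) hA
          have := hc A h0
          rw [Nat.le_zero, Finset.card_eq_zero, Finset.filter_eq_empty_iff] at this
          simpa using this (Finset.mem_univ i)
      · simp
    | succ r =>
      have hcard : ∀ (A : Fin h → Bool) (b : Bool), (Finset.univ.filter fun i =>
          Fin.snoc (α := fun _ => Bool) A b i = true).card =
          (Finset.univ.filter fun i => A i = true).card + if b then 1 else 0 := by
        intro A b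
        simp only [Finset.card_filter, Fin.sum_univ_castSucc, Fin.snoc_castSucc, Fin.snoc_last]
      let N (b : Bool) : L →ₗ[K] L := ∑ A, LinearMap.mulLeft K
        (c (Fin.snoc (α := fun _ => Bool) A b)) ∘ₗ (galWord T.θ h A).toLinearMap
      have hN : ∀ b x, N b x = ∑ A, c (Fin.snoc (α := fun _ => Bool) A b) * galWord T.θ h A x := by
        intro b x
        simp [N, LinearMap.sum_apply]
      refine ⟨N false, N true, ih _ (fun A hA => ?_) (hN false), ih _ (fun A hA => ?_) (hN true),
        fun x => ?_⟩
      · simpa [hcard] using hc _ hA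
      · simpa [hcard] using hc _ hA
      · rw [hM, Fintype.sum_snoc_bool, hN, hN, ← Finset.sum_add_distrib]
        refine Finset.sum_congr rfl fun A _ => ?_
        rw [Fintype.sum_bool, galWord_snoc, galWord_snoc, add_comm]
        simp

end QuadTower

section Adapted

variable {K : Type u} {L : Type v} [Field K] [Field L] [Algebra K L] [FiniteDimensional K L]
  [IsGalois K L] {m : ℕ} {e : (L ≃ₐ[K] L) ≃* Multiplicative (Fin m → ZMod 2)} {γ : Fin m → L}

lemma IsAdapted.bm_tower (hγ : IsAdapted e γ) : hγ.tower.bm m = mon γ := by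
  funext A
  simp [QuadTower.bm, mon, IsAdapted.tower]

lemma IsAdapted.rm_ofMat (hγ : IsAdapted e γ) {r : ℕ}
    {C : Matrix (Fin m → Bool) (Fin m → Bool) K} (hC : C ∈ rmMatrices e γ r) :
    hγ.tower.RM m r (hγ.tower.ofMat C) := by
  obtain ⟨f, hf, hfC⟩ := hC
  refine hγ.tower.RM_of_sum (fun A => f.coeff (galEquiv e A))
    (fun A hA => by rw [← galWeight_galEquiv e]; exact hf _ hA) fun x => ?_
  have hs : ∀ y : L, skewApply f y = ∑ A, f.coeff (galEquiv e A) * galEquiv e A y := fun y => by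
    rw [skewApply, Finsupp.sum_fintype _ _ fun g => zero_mul _,
      ← (galEquiv e).sum_comp fun g => f.coeff g * g y]
  let N : L →ₗ[K] L := ∑ A, LinearMap.mulLeft K (f.coeff (galEquiv e A)) ∘ₗ
    (galEquiv e A).toLinearMap
  have hN : ∀ y : L, N y = ∑ A, f.coeff (galEquiv e A) * galEquiv e A y := fun y => by
    simp [N, LinearMap.sum_apply]
  have : hγ.tower.ofMat C = N := by
    refine QuadTower.FLin.ext le_rfl (hγ.tower.flin_top _) (hγ.tower.flin_top _) fun B => ?_
    rw [hN, ← hs, QuadTower.ofMat_bm, hγ.bm_tower, hfC]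
  rw [this, hN]
  rfl

end Adapted

/-! ### The decoder -/

lemma DecodesWithin.mono {K : Type u} {L : Type v} [Field K] [Field L] [Algebra K L] {m : ℕ}
    {e : (L ≃ₐ[K] L) ≃* Multiplicative (Fin m → ZMod 2)} {γ : Fin m → L} {r : ℕ} {b b' : ℕ → ℝ} {P}
    (h : DecodesWithin e γ r b P) (hb : ∀ t, b t ≤ b' t) : DecodesWithin e γ r b' P :=
  fun C hC E t ht hE => ⟨(h C hC E t ht hE).1, (h C hC E t ht hE).2.trans (hb t)⟩

/-- For m = 0 the factor log N vanishes and no operation is allowed. But 2t < 1 makes the error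
zero, so the input is returned as it is. -/
lemma exists_decoder_zero {K : Type u} {L : Type v} [Field K] [Field L] [Algebra K L]
    (e : (L ≃ₐ[K] L) ≃* Multiplicative (Fin 0 → ZMod 2)) (γ : Fin 0 → L) :
    ∃ P, P.IsDeterministic ∧ DecodesWithin e γ 0 (fun _ => 0) P := by
  refine ⟨.ret Sum.inl, trivial, fun C _ E t ht hE => ⟨fun k => ?_, le_rfl⟩⟩
  have ht0 : t = 0 := by omega
  subst ht0
  have h0 : E = 0 := by
    rw [FoldingsHaveRank, Matrix.rank_map_algebraMap] at hE
    rw [Matrix.rank, Submodule.finrank_eq_zero, LinearMap.range_eq_bot] at hE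
    exact Matrix.toLin'.injective (by rw [Matrix.toLin'_apply', hE, map_zero])
  rw [h0, add_zero]
  rfl

section Decoder

open LMachine

variable {K : Type u} {L : Type v} [Field K] [Field L] [Algebra K L] [FiniteDimensional K L]
  [IsGalois K L] {m : ℕ} {e : (L ≃ₐ[K] L) ≃* Multiplicative (Fin m → ZMod 2)} {γ : Fin m → L}

/-- The instances of the decoding problem: a codeword, an error and its rank. -/
def decodingInstances (e : (L ≃ₐ[K] L) ≃* Multiplicative (Fin m → ZMod 2)) (γ : Fin m → L) (r : ℕ) :
    Set (Matrix (Fin m → Bool) (Fin m → Bool) K × Matrix (Fin m → Bool) (Fin m → Bool) K × ℕ) :=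
  {ω | ω.1 ∈ rmMatrices e γ r ∧ 2 * ω.2.2 < 2 ^ (m - r) ∧
    FoldingsHaveRank ω.2.2 r m γ (ω.2.1.map (algebraMap K L))}

/-- An instance records codeword, error and t, but initially only zero and the entries of their sum
are known. So t enters the cost and the analysis, never the program. -/
lemma IsAdapted.exists_decoder (hγ : IsAdapted e γ) {r : ℕ} (hr : r ≤ m) :
    ∃ P, P.IsDeterministic ∧ DecodesWithin e γ r
      (fun t => (2 * mulCost K (mon γ) * ((t + 1) * (2 ^ m * (98 * m + 112))) : ℕ)) P := by
  classical
  let T := hγ.tower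
  let Ω := Matrix (Fin m → Bool) (Fin m → Bool) K × Matrix (Fin m → Bool) (Fin m → Bool) K × ℕ
  let G : (Fin m → Bool) × (Fin m → Bool) → Ω → K := fun p ω => ω.1 p.1 p.2
  let S : KState Ω K := ⟨decodingInstances e γ r, insert (fun _ => 0)
    (Set.range fun p : (Fin m → Bool) × (Fin m → Bool) => fun ω : Ω => (ω.1 + ω.2.1) p.1 p.2),
    Set.mem_insert _ _⟩
  have hrun : (LMachine.ofTrees T G).Run S fun ω => 0 + decodeCost m ω.2.2 r m := by
    refine LMachine.run_decode (M := LMachine.ofTrees T G) (fun ω : Ω => ω.2.2) r m hr le_rfl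
      (Y := fun ω => T.ofMat (ω.1 + ω.2.1)) (N := fun ω => T.ofMat ω.1) (c := fun _ => 0)
      (fun p A => ?_) (fun ω hω => ?_) fun s' _ hk => ?_
    · refine ⟨_, Or.inr ⟨(A, p), rfl⟩, fun ω _ => ?_⟩
      exact (T.crd_ofMat_bm _ _ _).symm
    · obtain ⟨h1, h2, h3⟩ := hω
      refine ⟨hγ.rm_ofMat h1, T.flin_top _, ?_, h2⟩
      rw [T.ofMat_add, add_sub_cancel_left]
      refine QuadTower.rankChain_of_foldings r m le_rfl (T.flin_top _) one_ne_zero ?_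
      rw [one_smul, T.mat_ofMat]
      convert h3 using 1
      funext i
      simp [T, IsAdapted.tower]
    · refine KRun.done (fun p => ?_) fun ω _ => by simp
      refine (hk p.2 p.1).congr fun ω _ => T.crd_ofMat_bm _ _ _
  obtain ⟨P, hP, hP'⟩ := KRun.exists_prog hrun 1
    (fun ω : Ω => Prog.init (Function.uncurry (ω.1 + ω.2.1))) (by
      rintro f (rfl | ⟨p, rfl⟩)
      · exact ⟨Sum.inr 0, fun d hd => by cases hd; omega, fun ω _ => rfl⟩
      · exact ⟨Sum.inl p, by simp, fun ω _ => rfl⟩)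
  refine ⟨P, hP, fun C hC E t ht hE => ?_⟩
  obtain ⟨h1, h2⟩ := hP' (C, E, t) ⟨hC, ht, hE⟩
  refine ⟨h1, h2.trans ?_⟩
  have h3 := decodeCost_le m t r m le_rfl
  have h4 : T.bm m = mon γ := hγ.bm_tower
  rw [h4]
  simp only [zero_add]
  exact_mod_cast Nat.mul_le_mul_left (2 * mulCost K (mon γ)) h3

end Decoder

/-- As ω ≥ 2, τ ≤ τ^{ω-1} and t + 1 ≤ 2τ^{ω-1}. As m ≥ 1 and log 2 > 1/2, 98m + 112 ≤ 210m ≤ 420 log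
2^m. Altogether 1680 = 2 · 2 · 420. -/
lemma decoder_cost_le {m : ℕ} (hm : 1 ≤ m) {ω : ℝ} (hω : 2 ≤ ω) (t M : ℕ) :
    ((2 * M * ((t + 1) * (2 ^ m * (98 * m + 112))) : ℕ) : ℝ) ≤
      1680 * ((max t 1 : ℝ) ^ (ω - 1) * 2 ^ m * Real.log (2 ^ m) * M) := by
  have h1 : (1 : ℝ) ≤ max (t : ℝ) 1 := le_max_right _ _
  have h2 : max (t : ℝ) 1 ≤ max (t : ℝ) 1 ^ (ω - 1) := by
    conv_lhs => rw [← Real.rpow_one (max (t : ℝ) 1)]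
    exact Real.rpow_le_rpow_of_exponent_le h1 (by linarith)
  have h3 : (t : ℝ) + 1 ≤ 2 * max (t : ℝ) 1 ^ (ω - 1) := by
    have := le_max_left (t : ℝ) 1
    linarith
  have h4 : (98 * m + 112 : ℝ) ≤ 420 * Real.log (2 ^ m) := by
    rw [Real.log_pow]
    have h5 := Real.log_two_gt_d9
    have h6 : (1 : ℝ) ≤ m := by exact_mod_cast hm
    nlinarith
  push_cast
  calc (2 * M * ((t + 1) * (2 ^ m * (98 * m + 112))) : ℝ)
      ≤ 2 * M * ((2 * max (t : ℝ) 1 ^ (ω - 1)) * (2 ^ m * (420 * Real.log (2 ^ m)))) := by gcongr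
    _ = _ := by ring

theorem mainTheorem5 (α ω cω : ℝ) (cM : ℝ → ℝ) (hα : 1 < α) (hα2 : α ≤ 2) (hω : 2 ≤ ω) :
    ∃ c : ℝ, ∀ (K : Type u) (L : Type v) [Field K] [Field L] [Algebra K L]
      [FiniteDimensional K L] [IsGalois K L] (m r : ℕ)
      (e : (L ≃ₐ[K] L) ≃* Multiplicative (Fin m → ZMod 2)) (γ : Fin m → L),
      r ≤ m → IsAdapted e γ → HasMatMulCost L ω cω →
      (∀ ε : ℝ, 0 < ε → ∀ S : Finset (Fin m),
        (mulCost K (mon fun i : S => γ i) : ℝ) ≤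
          cM ε * (Module.finrank K (IntermediateField.adjoin K (γ '' S)) : ℝ) ^ (α + ε)) →
      (∃ P, P.IsDeterministic ∧
        DecodesWithin e γ r (fun t =>
          c * ((2 ^ m : ℝ) ^ (if α < ω - 1 then ω else α + 1) +
            (max t 1 : ℝ) ^ (ω - 1) * 2 ^ m * Real.log (2 ^ m) * mulCost K (mon γ))) P) ∧
      (∃ P, DecodesWithin e γ r (fun t =>
          c * ((max t 1 : ℝ) ^ (ω - 1) * 2 ^ m * Real.log (2 ^ m) * mulCost K (mon γ))) P) := by
  refine ⟨1680, fun K L _ _ _ _ _ m r e γ hr hγ _ _ => ?_⟩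
  obtain ⟨P, hP, hd⟩ : ∃ P, P.IsDeterministic ∧ DecodesWithin e γ r (fun t =>
      1680 * ((max t 1 : ℝ) ^ (ω - 1) * 2 ^ m * Real.log (2 ^ m) * mulCost K (mon γ))) P := by
    rcases Nat.eq_zero_or_pos m with rfl | hm
    · obtain rfl : r = 0 := by omega
      obtain ⟨P, hP, hd⟩ := exists_decoder_zero e γ
      exact ⟨P, hP, hd.mono fun t => by simp⟩
    · obtain ⟨P, hP, hd⟩ := hγ.exists_decoder hr
      exact ⟨P, hP, hd.mono fun t => decoder_cost_le hm hω t _⟩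
  -- The same deterministic decoder serves both claims; the bound of the first has an additional
  -- nonnegative term.
  refine ⟨⟨P, hP, hd.mono fun t => ?_⟩, P, hd⟩
  rw [mul_add]
  exact le_add_of_nonneg_left (by positivity)
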